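/- Let $n\ge 0$, $A_o,B_o\in M(n,\mathbb C)$, and let $\nabla^o=\mathrm d+\Omega_o$, $\Omega_o=-\left(A_o+\frac1z B_o\right)\mathrm dz$, be the corresponding meromorphic connection on the trivial bundle of rank $n$ on $\mathbb P^1$. For a matrix $M$ write $M'$ for its diagonal and $M''=M-M'$ for its off-diagonal part. **Integrable deformations.** Let $(X,x_o)$ be the germ of a pointed (finite-dimensional) complex manifold. A germ of integrable deformation of $\nabla^o$ over $(X,x_o)$ is the germ of a flat connection $\nabla=\mathrm d+\Omega$ on a holomorphic vector bundle $E$ over $D\times X$, where $D=\{|z|>R\}\cup\{\infty\}$ is a disc centred at $z=\infty$, with a pole of order two (Poincaré rank one) along $\{\infty\}\times X$, whose restriction to $D\times\{x_o\}$ is $\nabla^o$. Thus, in a frame extending the given frame at $x=x_o$, $\Omega=a(\tfrac1z,x)\,\mathrm dz+z\,c(\tfrac1z,x)$, where $a$ is a matrix of holomorphic functions and $c$ a matrix of holomorphic $1$-forms in $x$ near $(0,x_o)$, $\mathrm d\Omega+\Omega\wedge\Omega=0$, and $\Omega$ restricts to $\Omega_o$ at $x=x_o$. Let $\mathfrak I(\nabla^o)$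 be the class of all these germs. The matrix in the frame changed by $G$ is $G^{-1}\Omega G+G^{-1}\mathrm dG$. A holomorphic matrix function $A$ and a holomorphic matrix of $1$-forms $C$ near $x_o$ are the *pole part* and the *deformation part* of the deformation if $A(x_o)=A_o$ and, in a holomorphic frame near $(\infty,x_o)$ that is the given one at $x=x_o$, the matrix of $\nabla$ is $$-\left(A(x)+\tfrac1z B_o\right)\mathrm dz-z\,C(x).\qquad(\ast)$$ A matrix $M$ of functions or of $1$-forms on $X$ is locally holomorphically diagonalizable at $x_o$ if $P^{-1}MP$ is diagonal near $x_o$ for some holomorphic invertible $P$. The following classes consist of the germs in $\mathfrak I(\nabla^o)$ that have a pole part $A$ and a deformation part $C$ as in $(\ast)$ such that: * $\mathfrak I_{\mathrm d}(\nabla^o)$: $A$ and $C$ are locally holomorphically diagonalizable at $x_o$; * $\mathfrak I^{\mathrm{gen}}_{\mathrm d}(\nabla^o)$: moreover, if $\mathrm{diag}(f_1,\dots,f_n)$ is a holomorphic diagonal form of $A$ near $x_o$, then $\mathrm d_{x_o}f_i\ne \mathrm d_{x_o}f_j$ for $i\ne j$; * $\mathfrak I_{\mathrm{dv}}(\nabla^o)$: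 the germ is in $\mathfrak I_{\mathrm d}(\nabla^o)$ and, in a holomorphic frame over $\mathbb P^1\times U$ of the bundle extended by means of the frame of $(\ast)$, for a neighbourhood $U$ of $x_o$, the matrix of $\nabla$ is $$-\left(\Delta_0(x)+\tfrac1z\mathcal B(x)\right)\mathrm dz-z\,\mathrm d\Delta_0(x)+\varpi(x),\qquad \mathcal B''=[\mathcal L,\Delta_0],\quad \varpi''=[\mathrm d\Delta_0,\mathcal L],$$ with $\Delta_0,\mathcal B,\mathcal L$ holomorphic matrix functions on $U$, $\Delta_0$ diagonal, $\mathcal L$ off-diagonal, and $\varpi$ a matrix of holomorphic $1$-forms on $U$; * $\mathfrak I_{\mathrm{fs}}(\nabla^o)$: on a neighbourhood $U$ of $x_o$ there are a formal series $\Phi=\sum_{k\ge0}\Phi_k(x)z^{-k}$ with all $\Phi_k$ holomorphic on $U$ and $\Phi_0$ invertible on $U$, a diagonal holomorphic $\Delta_0$ on $U$, and a constant diagonal matrix $\mathfrak B_o'$ such that, with $\Omega$ the matrix $(\ast)$, $\Phi^{-1}\Omega\Phi+\Phi^{-1}\mathrm d\Phi=-\mathrm d(z\Delta_0)-\mathfrak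 B_o'\frac{\mathrm dz}{z}$. **Theorem.** 1. The classes $\mathfrak I_{\mathrm d}(\nabla^o)$, $\mathfrak I_{\mathrm{dv}}(\nabla^o)$ and $\mathfrak I_{\mathrm{fs}}(\nabla^o)$ are closed under arbitrary base change: for each germ of holomorphic map $\phi\colon(X,x_o)\to(X',x_o')$, the pull-back $(\mathrm{id}\times\phi)^*\nabla$ of a germ $\nabla$ over $(X',x_o')$ in one of these classes is in the same class over $(X,x_o)$. 2. For all $A_o,B_o$: $\mathfrak I_{\mathrm{fs}}(\nabla^o)\subseteq\mathfrak I_{\mathrm{dv}}(\nabla^o)$, $\mathfrak I^{\mathrm{gen}}_{\mathrm d}(\nabla^o)\subseteq\mathfrak I_{\mathrm{dv}}(\nabla^o)$, and $\mathfrak I_{\mathrm{dv}}(\nabla^o)\subseteq\mathfrak I_{\mathrm d}(\nabla^o)\subseteq\mathfrak I(\nabla^o)$. 3. If $A_o$ is regular (its characteristic polynomial equals its minimal polynomial) and diagonalizable, then $\mathfrak I_{\mathrm{fs}}(\nabla^o)=\mathfrak I_{\mathrm{dv}}(\nabla^o)=\mathfrak I_{\mathrm d}(\nabla^o)=\mathfrak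 I(\nabla^o)$. -/

import Mathlib

open Filter Topology

noncomputable section

namespace RHB

open scoped Matrix.Norms.L2Operator

/-! Meromorphic connections on `ℙ¹ × X` near `z = ∞`, their integrable deformations, and the classes of
deformations of diagonal, diagonal-vanishing and formally simplifiable type.

Everything below is about germs at a point `xₒ` of the parameter space, so the parameter space is a
neighbourhood of `xₒ` in a finite-dimensional complex normed space `V` (a holomorphic chart). The
affine coordinate on `ℙ¹` is `z`; the connection `∇ = d + Ω` is given, in a frame, by its matrix
`Ω` of 1-forms on (an open part of) `ℂ × V`. A matrix of 1-forms assigns a linear map to each point;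
it is holomorphic if its value on each fixed vector is a holomorphic function. -/

abbrev Mat (n : ℕ) : Type := Matrix (Fin n) (Fin n) ℂ

/-- Diagonalizable matrices: `P⁻¹ A P` is diagonal for some invertible `P`. -/
def Mdiag (n : ℕ) : Set (Mat n) :=
  {A | ∃ P : Mat n, IsUnit P ∧ (P⁻¹ * A * P).IsDiag}

/-- Regular matrices: the characteristic polynomial is the minimal polynomial. -/
def Mreg (n : ℕ) : Set (Mat n) := {A | A.charpoly = minpoly ℂ A}

/-- The off-diagonal part `M'' = M - M'`. -/
def offDiag {n : ℕ} (M : Mat n) : Mat n := M - Matrix.diagonal M.diag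

variable {n : ℕ} {V V' : Type*} [NormedAddCommGroup V] [NormedSpace ℂ V]
  [NormedAddCommGroup V'] [NormedSpace ℂ V']

/-- `n × n` matrices of 1-forms on `ℂ × V`, with coordinates `(z, x)`. -/
abbrev ConnForm (n : ℕ) (V : Type*) [NormedAddCommGroup V] [NormedSpace ℂ V] : Type _ :=
  ℂ × V → (ℂ × V →ₗ[ℂ] Mat n)

/-- The matrix of covectors `M dz + N` at a point of `ℂ × V`. -/
def dzdx (M : Mat n) (N : V →ₗ[ℂ] Mat n) : ℂ × V →ₗ[ℂ] Mat n :=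
  (LinearMap.fst ℂ ℂ V).smulRight M + N ∘ₗ LinearMap.snd ℂ ℂ V

/-- The matrix `G⁻¹ Ω G + G⁻¹ dG` of the connection `d + Ω` in the new frame given by `G`,
evaluated at the point `p` on the tangent vector `v`. -/
def gauge (G : ℂ × V → Mat n) (Ω : ConnForm n V) (p v : ℂ × V) : Mat n :=
  (G p)⁻¹ * Ω p v * G p + (G p)⁻¹ * fderiv ℂ G p v

/-- The sets that contain `{|z| > R} × U` for some `R` and some neighbourhood `U` of `xₒ`. -/
def nearInfinity (xₒ : V) : Filter (ℂ × V) := Bornology.cobounded ℂ ×ˢ 𝓝 xₒ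

/-- `dΩ + Ω ∧ Ω = 0` near `(∞, xₒ)`. -/
def IsFlat (xₒ : V) (Ω : ConnForm n V) : Prop :=
  ∀ᶠ p in nearInfinity xₒ, ∀ u v : ℂ × V,
    fderiv ℂ (fun q => Ω q v) p u - fderiv ℂ (fun q => Ω q u) p v +
      (Ω p u * Ω p v - Ω p v * Ω p u) = 0

/-- `Ω` has a pole of order two (Poincaré rank one) along `z = ∞`: near `(∞, xₒ)`,
`Ω = a(1/z, x) dz + z c(1/z, x)` with `a` and `c` holomorphic at `(0, xₒ)`.
In the coordinate `w = 1/z`: `Ω = w⁻¹ (-a(w, x) dw / w + c(w, x))`. -/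
def HasPoleOrderTwo (xₒ : V) (Ω : ConnForm n V) : Prop :=
  ∃ (a : ℂ × V → Mat n) (c : ℂ × V → (V →ₗ[ℂ] Mat n)),
    AnalyticAt ℂ a (0, xₒ) ∧ (∀ v, AnalyticAt ℂ (fun p => c p v) (0, xₒ)) ∧
    ∀ᶠ p in nearInfinity xₒ, Ω p = dzdx (a (p.1⁻¹, p.2)) (p.1 • c (p.1⁻¹, p.2))

/-- Germs at `xₒ` of integrable deformations of the connection `∇ᵒ` with matrix
`Ωₒ = -(Aₒ + Bₒ / z) dz` on the trivial bundle: flat connections with a pole of order two along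
`z = ∞`, on a bundle over `{|z| > R} × U` trivialized by a frame that extends the given frame at
`x = xₒ`, and restricting to `∇ᵒ` at `x = xₒ`. -/
def classI (Aₒ Bₒ : Mat n) (xₒ : V) : Set (ConnForm n V) :=
  {Ω | HasPoleOrderTwo xₒ Ω ∧ IsFlat xₒ Ω ∧
    ∀ᶠ z in Bornology.cobounded ℂ, ∀ ζ : ℂ, Ω (z, xₒ) (ζ, 0) = -(ζ • (Aₒ + z⁻¹ • Bₒ))}

/-- A holomorphic invertible matrix near `(∞, xₒ)`, the point `z = ∞` included. -/
def IsFrameAtInfinity (xₒ : V) (G : ℂ × V → Mat n) : Prop :=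
  ∃ g : ℂ × V → Mat n, AnalyticAt ℂ g (0, xₒ) ∧ IsUnit (g (0, xₒ)) ∧
    ∀ᶠ p in nearInfinity xₒ, G p = g (p.1⁻¹, p.2)

/-- The matrix `-(A(x) + B / z) dz - z C(x)`. -/
def birkhoffForm (A : V → Mat n) (B : Mat n) (C : V → (V →ₗ[ℂ] Mat n)) : ConnForm n V :=
  fun p => dzdx (-(A p.2 + p.1⁻¹ • B)) (-(p.1 • C p.2))

/-- `A` and `C` are (germs at `xₒ` of) the pole part and the deformation part of `Ω`: in a
holomorphic frame near `(∞, xₒ)` that is the given one at `x = xₒ`, the connection has matrix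
`-(A(x) + Bₒ / z) dz - z C(x)`, and `A(xₒ) = Aₒ`. -/
structure IsPoleAndDeformationPart (Aₒ Bₒ : Mat n) (xₒ : V) (Ω : ConnForm n V)
    (A : V → Mat n) (C : V → (V →ₗ[ℂ] Mat n)) : Prop where
  analyticAt_pole : AnalyticAt ℂ A xₒ
  analyticAt_def : ∀ v, AnalyticAt ℂ (fun x => C x v) xₒ
  pole_base : A xₒ = Aₒ
  exists_frame : ∃ G : ℂ × V → Mat n, IsFrameAtInfinity xₒ G ∧
    (∀ᶠ z in Bornology.cobounded ℂ, G (z, xₒ) = 1) ∧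
    ∀ᶠ p in nearInfinity xₒ, ∀ v, gauge G Ω p v = birkhoffForm A Bₒ C p v

/-- `Δ₀` is a holomorphic diagonal form of `A` at `xₒ`. -/
def IsDiagonalFormAt (xₒ : V) (A Δ₀ : V → Mat n) : Prop :=
  ∃ P : V → Mat n, AnalyticAt ℂ P xₒ ∧ IsUnit (P xₒ) ∧ AnalyticAt ℂ Δ₀ xₒ ∧
    ∀ᶠ x in 𝓝 xₒ, (Δ₀ x).IsDiag ∧ (P x)⁻¹ * A x * P x = Δ₀ x

/-- The matrix-valued function `A` is locally holomorphically diagonalizable at `xₒ`. -/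
def IsLocDiagonalizable (xₒ : V) (A : V → Mat n) : Prop :=
  ∃ Δ₀ : V → Mat n, IsDiagonalFormAt xₒ A Δ₀

/-- The matrix-valued 1-form `C` is locally holomorphically diagonalizable at `xₒ`. -/
def IsLocDiagonalizableForm (xₒ : V) (C : V → (V →ₗ[ℂ] Mat n)) : Prop :=
  ∃ P : V → Mat n, AnalyticAt ℂ P xₒ ∧ IsUnit (P xₒ) ∧
    ∀ᶠ x in 𝓝 xₒ, ∀ v, ((P x)⁻¹ * C x v * P x).IsDiag

/-- Deformations of diagonal type. -/
def classD (Aₒ Bₒ : Mat n) (xₒ : V) : Set (ConnForm n V) :=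
  {Ω | Ω ∈ classI Aₒ Bₒ xₒ ∧ ∃ A C, IsPoleAndDeformationPart Aₒ Bₒ xₒ Ω A C ∧
    IsLocDiagonalizable xₒ A ∧ IsLocDiagonalizableForm xₒ C}

/-- Deformations of generic diagonal type: the differentials at `xₒ` of the holomorphic
eigenvalues of the pole part are pairwise distinct. -/
def classDgen (Aₒ Bₒ : Mat n) (xₒ : V) : Set (ConnForm n V) :=
  {Ω | Ω ∈ classI Aₒ Bₒ xₒ ∧ ∃ A C, IsPoleAndDeformationPart Aₒ Bₒ xₒ Ω A C ∧
    IsLocDiagonalizable xₒ A ∧ IsLocDiagonalizableForm xₒ C ∧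
    ∃ Δ₀ : V → Mat n, IsDiagonalFormAt xₒ A Δ₀ ∧
      ∀ i j, i ≠ j → fderiv ℂ (fun x => Δ₀ x i i) xₒ ≠ fderiv ℂ (fun x => Δ₀ x j j) xₒ}

/-- A holomorphic map from `ℙ¹ × U` to the invertible matrices, given by its values `G` on `ℂ × U`
in the coordinate `z` and by its values `H` near `z = ∞` in the coordinate `1 / z`. -/
def IsProjectiveFrame (U : Set V) (G : ℂ × V → Mat n) : Prop :=
  (AnalyticOnNhd ℂ G (Set.univ ×ˢ U) ∧ ∀ p, p.2 ∈ U → IsUnit (G p)) ∧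
  ∃ H : ℂ × V → Mat n,
    (AnalyticOnNhd ℂ H (Set.univ ×ˢ U) ∧ ∀ p, p.2 ∈ U → IsUnit (H p)) ∧
    ∀ p, p.2 ∈ U → p.1 ≠ 0 → G p = H (p.1⁻¹, p.2)

/-- Deformations of diagonal-vanishing type. The frame in which the connection has matrix
`-(A(x) + Bₒ / z) dz - z C(x)` extends the bundle to `ℙ¹ × U`; in another holomorphic frame `G` of it
over `ℙ¹ × U`, the matrix is `-(Δ₀ + 𝓑 / z) dz - z dΔ₀ + ϖ` with `Δ₀` diagonal,
`𝓑'' = [L, Δ₀]` and `ϖ'' = [dΔ₀, L]`, where `L` is off-diagonal. -/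
def classDv (Aₒ Bₒ : Mat n) (xₒ : V) : Set (ConnForm n V) :=
  {Ω | Ω ∈ classI Aₒ Bₒ xₒ ∧ ∃ A C, IsPoleAndDeformationPart Aₒ Bₒ xₒ Ω A C ∧
    IsLocDiagonalizable xₒ A ∧ IsLocDiagonalizableForm xₒ C ∧
    ∃ U : Set V, IsOpen U ∧ xₒ ∈ U ∧
    ∃ G : ℂ × V → Mat n, IsProjectiveFrame U G ∧
    ∃ (Δ₀ 𝓑 L : V → Mat n) (ϖ : V → (V →ₗ[ℂ] Mat n)),
      AnalyticOnNhd ℂ Δ₀ U ∧ AnalyticOnNhd ℂ 𝓑 U ∧ AnalyticOnNhd ℂ L U ∧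
      (∀ v, AnalyticOnNhd ℂ (fun x => ϖ x v) U) ∧
      (∀ p, p.2 ∈ U → p.1 ≠ 0 → ∀ v, gauge G (birkhoffForm A Bₒ C) p v =
        dzdx (-(Δ₀ p.2 + p.1⁻¹ • 𝓑 p.2)) (-(p.1 • (fderiv ℂ Δ₀ p.2).toLinearMap) + ϖ p.2) v) ∧
      ∀ x ∈ U, (Δ₀ x).IsDiag ∧ (L x).diag = 0 ∧
        offDiag (𝓑 x) = L x * Δ₀ x - Δ₀ x * L x ∧
        ∀ v, offDiag (ϖ x v) = fderiv ℂ Δ₀ x v * L x - L x * fderiv ℂ Δ₀ x v}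

/-- The formal series `Φ = ∑ Φₖ(x) z⁻ᵏ` satisfies
`Φ⁻¹ Ω Φ + Φ⁻¹ dΦ = -d(z Δ₀) - B' dz / z` on `U`, where `Ω = -(A + B / z) dz - z C` : after
multiplication by `Φ` on the left, the coefficients of `dz`, of `z⁻¹⁻ᵏ dz`, of the part `z` and of
the part `z⁻ᵏ` without `dz` agree. -/
def IsFormalGauge (U : Set V) (A : V → Mat n) (B : Mat n) (C : V → (V →ₗ[ℂ] Mat n))
    (Φ : ℕ → V → Mat n) (Δ₀ : V → Mat n) (B' : Mat n) : Prop :=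
  ∀ x ∈ U,
    -(A x * Φ 0 x) = -(Φ 0 x * Δ₀ x) ∧
    (∀ k : ℕ, -(A x * Φ (k + 1) x) - B * Φ k x - (k : ℂ) • Φ k x =
      -(Φ (k + 1) x * Δ₀ x) - Φ k x * B') ∧
    (∀ v, -(C x v * Φ 0 x) = -(Φ 0 x * fderiv ℂ Δ₀ x v)) ∧
    (∀ k : ℕ, ∀ v, -(C x v * Φ (k + 1) x) + fderiv ℂ (Φ k) x v =
      -(Φ (k + 1) x * fderiv ℂ Δ₀ x v))

/-- Deformations of formally simplifiable type. -/
def classFs (Aₒ Bₒ : Mat n) (xₒ : V) : Set (ConnForm n V) :=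
  {Ω | Ω ∈ classI Aₒ Bₒ xₒ ∧ ∃ A C, IsPoleAndDeformationPart Aₒ Bₒ xₒ Ω A C ∧
    ∃ U : Set V, IsOpen U ∧ xₒ ∈ U ∧
    ∃ (Φ : ℕ → V → Mat n) (Δ₀ : V → Mat n) (B' : Mat n),
      (∀ k, AnalyticOnNhd ℂ (Φ k) U) ∧ (∀ x ∈ U, IsUnit (Φ 0 x)) ∧
      AnalyticOnNhd ℂ Δ₀ U ∧ (∀ x ∈ U, (Δ₀ x).IsDiag) ∧ B'.IsDiag ∧
      IsFormalGauge U A Bₒ C Φ Δ₀ B'}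

/-- The pull-back of `Ω` by `(z, x) ↦ (z, φ x)`. -/
def baseChange (φ : V → V') (Ω : ConnForm n V') : ConnForm n V :=
  fun p => Ω (p.1, φ p.2) ∘ₗ LinearMap.prodMap LinearMap.id (fderiv ℂ φ p.2).toLinearMap

/-- A class of germs of deformations, given over every germ `(V, xₒ)`, is closed under the base
changes `φ : (V, xₒ) → (V', xₒ')` between germs over `V` and `V'`. -/
def ClosedUnderBaseChange (K : (x : V) → Set (ConnForm n V)) (K' : (x' : V') → Set (ConnForm n V')) :
    Prop :=
  ∀ (xₒ : V) (xₒ' : V') (φ : V → V'), AnalyticAt ℂ φ xₒ → φ xₒ = xₒ' →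
    ∀ Ω ∈ K' xₒ', baseChange φ Ω ∈ K xₒ

end RHB

end

set_option linter.unusedSectionVars false

open Filter Topology

noncomputable section

/-! For all A_o, B_o the classes form a chain fs ⊆ dv ⊆ d ⊆ I. When A_o has simple spectrum the
chain is closed into a cycle by I ⊆ fs (`classI_subset_classFs`), and this inclusion carries most of
the work.

Its analytic half is the existence of a Birkhoff form -(A + B_o/z)dz - zC in a frame equal to 1 over
x_o (`exists_isPoleAndDeformationPart`). With w = 1/z the parameter part of the connection is
w⁻¹c(w, x), and one needs an invertible γ(w, x) with w dγ + cγ + γC = 0. Functions of w are regarded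
as elements of a Banach algebra on which the backward shift a ↦ (a - a(0))/w is bounded. The choice
C = -γ(0)⁻¹c(0)γ(0) makes cγ + γC divisible by w, so the equation becomes a regular analytic
equation with values in that algebra. It is solved along the rays from x_o by the implicit function
theorem (`exists_radial_solution`). By flatness, the defect in the other directions satisfies a
homogeneous linear equation of Euler type, so it vanishes (`exists_transport`). Flatness in mixed
directions then freezes the part of degree at least one in w of the dz-coefficient
(`tail_eq_of_flow`), which is why B_o does not vary.

The algebraic half compares powers of z in the flatness equation: [A, C] = 0 and dA = C + [C, B_o].
In a holomorphic frame P of eigenvectors with eigenvalues Δ this gives P⁻¹CP = dΔ and [Δ, P⁻¹dP] =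
[P⁻¹B_oP, dΔ]. Hence the off-diagonal entries of P⁻¹dP are multiples of d(Δᵢ - Δⱼ). It follows that
the diagonal of P⁻¹dP is closed, so that rescaling the eigenvectors removes it, and that the
diagonal of P⁻¹B_oP is constant. The formal gauge is built from the z-equation alone, by recursion.
Its defect in the parameter equation satisfies the homogeneous recursion, and is therefore zero
(`isFormalGauge_formalSol`).

For fs ⊆ dv, the matrix L is read off the first two coefficients of the formal gauge. For generic
deformations L is obtained by cancelling factors Δᵢ - Δⱼ, which is possible because their
differentials do not vanish (`eq_zero_of_mul_eq_zero`). Base change holds because all the data and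
all the differential relations pull back. -/

namespace RHB

/-! ### Analytic superposition operators on spaces of functions. -/

section Superposition

variable {X Y E F T : Type*} [NormedAddCommGroup X] [NormedSpace ℂ X]
  [NormedAddCommGroup Y] [NormedSpace ℂ Y] [CompleteSpace Y]
  [NormedAddCommGroup E] [NormedSpace ℂ E] [NormedAddCommGroup F] [NormedSpace ℂ F]

/-- Superposition operators: if all continuous multilinear maps lift to spaces `X`, `Y` of maps
`T → E`, `T → F` without increasing the norm, then so does an analytic function. -/
theorem exists_superposition (ev : T → X →L[ℂ] E) (ev' : T → Y →L[ℂ] F)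
    (hev : ∀ t x, ‖ev t x‖ ≤ ‖x‖)
    (lift : ∀ (k : ℕ) (P : ContinuousMultilinearMap ℂ (fun _ : Fin k => E) F),
      ∃ Q : ContinuousMultilinearMap ℂ (fun _ : Fin k => X) Y, ‖Q‖ ≤ ‖P‖ ∧
        ∀ m t, ev' t (Q m) = P fun i => ev t (m i))
    {f : E → F} {e : E} (hf : AnalyticAt ℂ f e) :
    ∃ (g : X → Y) (r : ℝ), 0 < r ∧ AnalyticOnNhd ℂ g (Metric.ball 0 r) ∧
      ∀ x ∈ Metric.ball (0 : X) r, ∀ t, ev' t (g x) = f (e + ev t x) := by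
  obtain ⟨p, R, hp⟩ := hf
  choose Q hQ hQe using lift
  let q : FormalMultilinearSeries ℂ X Y := fun k => Q k (p k)
  -- Lifting does not increase the norms of the coefficients, so the geometric bounds for the series
  -- of `f` hold for the lifted series.
  have hrad : p.radius ≤ q.radius := by
    refine ENNReal.le_of_forall_nnreal_lt fun r hr => ?_
    obtain ⟨C, -, hC⟩ := p.norm_mul_pow_le_of_lt_radius hr
    exact q.le_radius_of_bound C fun k =>
      (mul_le_mul_of_nonneg_right (hQ k (p k)) (by positivity)).trans (hC k)
  have hqpos : 0 < q.radius := (hp.r_pos.trans_le hp.r_le).trans_le hrad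
  have hq := q.hasFPowerSeriesOnBall hqpos
  -- A real radius is extracted because `R` may be `⊤`.
  obtain ⟨r, hr0, hrR⟩ : ∃ r : ℝ, 0 < r ∧ ENNReal.ofReal r ≤ R := by
    rcases eq_or_ne R ⊤ with h | h
    · exact ⟨1, one_pos, h ▸ le_top⟩
    · exact ⟨R.toReal, ENNReal.toReal_pos hp.r_pos.ne' h, by rw [ENNReal.ofReal_toReal h]⟩
  have hsub : ∀ x ∈ Metric.ball (0 : X) r, x ∈ Metric.eball (0 : X) q.radius := fun x hx => by
    have : x ∈ Metric.eball (0 : X) (ENNReal.ofReal r) := by rwa [Metric.eball_ofReal]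
    exact Metric.eball_subset_eball ((hrR.trans hp.r_le).trans hrad) this
  refine ⟨q.sum, r, hr0, fun x hx => hq.analyticAt_of_mem (hsub x hx), fun x hx t => ?_⟩
  have h1 := hq.hasSum (hsub x hx)
  rw [zero_add] at h1
  have h2 := h1.mapL (ev' t)
  have h3 : ev t x ∈ Metric.eball (0 : E) R := by
    have : ev t x ∈ Metric.ball (0 : E) r := by
      rw [mem_ball_zero_iff] at hx ⊢
      exact (hev t x).trans_lt hx
    rw [← Metric.eball_ofReal] at this
    exact Metric.eball_subset_eball hrR this
  refine h2.unique ?_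
  simpa [q, hQe] using hp.hasSum h3

/-- Multilinear maps lift to spaces of continuous functions on a compact space. -/
theorem exists_lift_continuousMap {K : Type*} [TopologicalSpace K] [CompactSpace K]
    (ev : K → X →L[ℂ] E) (hev : ∀ t x, ‖ev t x‖ ≤ ‖x‖) (hc : ∀ x, Continuous fun t => ev t x)
    (k : ℕ) (P : ContinuousMultilinearMap ℂ (fun _ : Fin k => E) F) :
    ∃ Q : ContinuousMultilinearMap ℂ (fun _ : Fin k => X) C(K, F), ‖Q‖ ≤ ‖P‖ ∧
      ∀ m t, Q m t = P fun i => ev t (m i) := by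
  let Q₀ : MultilinearMap ℂ (fun _ : Fin k => X) C(K, F) :=
    { toFun := fun m => ⟨fun t => P fun i => ev t (m i),
        P.cont.comp (continuous_pi fun i => hc (m i))⟩
      map_update_add' := by
        intro _ m i x y
        ext t
        have h : ∀ z : X, (fun j => ev t (Function.update m i z j)) =
            Function.update (fun j => ev t (m j)) i (ev t z) := fun z => by
          ext j
          rcases eq_or_ne j i with rfl | hj <;> simp [*]
        simp only [ContinuousMap.coe_mk, ContinuousMap.add_apply]
        convert P.map_update_add (fun j => ev t (m j)) i (ev t x) (ev t y) using 2
        · convert h (x + y); simp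
        · convert congrArg P (h x)
        · convert congrArg P (h y)
      map_update_smul' := by
        intro _ m i c x
        ext t
        have h : ∀ z : X, (fun j => ev t (Function.update m i z j)) =
            Function.update (fun j => ev t (m j)) i (ev t z) := fun z => by
          ext j
          rcases eq_or_ne j i with rfl | hj <;> simp [*]
        simp only [ContinuousMap.coe_mk, ContinuousMap.smul_apply]
        convert P.map_update_smul (fun j => ev t (m j)) i c (ev t x) using 2
        · convert h (c • x); simp
        · convert congrArg P (h x) }
  have hQ₀ : ∀ m, ‖Q₀ m‖ ≤ ‖P‖ * ∏ i, ‖m i‖ := fun m => by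
    rw [ContinuousMap.norm_le _ (by positivity)]
    intro t
    refine (P.le_opNorm _).trans ?_
    gcongr with i
    exact hev t (m i)
  exact ⟨Q₀.mkContinuous ‖P‖ hQ₀, Q₀.mkContinuous_norm_le (norm_nonneg _) hQ₀, fun m t => rfl⟩

end Superposition

/-! ### Analytic differential equations along rays. -/

section RadialODE

variable {V 𝒜 : Type*} [NormedAddCommGroup V] [NormedSpace ℂ V]
  [NormedAddCommGroup 𝒜] [NormedSpace ℂ 𝒜] [CompleteSpace 𝒜]

theorem continuous_comp_projIcc (a : C(unitInterval, 𝒜)) :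
    Continuous fun τ : ℝ => a (Set.projIcc 0 1 zero_le_one τ) :=
  a.continuous.comp continuous_projIcc

/-- The primitive vanishing at `0`, as an operator on `C([0, 1], 𝒜)`. -/
def primitiveCLM (𝒜 : Type*) [NormedAddCommGroup 𝒜] [NormedSpace ℂ 𝒜] [CompleteSpace 𝒜] :
    C(unitInterval, 𝒜) →L[ℂ] C(unitInterval, 𝒜) :=
  LinearMap.mkContinuous
    { toFun := fun a => ⟨fun t => ∫ τ in (0 : ℝ)..t, a (Set.projIcc 0 1 zero_le_one τ),
        (intervalIntegral.continuous_primitive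
          (fun _ _ => (continuous_comp_projIcc a).intervalIntegrable _ _) 0).comp
          continuous_subtype_val⟩
      map_add' := fun a b => by
        ext t
        exact intervalIntegral.integral_add ((continuous_comp_projIcc a).intervalIntegrable _ _)
          ((continuous_comp_projIcc b).intervalIntegrable _ _)
      map_smul' := fun c a => by
        ext t
        exact intervalIntegral.integral_smul c _ } 1 fun a => by
    rw [one_mul, ContinuousMap.norm_le _ (norm_nonneg _)]
    intro t
    refine (intervalIntegral.norm_integral_le_of_norm_le_const (C := ‖a‖)
      fun τ _ => a.norm_coe_le_norm _).trans ?_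
    rw [sub_zero, abs_of_nonneg t.2.1]
    exact mul_le_of_le_one_right (norm_nonneg _) t.2.2

theorem primitiveCLM_apply (a : C(unitInterval, 𝒜)) (t : unitInterval) :
    primitiveCLM 𝒜 a t = ∫ τ in (0 : ℝ)..t, a (Set.projIcc 0 1 zero_le_one τ) := rfl

/-- Analytic solutions of ordinary differential equations along the rays issued from `x₀`. -/
theorem exists_radial_solution [CompleteSpace V] {f : V × V × 𝒜 → 𝒜} {x₀ : V} {y₀ : 𝒜}
    (hf : AnalyticAt ℂ f (x₀, 0, y₀))
    (hlin : ∀ (s : ℂ) x u y, f (x, s • u, y) = s • f (x, u, y)) :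
    ∃ g : V → 𝒜, AnalyticAt ℂ g x₀ ∧ g x₀ = y₀ ∧
      ∀ᶠ x in 𝓝 x₀, fderiv ℂ g x (x - x₀) = f (x, x - x₀, g x) := by
  -- A direction u and a curve y are sent to the displacement (tu, u, y(t)) from (x₀, 0, y₀) at
  -- which `f` is evaluated at time t.
  let ev : unitInterval → (V × C(unitInterval, 𝒜)) →L[ℂ] V × V × 𝒜 := fun t =>
    (((t : ℝ) : ℂ) • ContinuousLinearMap.fst ℂ V C(unitInterval, 𝒜)).prod
      ((ContinuousLinearMap.fst ℂ V C(unitInterval, 𝒜)).prod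
        ((ContinuousMap.evalCLM ℂ t).comp (ContinuousLinearMap.snd ℂ V C(unitInterval, 𝒜))))
  have hev_apply : ∀ t x, ev t x = (((t : ℝ) : ℂ) • x.1, x.1, x.2 t) := fun t x => rfl
  have hev : ∀ t x, ‖ev t x‖ ≤ ‖x‖ := by
    intro t x
    have ht : ‖((t : ℝ) : ℂ)‖ ≤ 1 := by
      rw [Complex.norm_real, Real.norm_of_nonneg t.2.1]; exact t.2.2
    have h1 : ‖((t : ℝ) : ℂ) • x.1‖ ≤ ‖x‖ := by
      rw [norm_smul]
      exact (mul_le_of_le_one_left (norm_nonneg _) ht).trans (norm_fst_le x)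
    rw [hev_apply]
    exact norm_prod_le_iff.2 ⟨h1, norm_prod_le_iff.2
      ⟨norm_fst_le x, (x.2.norm_coe_le_norm t).trans (norm_snd_le x)⟩⟩
  have hcont : ∀ x, Continuous fun t => ev t x := fun x => by
    simp only [hev_apply]
    have := x.2.continuous
    fun_prop
  obtain ⟨N, r, hr, hN, hNe⟩ := exists_superposition ev
    (fun t => ContinuousMap.evalCLM (M := 𝒜) ℂ t) hev
    (fun k P => exists_lift_continuousMap ev hev hcont k P) hf
  replace hNe : ∀ x ∈ Metric.ball (0 : V × C(unitInterval, 𝒜)) r, ∀ t : unitInterval,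
      N x t = f (x₀ + ((t : ℝ) : ℂ) • x.1, x.1, y₀ + x.2 t) := fun x hx t => by
    have := hNe x hx t
    rw [hev_apply, Prod.mk_add_mk, Prod.mk_add_mk, zero_add] at this
    exact this
  have hf0 : ∀ x y, f (x, 0, y) = 0 := fun x y => by simpa using hlin 0 x 0 y
  -- Near the origin, the zeros of `Θ` are the solutions of y(t) = ∫₀ᵗ f(x₀ + τu, u, y₀ + y(τ)) dτ.
  -- The implicit function theorem gives y as an analytic function `ψ` of u.
  let Θ : V × C(unitInterval, 𝒜) → C(unitInterval, 𝒜) := fun p => p.2 - primitiveCLM 𝒜 (N p)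
  have hN0 : AnalyticAt ℂ N 0 := hN 0 (Metric.mem_ball_self hr)
  have hΘ : AnalyticAt ℂ Θ 0 := analyticAt_snd.sub
    ((primitiveCLM 𝒜).analyticAt _ |>.comp hN0)
  -- Homogeneity makes `f` vanish at u = 0. So `N` vanishes for u = 0 and small y, and the partial
  -- derivative of `Θ` in y is the identity.
  have hNinr : (fun y : C(unitInterval, 𝒜) => N (0, y)) =ᶠ[𝓝 0] fun _ => 0 := by
    have : ∀ᶠ y in 𝓝 (0 : C(unitInterval, 𝒜)), y ∈ Metric.ball 0 r :=
      Metric.ball_mem_nhds _ hr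
    filter_upwards [this] with y hy
    ext t
    rw [hNe (0, y) (by simpa using hy) t]
    exact hf0 _ _
  have hinv : fderiv ℂ Θ 0 ∘L .inr ℂ V C(unitInterval, 𝒜) =
      ContinuousLinearMap.id ℂ C(unitInterval, 𝒜) := by
    have h1 : HasFDerivAt (fun y : C(unitInterval, 𝒜) => Θ (0, y))
        (fderiv ℂ Θ 0 ∘L .inr ℂ V C(unitInterval, 𝒜)) 0 :=
      HasFDerivAt.comp (g := Θ) (0 : C(unitInterval, 𝒜)) hΘ.differentiableAt.hasFDerivAt
        (ContinuousLinearMap.inr ℂ V C(unitInterval, 𝒜)).hasFDerivAt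
    have h2 : HasFDerivAt (fun y : C(unitInterval, 𝒜) => Θ (0, y))
        (ContinuousLinearMap.id ℂ _) 0 := by
      refine (hasFDerivAt_id _).congr_of_eventuallyEq ?_
      filter_upwards [hNinr] with y hy
      simp [Θ, hy]
    exact h1.unique h2
  have hcd : ContDiffAt ℂ ⊤ Θ 0 := hΘ.contDiffAt
  have hif : (fderiv ℂ Θ 0 ∘L .inr ℂ V C(unitInterval, 𝒜)).IsInvertible := by
    rw [hinv]; exact ContinuousLinearMap.isInvertible_equiv (f := ContinuousLinearEquiv.refl ℂ _)
  have hne : (⊤ : WithTop ℕ∞) ≠ 0 := by simp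
  set ψ := hcd.implicitFunction hne hif with hψ
  have hψ0 : ψ 0 = 0 := hcd.implicitFunction_apply_self hne hif
  have hψa : AnalyticAt ℂ ψ 0 := (hcd.contDiffAt_implicitFunction hne hif).analyticAt
  have hΘ0 : Θ 0 = 0 := by
    have : N 0 = 0 := hNinr.self_of_nhds
    simp [Θ, this]
  have hsol := hcd.eventually_apply_implicitFunction hne hif
  have hiff := hcd.eventually_apply_eq_iff_implicitFunction hne hif
  rw [← hψ, hΘ0] at hsol hiff
  obtain ⟨δ, hδ, hδiff⟩ := Metric.eventually_nhds_iff_ball.1 hiff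
  let ev1 : C(unitInterval, 𝒜) →L[ℂ] 𝒜 := ContinuousMap.evalCLM ℂ 1
  have hga : AnalyticAt ℂ (fun u => ev1 (ψ u)) 0 := (ev1.analyticAt _).comp hψa
  have hmain : ∀ᶠ u in 𝓝 (0 : V),
      fderiv ℂ (fun u => ev1 (ψ u)) u u = f (x₀ + u, u, y₀ + ev1 (ψ u)) := by
    have hsmall : ∀ᶠ u in 𝓝 (0 : V), ψ u ∈ Metric.ball 0 (min δ r) :=
      hψa.continuousAt.eventually_mem (by rw [hψ0]; exact Metric.ball_mem_nhds _ (lt_min hδ hr))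
    have hsmall' : ∀ᶠ u in 𝓝 (0 : V), u ∈ Metric.ball (0 : V) (min δ r) :=
      Metric.ball_mem_nhds _ (lt_min hδ hr)
    filter_upwards [hsmall, hsmall', hsol, hga.eventually_analyticAt] with u h1 h2 h3 h4
    rw [mem_ball_zero_iff, lt_min_iff] at h1 h2
    have hfix : ψ u = primitiveCLM 𝒜 (N (u, ψ u)) := sub_eq_zero.1 h3
    have hur : ((u, ψ u) : V × C(unitInterval, 𝒜)) ∈ Metric.ball 0 r := by
      rw [mem_ball_zero_iff, Prod.norm_def]; exact max_lt h2.2 h1.2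
    -- Time becomes position: the curve for su is the curve for u run at speed s. By homogeneity the
    -- reparametrized curve solves the integral equation for su, and local uniqueness in the
    -- implicit function theorem identifies it with `ψ` at su.
    have hscale : ∀ s : unitInterval, ev1 (ψ (((s : ℝ) : ℂ) • u)) = ψ u s := by
      intro s
      have hs : ‖((s : ℝ) : ℂ)‖ ≤ 1 := by
        rw [Complex.norm_real, Real.norm_of_nonneg s.2.1]; exact s.2.2
      have hsu : ‖((s : ℝ) : ℂ) • u‖ ≤ ‖u‖ := by
        rw [norm_smul]; exact mul_le_of_le_one_left (norm_nonneg _) hs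
      let y : C(unitInterval, 𝒜) := (ψ u).comp ⟨fun τ => s * τ, by fun_prop⟩
      have hy : ∀ τ, y τ = ψ u (s * τ) := fun τ => rfl
      have hyn : ‖y‖ ≤ ‖ψ u‖ := by
        rw [ContinuousMap.norm_le _ (norm_nonneg _)]
        exact fun τ => (ψ u).norm_coe_le_norm _
      have hmem : ∀ ρ : ℝ, ‖u‖ < ρ → ‖ψ u‖ < ρ →
          ((((s : ℝ) : ℂ) • u, y) : V × C(unitInterval, 𝒜)) ∈ Metric.ball 0 ρ := fun ρ ha hb => by
        rw [mem_ball_zero_iff, Prod.norm_def]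
        exact max_lt (hsu.trans_lt ha) (hyn.trans_lt hb)
      have hz : Θ (((s : ℝ) : ℂ) • u, y) = 0 := by
        refine sub_eq_zero.2 ?_
        ext τ
        change y τ = _
        rw [hy, hfix, primitiveCLM_apply, primitiveCLM_apply]
        have : ((s * τ : unitInterval) : ℝ) = (s : ℝ) * τ := rfl
        rw [this]
        have hsub := intervalIntegral.smul_integral_comp_mul_left (a := 0) (b := (τ : ℝ))
          (fun τ' => N (u, ψ u) (Set.projIcc 0 1 zero_le_one τ')) (s : ℝ)
        rw [mul_zero] at hsub
        rw [← hsub, ← intervalIntegral.integral_smul]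
        refine intervalIntegral.integral_congr fun τ' hτ' => ?_
        rw [Set.uIcc_of_le τ.2.1] at hτ'
        have hτI : τ' ∈ Set.Icc (0 : ℝ) 1 := ⟨hτ'.1, hτ'.2.trans τ.2.2⟩
        have hsτ : (s : ℝ) * τ' ∈ Set.Icc (0 : ℝ) 1 :=
          ⟨mul_nonneg s.2.1 hτI.1, mul_le_one₀ s.2.2 hτI.1 hτI.2⟩
        simp only [Set.projIcc_of_mem _ hτI, Set.projIcc_of_mem _ hsτ]
        rw [hNe _ hur, hNe _ (hmem r h2.2 h1.2), hlin, hy, smul_smul]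
        rw [← Complex.coe_smul]
        rw [mul_comm (((⟨τ', hτI⟩ : unitInterval) : ℝ) : ℂ), ← Complex.ofReal_mul]
        rfl
      have := (hδiff _ (hmem δ h2.1 h1.1)).1 hz
      rw [this]
      change ψ u (s * 1) = ψ u s
      rw [mul_one]
    have hd1 : HasDerivAt (fun s : ℝ => ev1 (ψ ((s : ℂ) • u)))
        (fderiv ℂ (fun u => ev1 (ψ u)) u u) 1 := by
      have hl : HasDerivAt (fun s : ℝ => (s : ℂ) • u) u 1 := by
        simpa using (Complex.ofRealCLM.hasDerivAt (x := (1 : ℝ))).smul_const u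
      have h5 : HasFDerivAt (fun u => ev1 (ψ u)) (fderiv ℂ (fun u => ev1 (ψ u)) u)
          (((1 : ℝ) : ℂ) • u) := by
        simpa using h4.differentiableAt.hasFDerivAt
      exact (h5.restrictScalars ℝ).comp_hasDerivAt (1 : ℝ) hl
    have hd2 : HasDerivAt (fun s : ℝ => ∫ τ in (0 : ℝ)..s,
        N (u, ψ u) (Set.projIcc 0 1 zero_le_one τ))
        (N (u, ψ u) 1) 1 := by
      have hc := continuous_comp_projIcc (N (u, ψ u))
      have := intervalIntegral.integral_hasDerivAt_right (hc.intervalIntegrable 0 1)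
        hc.stronglyMeasurable.stronglyMeasurableAtFilter hc.continuousAt
      convert this using 2
      simp
    -- The scaling identity is available only for s in [0, 1], so the derivatives at s = 1 are
    -- compared within this interval.
    have heq : Set.EqOn (fun s : ℝ => ev1 (ψ ((s : ℂ) • u)))
        (fun s : ℝ => ∫ τ in (0 : ℝ)..s, N (u, ψ u) (Set.projIcc 0 1 zero_le_one τ))
        (Set.Icc 0 1) := fun s hs => by
      have h6 := hscale ⟨s, hs⟩
      exact h6.trans (congrArg (fun a : C(unitInterval, 𝒜) => a ⟨s, hs⟩) hfix)
    have h1I : (1 : ℝ) ∈ Set.Icc (0 : ℝ) 1 := ⟨zero_le_one, le_rfl⟩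
    have huniq : UniqueDiffWithinAt ℝ (Set.Icc (0 : ℝ) 1) 1 :=
      uniqueDiffOn_Icc zero_lt_one 1 h1I
    have := huniq.eq_deriv _ (hd1.hasDerivWithinAt)
      (hd2.hasDerivWithinAt.congr heq (heq h1I))
    rw [this, hNe _ hur]
    simp [ev1]
  refine ⟨fun x => y₀ + ev1 (ψ (x - x₀)), ?_, ?_, ?_⟩
  · refine analyticAt_const.add ?_
    have h : AnalyticAt ℂ (fun x : V => x - x₀) x₀ := analyticAt_id.sub analyticAt_const
    exact AnalyticAt.comp (g := fun u => ev1 (ψ u)) (by simpa using hga) h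
  · simp [hψ0]
  · have ht : Tendsto (fun x : V => x - x₀) (𝓝 x₀) (𝓝 0) := by
      rw [← sub_self x₀]
      exact (continuous_id.sub continuous_const).tendsto x₀
    filter_upwards [ht.eventually hmain] with x hx
    rw [fderiv_const_add, fderiv_comp_sub (f := fun u => ev1 (ψ u)), hx]
    simp

end RadialODE

/-! ### Uniqueness along rays by Grönwall's inequality. -/

section RadialUniqueness

variable {V W : Type*} [NormedAddCommGroup V] [NormedSpace ℂ V]
  [NormedAddCommGroup W] [NormedSpace ℂ W]

theorem hasDerivAt_ray (x₀ u : V) (s : ℝ) :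
    HasDerivAt (fun s : ℝ => x₀ + (s : ℂ) • u) u s := by
  simpa using ((Complex.ofRealCLM.hasDerivAt (x := s)).smul_const u).const_add x₀

theorem hasDerivAt_comp_ray {E : V → W} {x₀ u : V} {s : ℝ}
    (hE : DifferentiableAt ℂ E (x₀ + (s : ℂ) • u)) :
    HasDerivAt (fun s : ℝ => E (x₀ + (s : ℂ) • u)) (fderiv ℂ E (x₀ + (s : ℂ) • u) u) s := by
  have h := hE.hasFDerivAt.restrictScalars ℝ
  exact h.comp_hasDerivAt s (hasDerivAt_ray x₀ u s)

theorem ray_mem_ball {x₀ x : V} {r s : ℝ} (hx : x ∈ Metric.ball x₀ r) (hs : s ∈ Set.Icc (0 : ℝ) 1) :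
    x₀ + (s : ℂ) • (x - x₀) ∈ Metric.ball x₀ r := by
  rw [mem_ball_iff_norm] at hx ⊢
  rw [add_sub_cancel_left, norm_smul, Complex.norm_real, Real.norm_of_nonneg hs.1]
  exact (mul_le_of_le_one_left (norm_nonneg _) hs.2).trans_lt hx

/-- Uniqueness for linear equations along rays that are singular at the centre. -/
theorem eventually_eq_zero_of_euler {E : V → W} {x₀ : V} {M : ℝ}
    (hE : ∀ᶠ x in 𝓝 x₀, DifferentiableAt ℂ E x)
    (h : ∀ᶠ x in 𝓝 x₀, ‖fderiv ℂ E x (x - x₀) + E x‖ ≤ M * (‖x - x₀‖ * ‖E x‖)) :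
    ∀ᶠ x in 𝓝 x₀, E x = 0 := by
  obtain ⟨r, hr, hball⟩ := Metric.eventually_nhds_iff_ball.1 (hE.and h)
  filter_upwards [Metric.ball_mem_nhds x₀ hr] with x hx
  -- The factor s absorbs the singularity at the centre: the derivative of s ↦ s·E is the left side
  -- of the hypothesis at the point of the ray, and the initial value is 0 whatever E(x₀) is.
  have hd : ∀ s ∈ Set.Icc (0 : ℝ) 1, HasDerivAt
      (fun s : ℝ => (s : ℂ) • E (x₀ + (s : ℂ) • (x - x₀)))
      ((s : ℂ) • fderiv ℂ E (x₀ + (s : ℂ) • (x - x₀)) (x - x₀) +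
        (1 : ℂ) • E (x₀ + (s : ℂ) • (x - x₀))) s := fun s hs => by
    have h1 := hasDerivAt_comp_ray (hball _ (ray_mem_ball hx hs)).1
    have h2 : HasDerivAt (fun s : ℝ => (s : ℂ)) 1 s := Complex.ofRealCLM.hasDerivAt
    exact h2.smul h1
  have key := eq_zero_of_abs_deriv_le_mul_abs_self_of_eq_zero_right (K := M * ‖x - x₀‖)
    (fun s hs => (hd s hs).continuousAt.continuousWithinAt)
    (fun s hs => (hd s (Set.Ico_subset_Icc_self hs)).hasDerivWithinAt) (by simp)
    (fun s hs => ?_) 1 (by simp)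
  · simpa using key
  · have h3 := (hball _ (ray_mem_ball hx (Set.Ico_subset_Icc_self hs))).2
    rw [add_sub_cancel_left, map_smul, norm_smul] at h3
    rw [one_smul, norm_smul]
    calc _ ≤ _ := h3
      _ = _ := by ring

/-- Uniqueness for linear total differential equations. -/
theorem eventually_eq_zero_of_fderiv_le {E : V → W} {x₀ : V} {M : ℝ}
    (hE : ∀ᶠ x in 𝓝 x₀, DifferentiableAt ℂ E x) (h0 : E x₀ = 0)
    (h : ∀ᶠ x in 𝓝 x₀, ∀ v, ‖fderiv ℂ E x v‖ ≤ M * (‖v‖ * ‖E x‖)) :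
    ∀ᶠ x in 𝓝 x₀, E x = 0 := by
  obtain ⟨r, hr, hball⟩ := Metric.eventually_nhds_iff_ball.1 (hE.and h)
  filter_upwards [Metric.ball_mem_nhds x₀ hr] with x hx
  have hd : ∀ s ∈ Set.Icc (0 : ℝ) 1, HasDerivAt (fun s : ℝ => E (x₀ + (s : ℂ) • (x - x₀)))
      (fderiv ℂ E (x₀ + (s : ℂ) • (x - x₀)) (x - x₀)) s := fun s hs =>
    hasDerivAt_comp_ray (hball _ (ray_mem_ball hx hs)).1
  have key := eq_zero_of_abs_deriv_le_mul_abs_self_of_eq_zero_right (K := M * ‖x - x₀‖)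
    (fun s hs => (hd s hs).continuousAt.continuousWithinAt)
    (fun s hs => (hd s (Set.Ico_subset_Icc_self hs)).hasDerivWithinAt) (by simp [h0])
    (fun s hs => ?_) 1 (by simp)
  · simpa using key
  · have h3 := (hball _ (ray_mem_ball hx (Set.Ico_subset_Icc_self hs))).2 (x - x₀)
    exact h3.trans_eq (by ring)

end RadialUniqueness

/-! ### Analytic families of linear maps. -/

section FiniteDimensional

variable {V E W : Type*} [NormedAddCommGroup V] [NormedSpace ℂ V] [FiniteDimensional ℂ V]
  [NormedAddCommGroup E] [NormedSpace ℂ E] [NormedAddCommGroup W] [NormedSpace ℂ W]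

/-- A family of linear maps on a finite-dimensional space that is analytic on each vector is the
family of values of an analytic map to the space of continuous linear maps. -/
theorem exists_analyticAt_clm {c : E → V → W} {e : E} (hc : ∀ v, AnalyticAt ℂ (fun p => c p v) e) :
    ∃ T : E → V →L[ℂ] W, AnalyticAt ℂ T e ∧
      ∀ p, (∀ a b, c p (a + b) = c p a + c p b) → (∀ (s : ℂ) a, c p (s • a) = s • c p a) →
        ∀ v, T p v = c p v := by
  let b := Module.finBasis ℂ V
  let φ : Fin (Module.finrank ℂ V) → V →L[ℂ] ℂ := fun i => (b.coord i).toContinuousLinearMap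
  refine ⟨fun p => ∑ i, (φ i).smulRight (c p (b i)), ?_, fun p ha hs v => ?_⟩
  · refine Finset.analyticAt_fun_sum _ fun i _ => ?_
    exact ((ContinuousLinearMap.smulRightL ℂ V W (φ i)).analyticAt _).comp (hc (b i))
  · let L : V →ₗ[ℂ] W := ⟨⟨c p, ha⟩, hs⟩
    have : L v = ∑ i, b.repr v i • L (b i) := by
      conv_lhs => rw [← b.sum_repr v, map_sum]
      simp only [map_smul]
    simp only [sum_apply, ContinuousLinearMap.smulRight_apply]
    exact this.symm

theorem exists_analyticAt_clm_linearMap {c : E → V →ₗ[ℂ] W} {e : E}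
    (hc : ∀ v, AnalyticAt ℂ (fun p => c p v) e) :
    ∃ T : E → V →L[ℂ] W, AnalyticAt ℂ T e ∧ ∀ p v, T p v = c p v := by
  obtain ⟨T, hT, h⟩ := exists_analyticAt_clm (c := fun p v => c p v) hc
  exact ⟨T, hT, fun p => h p (map_add _) (fun s a => map_smul (c p) s a)⟩

end FiniteDimensional

/-! ### The disc algebra and its backward shift. -/

section DiscAlgebra

/-- The closed unit disc. -/
abbrev Disc : Type := Metric.closedBall (0 : ℂ) 1

instance : Zero Disc := ⟨⟨0, by simp⟩⟩

@[simp] theorem Disc.coe_zero : ((0 : Disc) : ℂ) = 0 := rfl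

variable {R : Type*} [NormedRing R] [NormedAlgebra ℂ R]

open scoped Classical in
/-- Extension by zero of a function on the closed unit disc. -/
def discExt (a : C(Disc, R)) (w : ℂ) : R :=
  if h : w ∈ Metric.closedBall (0 : ℂ) 1 then a ⟨w, h⟩ else 0

theorem discExt_coe (a : C(Disc, R)) (w : Disc) : discExt a w = a w := by
  rw [discExt, dif_pos w.2]

theorem discExt_of_mem (a : C(Disc, R)) {w : ℂ} (h : w ∈ Metric.closedBall (0 : ℂ) 1) :
    discExt a w = a ⟨w, h⟩ := dif_pos h

theorem continuousOn_discExt (a : C(Disc, R)) :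
    ContinuousOn (discExt a) (Metric.closedBall 0 1) := by
  rw [continuousOn_iff_continuous_domRestrict]
  convert a.continuous using 1
  ext w
  exact discExt_coe a w

theorem discExt_eqOn {a : C(Disc, R)} {f : ℂ → R} (h : ∀ w : Disc, a w = f w) :
    Set.EqOn (discExt a) f (Metric.ball 0 1) := fun w hw => by
  rw [discExt_of_mem a (Metric.ball_subset_closedBall hw)]
  exact h _

/-- The algebra of continuous functions on the closed unit disc that are holomorphic inside. -/
def DiscAlgebra (R : Type*) [NormedRing R] [NormedAlgebra ℂ R] : Subalgebra ℂ C(Disc, R) where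
  carrier := {a | DifferentiableOn ℂ (discExt a) (Metric.ball 0 1)}
  mul_mem' {a b} ha hb := (DifferentiableOn.mul ha hb).congr
    (discExt_eqOn fun w => by simp [discExt_coe])
  add_mem' {a b} ha hb := (DifferentiableOn.add ha hb).congr
    (discExt_eqOn fun w => by simp [discExt_coe])
  algebraMap_mem' c := (differentiableOn_const (c := algebraMap ℂ R c)).congr
    (discExt_eqOn fun w => by simp [Algebra.algebraMap_eq_smul_one])

theorem mem_discAlgebra {a : C(Disc, R)} {f : ℂ → R} (hf : DifferentiableOn ℂ f (Metric.ball 0 1))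
    (h : ∀ w : Disc, a w = f w) : a ∈ DiscAlgebra R :=
  hf.congr (discExt_eqOn h)

/-- Weierstrass: uniform limits of holomorphic functions are holomorphic. Completeness of the
algebra follows. -/
theorem isClosed_discAlgebra [CompleteSpace R] : IsClosed (DiscAlgebra R : Set C(Disc, R)) := by
  refine IsSeqClosed.isClosed fun a b ha hab => ?_
  have hu := ContinuousMap.tendsto_iff_tendstoUniformly.1 hab
  refine TendstoLocallyUniformlyOn.differentiableOn (φ := atTop) (F := fun k => discExt (a k)) ?_
    (Eventually.of_forall ha) Metric.isOpen_ball
  refine TendstoUniformlyOn.tendstoLocallyUniformlyOn ?_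
  rw [Metric.tendstoUniformlyOn_iff]
  rw [Metric.tendstoUniformly_iff] at hu
  intro ε hε
  filter_upwards [hu ε hε] with k hk w hw
  rw [discExt_of_mem b (Metric.ball_subset_closedBall hw),
    discExt_of_mem (a k) (Metric.ball_subset_closedBall hw)]
  exact hk _

instance [CompleteSpace R] : CompleteSpace (DiscAlgebra R) :=
  IsClosed.completeSpace_coe (hs := isClosed_discAlgebra)

/-- Evaluation at a point of the disc. -/
def discEval (R : Type*) [NormedRing R] [NormedAlgebra ℂ R] (w : Disc) : DiscAlgebra R →L[ℂ] R :=
  (ContinuousMap.evalCLM ℂ w).comp (DiscAlgebra R).toSubmodule.subtypeL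

@[simp] theorem discEval_mul (w : Disc) (a b : DiscAlgebra R) :
    discEval R w (a * b) = discEval R w a * discEval R w b := rfl

@[simp] theorem discEval_one (w : Disc) : discEval R w 1 = 1 := rfl

theorem disc_ext {a b : DiscAlgebra R} (h : ∀ w, discEval R w a = discEval R w b) : a = b :=
  Subtype.ext (ContinuousMap.ext h)

/-- Constant functions. -/
def discConst (R : Type*) [NormedRing R] [NormedAlgebra ℂ R] : R →L[ℂ] DiscAlgebra R :=
  LinearMap.mkContinuous
    { toFun := fun m => ⟨ContinuousMap.const _ m,
        mem_discAlgebra (differentiableOn_const (c := m)) fun _ => rfl⟩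
      map_add' := fun _ _ => rfl
      map_smul' := fun _ _ => rfl } 1 fun m => by
    rw [one_mul]
    exact (ContinuousMap.norm_le _ (norm_nonneg _)).2 fun _ => le_rfl

@[simp] theorem discEval_const (w : Disc) (m : R) : discEval R w (discConst R m) = m := rfl

theorem discConst_mul (a b : R) : discConst R (a * b) = discConst R a * discConst R b := rfl

/-- The coordinate function. -/
def discCoord (R : Type*) [NormedRing R] [NormedAlgebra ℂ R] : DiscAlgebra R :=
  ⟨⟨fun w => algebraMap ℂ R w, (algebraMapCLM ℂ R).continuous.comp continuous_subtype_val⟩,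
    mem_discAlgebra (f := fun w => algebraMapCLM ℂ R w)
      (algebraMapCLM ℂ R).differentiable.differentiableOn fun _ => rfl⟩

@[simp] theorem discEval_coord_mul (w : Disc) (a : DiscAlgebra R) :
    discEval R w (discCoord R * a) = (w : ℂ) • discEval R w a := (Algebra.smul_def _ _).symm

theorem discCoord_mul_comm (a : DiscAlgebra R) : a * discCoord R = discCoord R * a :=
  disc_ext fun w => (Algebra.commutes (w : ℂ) (discEval R w a)).symm

/-- The origin is a limit of other points of the disc, so continuity is enough. Identities that come
from flatness are known only at finite z, that is for w ≠ 0, and are extended to w = 0 in this way.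
-/
theorem disc_ext_of_ne_zero {a b : DiscAlgebra R}
    (h : ∀ w : Disc, w ≠ 0 → discEval R w a = discEval R w b) : a = b := by
  have h0 : ∀ w : Disc, w ∈ closure {w : Disc | w ≠ 0} := fun w => by
    rcases eq_or_ne w 0 with rfl | hw
    · rw [Metric.mem_closure_iff]
      intro ε hε
      have hpos : 0 < min 1 (ε / 2) := lt_min one_pos (half_pos hε)
      have hn : ‖((min 1 (ε / 2) : ℝ) : ℂ)‖ = min 1 (ε / 2) := by
        rw [Complex.norm_real, Real.norm_of_nonneg hpos.le]
      refine ⟨⟨((min 1 (ε / 2) : ℝ) : ℂ), ?_⟩, ?_, ?_⟩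
      · rw [mem_closedBall_zero_iff, hn]; exact min_le_left _ _
      · intro h
        have := congrArg (fun w : Disc => ‖(w : ℂ)‖) h
        simp only [hn, Disc.coe_zero, norm_zero] at this
        exact hpos.ne' this
      · rw [dist_comm, Subtype.dist_eq, Disc.coe_zero, dist_zero_right, hn]
        exact (min_le_right _ _).trans_lt (half_lt_self hε)
    · exact subset_closure hw
  refine disc_ext fun w => ?_
  have hc : IsClosed {w : Disc | discEval R w a = discEval R w b} :=
    isClosed_eq (a : C(Disc, R)).continuous (b : C(Disc, R)).continuous
  exact hc.closure_subset_iff.2 h (h0 w)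

/-- Quotients by w are unique; the linearity of the shift rests on this. -/
theorem discCoord_mul_cancel {a b : DiscAlgebra R} (h : discCoord R * a = discCoord R * b) :
    a = b := by
  refine disc_ext_of_ne_zero fun w hw => ?_
  have := congrArg (discEval R w) h
  simp only [discEval_coord_mul] at this
  exact smul_right_injective R (fun h0 => hw (Subtype.ext h0)) this

variable [CompleteSpace R]

/-- The quotient by w is the slope at 0. By the maximum principle its norm is controlled on the
circle |w| = 1, where dividing by w is isometric; this gives the constant 2. -/
theorem exists_discShift : ∃ S : DiscAlgebra R →L[ℂ] DiscAlgebra R,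
    ∀ a, discCoord R * S a = a - discConst R (discEval R 0 a) := by
  have hex : ∀ a : DiscAlgebra R, ∃ b : DiscAlgebra R,
      discCoord R * b = a - discConst R (discEval R 0 a) := fun a => by
    have hnhds : Metric.ball (0 : ℂ) 1 ∈ 𝓝 (0 : ℂ) := Metric.ball_mem_nhds _ one_pos
    have ha : DifferentiableOn ℂ (discExt (a : C(Disc, R))) (Metric.ball 0 1) := a.2
    have hd : DifferentiableOn ℂ (dslope (discExt (a : C(Disc, R))) 0) (Metric.ball 0 1) :=
      (Complex.differentiableOn_dslope hnhds).2 ha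
    have hc : ContinuousOn (dslope (discExt (a : C(Disc, R))) 0) (Metric.closedBall 0 1) :=
      (continuousOn_dslope (mem_of_superset hnhds Metric.ball_subset_closedBall)).2
        ⟨continuousOn_discExt _, ha.differentiableAt hnhds⟩
    refine ⟨⟨⟨fun w => dslope (discExt (a : C(Disc, R))) 0 w,
      continuousOn_iff_continuous_domRestrict.1 hc⟩, mem_discAlgebra hd fun _ => rfl⟩,
      disc_ext fun w => ?_⟩
    have h1 := sub_smul_dslope (discExt (a : C(Disc, R))) 0 (w : ℂ)
    have h2 : discExt (a : C(Disc, R)) 0 = (a : C(Disc, R)) 0 := discExt_coe _ 0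
    rw [sub_zero, discExt_coe, h2] at h1
    rw [discEval_coord_mul, map_sub, discEval_const]
    exact h1
  choose S hS using hex
  have hSu : ∀ a b, discCoord R * b = a - discConst R (discEval R 0 a) → S a = b :=
    fun a b h => discCoord_mul_cancel ((hS a).trans h.symm)
  have hbound : ∀ a, ‖S a‖ ≤ 2 * ‖a‖ := fun a => by
    have hb : ∀ w : ℂ, w ∈ frontier (Metric.ball (0 : ℂ) 1) →
        ‖discExt (S a : C(Disc, R)) w‖ ≤ 2 * ‖a‖ := fun w hw => by
      rw [frontier_ball _ one_ne_zero] at hw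
      have hw' : w ∈ Metric.closedBall (0 : ℂ) 1 := Metric.sphere_subset_closedBall hw
      have h1 := congrArg (discEval R ⟨w, hw'⟩) (hS a)
      rw [discEval_coord_mul, map_sub, discEval_const] at h1
      have h2 := congrArg norm h1
      rw [norm_smul, mem_sphere_zero_iff_norm.1 hw, one_mul] at h2
      rw [discExt_of_mem _ hw']
      calc _ = _ := h2
        _ ≤ _ := norm_sub_le _ _
        _ ≤ ‖a‖ + ‖a‖ := add_le_add ((a : C(Disc, R)).norm_coe_le_norm _)
          ((a : C(Disc, R)).norm_coe_le_norm _)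
        _ = _ := by ring
    have hdc : DiffContOnCl ℂ (discExt (S a : C(Disc, R))) (Metric.ball 0 1) :=
      ⟨(S a).2, by rw [closure_ball _ one_ne_zero]; exact continuousOn_discExt _⟩
    refine (ContinuousMap.norm_le _ (by positivity)).2 fun w => ?_
    rw [← discExt_coe]
    refine Complex.norm_le_of_forall_mem_frontier_norm_le Metric.isBounded_ball hdc hb ?_
    rw [closure_ball _ one_ne_zero]
    exact w.2
  refine ⟨LinearMap.mkContinuous
    { toFun := S
      map_add' := fun a b => hSu _ _ ?_
      map_smul' := fun c a => hSu _ _ ?_ } 2 hbound, hS⟩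
  · rw [mul_add, hS, hS, map_add, map_add]; abel
  · rw [RingHom.id_apply, mul_smul_comm, hS, map_smul, map_smul, smul_sub]

/-- The backward shift `a ↦ (a - a(0)) / w`. -/
def discShift (R : Type*) [NormedRing R] [NormedAlgebra ℂ R] [CompleteSpace R] :
    DiscAlgebra R →L[ℂ] DiscAlgebra R := exists_discShift.choose

theorem discCoord_mul_shift (a : DiscAlgebra R) :
    discCoord R * discShift R a = a - discConst R (discEval R 0 a) :=
  exists_discShift.choose_spec a

variable {V : Type*} [NormedAddCommGroup V] [NormedSpace ℂ V]

/-- An analytic function of `(w, x)` gives an analytic map from `x` to the disc algebra, after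
rescaling of `w`. -/
theorem exists_analyticAt_discAlgebra {f : ℂ × V → R} {x₀ : V} (hf : AnalyticAt ℂ f (0, x₀)) :
    ∃ r : ℝ, 0 < r ∧ ∀ ρ : ℝ, 0 < ρ → ρ < r → ∃ F : V → DiscAlgebra R, AnalyticAt ℂ F x₀ ∧
      ∀ᶠ x in 𝓝 x₀, ∀ w : Disc, discEval R w (F x) = f ((ρ : ℂ) * w, x) := by
  -- The scale is treated as a variable: evaluation at w sends (s, x) to (ws, x), which does not
  -- increase norms on the closed disc. Setting s = ρ at the end produces f(ρw, x).
  let ev : Disc → (ℂ × V) →L[ℂ] ℂ × V := fun w =>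
    ((w : ℂ) • ContinuousLinearMap.fst ℂ ℂ V).prod (ContinuousLinearMap.snd ℂ ℂ V)
  have hev_apply : ∀ w x, ev w x = ((w : ℂ) * x.1, x.2) := fun w x => rfl
  have hev : ∀ w x, ‖ev w x‖ ≤ ‖x‖ := by
    intro w x
    have hw : ‖(w : ℂ)‖ ≤ 1 := mem_closedBall_zero_iff.1 w.2
    rw [hev_apply]
    refine norm_prod_le_iff.2 ⟨?_, norm_snd_le x⟩
    rw [norm_mul]
    exact (mul_le_of_le_one_left (norm_nonneg _) hw).trans (norm_fst_le x)
  have hcont : ∀ x, Continuous fun w => ev w x := fun x => by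
    simp only [hev_apply]; fun_prop
  obtain ⟨N, r, hr, hN, hNe⟩ := exists_superposition ev (fun w => discEval R w) hev
    (fun k P => by
      obtain ⟨Q, hQ, hQe⟩ := exists_lift_continuousMap ev hev hcont k P
      -- A lifted multilinear map is a polynomial expression in w, hence holomorphic inside the
      -- disc.
      have hmem : ∀ m, Q m ∈ (DiscAlgebra R).toSubmodule := fun m => by
        refine mem_discAlgebra (f := fun w => P fun i => (w * (m i).1, (m i).2)) ?_ fun w => hQe m w
        refine (P.contDiff (n := 1)).differentiable (by simp) |>.comp ?_ |>.differentiableOn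
        fun_prop
      refine ⟨Q.codRestrict _ hmem, ?_, fun m t => hQe m t⟩
      exact ContinuousMultilinearMap.opNorm_le_bound (norm_nonneg _) fun m =>
        (Q.le_opNorm m).trans (by gcongr)) hf
  refine ⟨r, hr, fun ρ hρ hρr => ?_⟩
  have hρn : ‖(ρ : ℂ)‖ = ρ := by rw [Complex.norm_real, Real.norm_of_nonneg hρ.le]
  have hlin : AnalyticAt ℂ (fun x : V => ((ρ : ℂ), x - x₀)) x₀ :=
    analyticAt_const.prod (analyticAt_id.sub analyticAt_const)
  refine ⟨fun x => N ((ρ : ℂ), x - x₀), ?_, ?_⟩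
  · refine AnalyticAt.comp (g := N) (hN _ ?_) hlin
    rw [mem_ball_zero_iff, sub_self, Prod.norm_def, hρn]
    simpa using ⟨hρr, hr⟩
  · have : ∀ᶠ x in 𝓝 x₀, x ∈ Metric.ball x₀ r := Metric.ball_mem_nhds _ hr
    filter_upwards [this] with x hx w
    rw [hNe, hev_apply]
    · simp [mul_comm]
    · rw [mem_ball_zero_iff, Prod.norm_def, hρn]
      exact max_lt hρr (mem_ball_iff_norm.1 hx)

end DiscAlgebra

/-! ### Derivatives along complex lines. -/

section Lines

variable {V W : Type*} [NormedAddCommGroup V] [NormedSpace ℂ V]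
  [NormedAddCommGroup W] [NormedSpace ℂ W]

/-- Identities between differentials are proved below by restricting to such a line and using the
uniqueness of one-variable derivatives. -/
theorem hasDerivAt_line {F : V → W} {x : V} (hF : DifferentiableAt ℂ F x) (a : V) :
    HasDerivAt (fun t : ℂ => F (x + t • a)) (fderiv ℂ F x a) 0 := by
  have h1 : HasDerivAt (fun t : ℂ => x + t • a) a 0 := by
    simpa using ((hasDerivAt_id (0 : ℂ)).smul_const a).const_add x
  have h2 : HasFDerivAt F (fderiv ℂ F x) (x + (0 : ℂ) • a) := by simpa using hF.hasFDerivAt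
  exact h2.comp_hasDerivAt (0 : ℂ) h1

theorem hasDerivAt_line_clm {U : Type*} [NormedAddCommGroup U] [NormedSpace ℂ U]
    {T : V → U →L[ℂ] W} {x : V} (hT : DifferentiableAt ℂ T x) (a : V) (b : U) :
    HasDerivAt (fun t : ℂ => T (x + t • a) b) (fderiv ℂ T x a b) 0 :=
  (ContinuousLinearMap.apply ℂ W b).hasFDerivAt.comp_hasDerivAt (0 : ℂ) (hasDerivAt_line hT a)

theorem fderiv_fderiv_comm [CompleteSpace W] {g : V → W} {x : V} (hg : AnalyticAt ℂ g x) (a b : V) :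
    fderiv ℂ (fderiv ℂ g) x a b = fderiv ℂ (fderiv ℂ g) x b a :=
  second_derivative_symmetric_of_eventually
    (hg.eventually_analyticAt.mono fun _ h => h.differentiableAt.hasFDerivAt)
    hg.fderiv.differentiableAt.hasFDerivAt a b

variable {U W' : Type*} [NormedAddCommGroup U] [NormedSpace ℂ U]
  [NormedAddCommGroup W'] [NormedSpace ℂ W']

theorem _root_.AnalyticAt.clm_apply_analyticAt {T : V → U →L[ℂ] W} {u : V → U} {x : V}
    (hT : AnalyticAt ℂ T x) (hu : AnalyticAt ℂ u x) : AnalyticAt ℂ (fun y => T y (u y)) x :=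
  ((ContinuousLinearMap.id ℂ (U →L[ℂ] W)).analyticAt_bilinear (T x, u x)).comp₂ hT hu

theorem _root_.AnalyticAt.clm_comp_analyticAt {T : V → W →L[ℂ] W'} {u : V → U →L[ℂ] W} {x : V}
    (hT : AnalyticAt ℂ T x) (hu : AnalyticAt ℂ u x) :
    AnalyticAt ℂ (fun y => (T y).comp (u y)) x :=
  ((ContinuousLinearMap.compL ℂ U W W').analyticAt_bilinear (T x, u x)).comp₂ hT hu

end Lines

/-! ### Banach algebras with a backward shift. -/

/-- A Banach algebra `D` of functions of `w` with values in `R`: it has a coordinate, the constants,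
the evaluation at `0` and the backward shift. -/
structure ShiftAlgebra (R D : Type*) [NormedRing R] [NormedAlgebra ℂ R]
    [NormedRing D] [NormedAlgebra ℂ D] where
  coord : D
  const : R →L[ℂ] D
  eval : D →L[ℂ] R
  shift : D →L[ℂ] D
  mul_coord : ∀ a, a * coord = coord * a
  cancel : ∀ {a b}, coord * a = coord * b → a = b
  const_mul : ∀ m m', const (m * m') = const m * const m'
  eval_const : ∀ m, eval (const m) = m
  eval_one : eval 1 = 1
  eval_mul : ∀ a b, eval (a * b) = eval a * eval b
  eval_coord_mul : ∀ a, eval (coord * a) = 0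
  coord_mul_shift : ∀ a, coord * shift a = a - const (eval a)

theorem ShiftAlgebra.shift_coord_mul {R D : Type*} [NormedRing R] [NormedAlgebra ℂ R]
    [NormedRing D] [NormedAlgebra ℂ D] (S : ShiftAlgebra R D) {a b : D} (h : S.coord * b = a) :
    S.shift a = b := by
  refine S.cancel ?_
  rw [S.coord_mul_shift, ← h, S.eval_coord_mul, map_zero, sub_zero]

/-- The disc algebra as a shift algebra. -/
def discShiftAlgebra (R : Type*) [NormedRing R] [NormedAlgebra ℂ R] [CompleteSpace R] :
    ShiftAlgebra R (DiscAlgebra R) where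
  coord := discCoord R
  const := discConst R
  eval := discEval R 0
  shift := discShift R
  mul_coord := discCoord_mul_comm
  cancel := discCoord_mul_cancel
  const_mul := discConst_mul
  eval_const := discEval_const 0
  eval_one := rfl
  eval_mul := discEval_mul 0
  eval_coord_mul a := by rw [discEval_coord_mul, Disc.coe_zero, zero_smul]
  coord_mul_shift := discCoord_mul_shift

/-- The algebra behind the integrability of the equation `w dg + c g + g C = 0`. -/
theorem defect_identity {A : Type*} [Ring A] 
    {z g ga gb gab ca cb cab cba Ca Cb Cab Cba Ea Eb Eab Eba : A}
    (hz : ∀ y, y * z = z * y) (hflat : z * (cab - cba) + (ca * cb - cb * ca) = 0)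
    (hcomm : Ca * Cb = Cb * Ca)
    (ha : z * Ea = z * ga + ca * g + g * Ca) (hb : z * Eb = z * gb + cb * g + g * Cb)
    (hab : z * Eab = z * gab + (cab * g + cb * ga) + (ga * Cb + g * Cab))
    (hba : z * Eba = z * gab + (cba * g + ca * gb) + (gb * Ca + g * Cba)) :
    z * (z * (Eab - Eba)) =
      z * (cb * Ea - ca * Eb + Ea * Cb - Eb * Ca + g * (Cab - Cba)) := by
  -- One factor z is moved onto the derivatives of c and g, so that flatness and the relations
  -- defining Ea and Eb can replace them. The terms quadratic in c and the mixed terms in c and C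
  -- cancel directly, those quadratic in C by `hcomm`.
  have e1 : z * (z * (Eab - Eba)) = (z * (cab - cba)) * g + cb * (z * ga) - ca * (z * gb)
      + (z * ga) * Cb - (z * gb) * Ca + z * (g * (Cab - Cba)) := by
    rw [mul_sub z Eab, hab, hba, ← mul_assoc cb z, ← mul_assoc ca z, hz, hz]
    noncomm_ring
  have e2 : z * (cab - cba) = -(ca * cb - cb * ca) := eq_neg_of_add_eq_zero_left hflat
  have e3 : z * ga = z * Ea - ca * g - g * Ca := by rw [ha]; abel
  have e4 : z * gb = z * Eb - cb * g - g * Cb := by rw [hb]; abel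
  rw [e1, e2, e3, e4]
  have e5 : g * Ca * Cb = g * Cb * Ca := by rw [mul_assoc, hcomm, mul_assoc]
  have e6 : cb * (z * Ea - ca * g - g * Ca) = z * (cb * Ea) - cb * ca * g - cb * g * Ca := by
    rw [mul_sub, mul_sub, ← mul_assoc, hz]; noncomm_ring
  have e7 : ca * (z * Eb - cb * g - g * Cb) = z * (ca * Eb) - ca * cb * g - ca * g * Cb := by
    rw [mul_sub, mul_sub, ← mul_assoc, hz]; noncomm_ring
  rw [e6, e7]
  simp only [mul_sub, sub_mul, mul_add, ← mul_assoc, e5]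
  noncomm_ring

/-! ### Integration of the parameter part of the connection. -/

section Transport

variable {R D : Type*} [NormedRing R] [NormedAlgebra ℂ R] [CompleteSpace R]
  [NormedRing D] [NormedAlgebra ℂ D]
  {V : Type*} [NormedAddCommGroup V] [NormedSpace ℂ V]

theorem analyticAt_ringInverse {E : Type*} [NormedAddCommGroup E] [NormedSpace ℂ E] {F : E → R}
    {e : E} (hF : AnalyticAt ℂ F e) (hu : IsUnit (F e)) :
    AnalyticAt ℂ (fun x => Ring.inverse (F x)) e := by
  obtain ⟨u, hu⟩ := hu
  have h := analyticAt_inverse (𝕜 := ℂ) u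
  rw [hu] at h
  exact h.comp hF

theorem eventually_isUnit {X : Type*} [TopologicalSpace X] {F : X → R} {x : X}
    (hF : ContinuousAt F x) (hu : IsUnit (F x)) : ∀ᶠ y in 𝓝 x, IsUnit (F y) :=
  hF.eventually (Units.isOpen.mem_nhds hu)

/-- Differentiating the relation that defines `E` and antisymmetrizing removes the second
derivatives of `g`. Flatness then leaves an identity that is linear in `E`, apart from the exterior
derivative of `C`. -/
theorem defect_derivative (S : ShiftAlgebra R D) [CompleteSpace D] {c C E : V → V →L[ℂ] D}
    {g : V → D} {x : V}
    (hc : DifferentiableAt ℂ c x) (hC : DifferentiableAt ℂ C x) (hE : DifferentiableAt ℂ E x)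
    (hg : AnalyticAt ℂ g x)
    (hflat : ∀ a b, S.coord * (fderiv ℂ c x a b - fderiv ℂ c x b a) +
      (c x a * c x b - c x b * c x a) = 0)
    (hcomm : ∀ a b, C x a * C x b = C x b * C x a)
    (hdef : ∀ᶠ y in 𝓝 x, ∀ b, S.coord * E y b = S.coord * fderiv ℂ g y b + c y b * g y + g y * C y b)
    (a b : V) :
    S.coord * (fderiv ℂ E x a b - fderiv ℂ E x b a) = c x b * E x a - c x a * E x b +
      E x a * C x b - E x b * C x a + g x * (fderiv ℂ C x a b - fderiv ℂ C x b a) := by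
  have hder : ∀ a b, S.coord * fderiv ℂ E x a b = S.coord * fderiv ℂ (fderiv ℂ g) x a b +
      (fderiv ℂ c x a b * g x + c x b * fderiv ℂ g x a) +
      (fderiv ℂ g x a * C x b + g x * fderiv ℂ C x a b) := fun a b => by
    have ht : Tendsto (fun t : ℂ => x + t • a) (𝓝 0) (𝓝 x) := by
      have : Continuous fun t : ℂ => x + t • a := by fun_prop
      simpa using this.tendsto 0
    have h1 := (hasDerivAt_line_clm hE a b).const_mul S.coord
    have h2 := (((hasDerivAt_line_clm hg.fderiv.differentiableAt a b).const_mul S.coord).add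
      ((hasDerivAt_line_clm hc a b).mul (hasDerivAt_line hg.differentiableAt a))).add
      ((hasDerivAt_line hg.differentiableAt a).mul (hasDerivAt_line_clm hC a b))
    have h3 := h1.unique (h2.congr_of_eventuallyEq ((ht.eventually hdef).mono fun t h => h b))
    simpa using h3
  have hx := hdef.self_of_nhds
  have hba := hder b a
  rw [fderiv_fderiv_comm hg b a] at hba
  exact S.cancel (defect_identity S.mul_coord (hflat a b) (hcomm a b) (hx a) (hx b) (hder a b) hba)

/-- Integration of the `x`-part of a flat connection with a simple pole in `w`, in a frame at
`w = 0` in which it has no regular part. -/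
theorem exists_transport (S : ShiftAlgebra R D) [CompleteSpace D] [CompleteSpace V]
    {c : V → V →L[ℂ] D} {x₀ : V}
    (hc : AnalyticAt ℂ c x₀)
    (hflat : ∀ᶠ x in 𝓝 x₀, ∀ a b, S.coord * (fderiv ℂ c x a b - fderiv ℂ c x b a) +
      (c x a * c x b - c x b * c x a) = 0) :
    ∃ (g : V → D) (C : V → V →L[ℂ] R), AnalyticAt ℂ g x₀ ∧ AnalyticAt ℂ C x₀ ∧
      g x₀ = 1 ∧ ∀ᶠ x in 𝓝 x₀, ∀ a, S.coord * fderiv ℂ g x a + c x a * g x + g x * S.const (C x a) = 0 := by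
  let inv : D → R := fun y => Ring.inverse (S.eval y)
  -- `C` is eliminated by requiring cg + gC to vanish at w = 0; the sum is then divisible by w and
  -- the shift performs the division. What remains is analytic near (x₀, 0, 1) and linear in the
  -- direction.
  let f : V × V × D → D := fun p =>
    -S.shift (c p.1 p.2.1 * p.2.2 + p.2.2 * S.const (-(inv p.2.2 * S.eval (c p.1 p.2.1) * S.eval p.2.2)))
  have hinv : ∀ y : D, IsUnit (S.eval y) → AnalyticAt ℂ inv y := fun y hy =>
    analyticAt_ringInverse (S.eval.analyticAt y) hy
  have hfa : AnalyticAt ℂ f (x₀, 0, 1) := by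
    have h1 : AnalyticAt ℂ (fun p : V × V × D => c p.1 p.2.1) (x₀, 0, 1) :=
      (AnalyticAt.comp (g := c) (x := (x₀, 0, 1)) hc analyticAt_fst).clm_apply_analyticAt
        (analyticAt_fst.comp analyticAt_snd)
    have h2 : AnalyticAt ℂ (fun p : V × V × D => p.2.2) (x₀, 0, 1) :=
      analyticAt_snd.comp analyticAt_snd
    have h3 : AnalyticAt ℂ (fun p : V × V × D => inv p.2.2) (x₀, 0, 1) :=
      AnalyticAt.comp (g := inv) (hinv _ (by simp [S.eval_one])) h2
    have h4 : AnalyticAt ℂ (fun p : V × V × D => S.eval (c p.1 p.2.1)) (x₀, 0, 1) :=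
      (S.eval.analyticAt _).comp h1
    have h5 : AnalyticAt ℂ (fun p : V × V × D => S.eval p.2.2) (x₀, 0, 1) :=
      (S.eval.analyticAt _).comp h2
    exact (((S.shift).analyticAt _).comp ((h1.mul h2).add (h2.mul
      ((S.const.analyticAt _).comp ((h3.mul h4).mul h5).neg)))).neg
  obtain ⟨g, hg, hg0, hrad⟩ := exists_radial_solution hfa (fun s x u y => by
    simp only [f, map_smul, smul_mul_assoc, mul_smul_comm, ← smul_neg, ← smul_add])
  have hu0 : IsUnit (S.eval (g x₀)) := by simp [hg0, S.eval_one]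
  let G₀ : V → R := fun x => S.eval (g x)
  have hG₀ : AnalyticAt ℂ G₀ x₀ := (S.eval.analyticAt _).comp hg
  have hi : AnalyticAt ℂ (fun x => inv (g x)) x₀ := AnalyticAt.comp (g := inv) (hinv _ hu0) hg
  let C : V → V →L[ℂ] R := fun x => -((ContinuousLinearMap.mul ℂ R (inv (g x))).comp
    (((ContinuousLinearMap.mul ℂ R).flip (G₀ x)).comp (S.eval.comp (c x))))
  have hC_apply : ∀ x a, C x a = -(inv (g x) * (S.eval (c x a) * G₀ x)) := fun x a => rfl
  have hCa : AnalyticAt ℂ C x₀ := by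
    refine AnalyticAt.neg ?_
    refine AnalyticAt.clm_comp_analyticAt (((ContinuousLinearMap.mul ℂ R).analyticAt _).comp hi) ?_
    refine AnalyticAt.clm_comp_analyticAt (((ContinuousLinearMap.mul ℂ R).flip.analyticAt _).comp hG₀) ?_
    exact AnalyticAt.clm_comp_analyticAt analyticAt_const hc
  let C' : V → V →L[ℂ] D := fun x => S.const.comp (C x)
  have hC'a : AnalyticAt ℂ C' x₀ := AnalyticAt.clm_comp_analyticAt analyticAt_const hCa
  -- The defect of the equation in all directions, already divided by w. By construction of `g` it
  -- vanishes on the radial vector x - x₀.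
  let E : V → V →L[ℂ] D := fun x => fderiv ℂ g x + (S.shift).comp
    (((ContinuousLinearMap.mul ℂ (D)).flip (g x)).comp (c x) +
      (ContinuousLinearMap.mul ℂ (D) (g x)).comp (C' x))
  have hE_apply : ∀ x a, E x a = fderiv ℂ g x a + S.shift (c x a * g x + g x * C' x a) :=
    fun x a => rfl
  have hEa : AnalyticAt ℂ E x₀ := by
    refine hg.fderiv.add (AnalyticAt.clm_comp_analyticAt analyticAt_const (AnalyticAt.add ?_ ?_))
    · exact AnalyticAt.clm_comp_analyticAt
        (((ContinuousLinearMap.mul ℂ (D)).flip.analyticAt _).comp hg) hc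
    · exact AnalyticAt.clm_comp_analyticAt (((ContinuousLinearMap.mul ℂ (D)).analyticAt _).comp hg)
        hC'a
  have hunit : ∀ᶠ x in 𝓝 x₀, IsUnit (G₀ x) := eventually_isUnit hG₀.continuousAt hu0
  have hdef : ∀ᶠ y in 𝓝 x₀, ∀ b, S.coord * E y b = S.coord * fderiv ℂ g y b + c y b * g y + g y * C' y b := by
    filter_upwards [hunit] with y hy b
    rw [hE_apply, mul_add, S.coord_mul_shift]
    have : S.eval (c y b * g y + g y * C' y b) = 0 := by
      have hC'0 : S.eval (C' y b) = C y b := S.eval_const _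
      rw [map_add, S.eval_mul, S.eval_mul, hC'0]
      change S.eval (c y b) * G₀ y + G₀ y * C y b = 0
      rw [hC_apply, mul_neg, ← mul_assoc (G₀ y), Ring.mul_inverse_cancel _ hy, one_mul,
        add_neg_cancel]
    rw [this, map_zero, sub_zero, add_assoc]
  have hradE : ∀ᶠ x in 𝓝 x₀, E x (x - x₀) = 0 := by
    filter_upwards [hrad] with x hx
    rw [hE_apply, hx]
    change -S.shift (c x (x - x₀) * g x +
      g x * S.const (-(inv (g x) * S.eval (c x (x - x₀)) * G₀ x))) + _ = 0
    change _ + S.shift (c x (x - x₀) * g x +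
      g x * S.const (-(inv (g x) * (S.eval (c x (x - x₀)) * G₀ x)))) = 0
    rw [mul_assoc (inv (g x)), neg_add_cancel]
  -- A continuous majorant for the right side of the Euler equation `hfinal`, read off from the norm
  -- estimates `t1` to `t5`.
  let N : V → ℝ := fun x => ‖S.shift‖ * ((‖c x‖ + ‖C' x‖) +
    ‖g x‖ * (‖S.const‖ * (‖inv (g x)‖ * (‖S.eval‖ * ‖c x‖ * ‖S.eval‖ + ‖S.eval‖ * ‖C x‖))))
  have hN : ContinuousAt N x₀ := by
    have h1 := hc.continuousAt
    have h2 := hC'a.continuousAt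
    have h3 := hg.continuousAt
    have h4 := hi.continuousAt
    have h5 := hCa.continuousAt
    fun_prop
  have hNM : ∀ᶠ x in 𝓝 x₀, N x ≤ N x₀ + 1 :=
    (hN.eventually_lt continuousAt_const (lt_add_one _)).mono fun _ h => h.le
  have hEzero : ∀ᶠ x in 𝓝 x₀, E x = 0 := by
    refine eventually_eq_zero_of_euler (M := N x₀ + 1)
      (hEa.eventually_analyticAt.mono fun _ h => h.differentiableAt) ?_
    filter_upwards [hNM, hdef.eventually_nhds, hradE.eventually_nhds, hunit, hflat,
      hc.eventually_analyticAt, hC'a.eventually_analyticAt, hCa.eventually_analyticAt,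
      hEa.eventually_analyticAt, hg.eventually_analyticAt]
      with x h1 h2 h3 h4 h5 h6 h7 h7' h8 h9
    -- At w = 0 flatness says that the values of c commute, and `C` is minus a conjugate of c(0).
    have hcomm : ∀ a b, C' x a * C' x b = C' x b * C' x a := fun a b => by
      have h := congrArg S.eval (h5 a b)
      rw [map_add, S.eval_coord_mul, zero_add, map_sub, S.eval_mul,
        S.eval_mul, map_zero, sub_eq_zero] at h
      change S.const (C x a) * S.const (C x b) = S.const (C x b) * S.const (C x a)
      rw [← S.const_mul, ← S.const_mul, hC_apply, hC_apply, neg_mul_neg, neg_mul_neg]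
      have hcan : G₀ x * inv (g x) = 1 := Ring.mul_inverse_cancel _ h4
      have e : ∀ p q : R, inv (g x) * (p * G₀ x) * (inv (g x) * (q * G₀ x)) =
          inv (g x) * (p * q) * G₀ x := fun p q => by
        calc _ = inv (g x) * p * (G₀ x * inv (g x)) * q * G₀ x := by noncomm_ring
          _ = _ := by rw [hcan]; noncomm_ring
      rw [e, e, h]
    have key := fun b => defect_derivative S h6.differentiableAt h7.differentiableAt
      h8.differentiableAt h9 h5 hcomm h2 (x - x₀) b
    have hx3 : E x (x - x₀) = 0 := h3.self_of_nhds
    -- This is the derivative of E(x)(x - x₀) = 0 in the direction b.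
    have hEu : ∀ b, fderiv ℂ E x b (x - x₀) = -E x b := fun b => by
      have hd : HasDerivAt (fun t : ℂ => E (x + t • b) (x + t • b - x₀))
          (fderiv ℂ E x b (x + (0 : ℂ) • b - x₀) + E (x + (0 : ℂ) • b) b) 0 := by
        refine (hasDerivAt_line h8.differentiableAt b).clm_apply ?_
        simpa using (((hasDerivAt_id (0 : ℂ)).smul_const b).const_add x).sub_const x₀
      have ht : Tendsto (fun t : ℂ => x + t • b) (𝓝 0) (𝓝 x) := by
        have : Continuous fun t : ℂ => x + t • b := by fun_prop
        simpa using this.tendsto 0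
      have := hd.unique ((hasDerivAt_const (0 : ℂ) (0 : D)).congr_of_eventuallyEq
        (ht.eventually h3))
      rw [zero_smul, add_zero] at this
      exact eq_neg_of_add_eq_zero_left this
    have hdC : ∀ b, fderiv ℂ C' x (x - x₀) b - fderiv ℂ C' x b (x - x₀) =
        S.const (fderiv ℂ C x (x - x₀) b - fderiv ℂ C x b (x - x₀)) := fun b => by
      have : HasFDerivAt C' ((ContinuousLinearMap.compL ℂ V R D S.const).comp
          (fderiv ℂ C x)) x :=
        (ContinuousLinearMap.compL ℂ V R D S.const).hasFDerivAt.comp x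
          h7'.differentiableAt.hasFDerivAt
      rw [this.fderiv, map_sub S.const]
      rfl
    -- At w = 0 the left side of `key` disappears, which expresses the exterior derivative of `C`
    -- through `E`. Inserted back into `key`, it makes the whole identity homogeneous in `E`.
    have hval : ∀ b, fderiv ℂ C x (x - x₀) b - fderiv ℂ C x b (x - x₀) =
        inv (g x) * (S.eval (c x (x - x₀)) * S.eval (E x b) + S.eval (E x b) * C x (x - x₀)) := fun b => by
      have h := key b
      rw [hx3, hdC] at h
      simp only [mul_zero, zero_mul, zero_sub, add_zero] at h
      replace h := congrArg S.eval h
      rw [S.eval_coord_mul, map_add, map_sub S.eval, map_neg, S.eval_mul, S.eval_mul, S.eval_mul,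
        S.eval_const] at h
      have hcan : inv (g x) * G₀ x = 1 := Ring.inverse_mul_cancel _ h4
      have hC'0 : S.eval (C' x (x - x₀)) = C x (x - x₀) := S.eval_const _
      rw [hC'0] at h
      have h' : G₀ x * (fderiv ℂ C x (x - x₀) b - fderiv ℂ C x b (x - x₀)) =
          S.eval (c x (x - x₀)) * S.eval (E x b) + S.eval (E x b) * C x (x - x₀) := by
        have h'' : ∀ p q r : R, 0 = -p - q + r → r = p + q := fun p q r h => by
          rw [eq_comm, neg_sub_left, neg_add_eq_zero] at h; rw [← h]; abel
        exact h'' _ _ _ h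
      rw [← h', ← mul_assoc, hcan, one_mul]
    have hfinal : ∀ b, fderiv ℂ E x (x - x₀) b + E x b = S.shift
        (-(c x (x - x₀) * E x b) - E x b * C' x (x - x₀) + g x * S.const (inv (g x) *
          (S.eval (c x (x - x₀)) * S.eval (E x b) + S.eval (E x b) * C x (x - x₀)))) := fun b => by
      refine (S.shift_coord_mul ?_).symm
      have hk := key b
      rw [hx3, hdC, hval, hEu, sub_neg_eq_add] at hk
      simp only [mul_zero, zero_mul, zero_sub, add_zero] at hk
      exact hk
    refine ContinuousLinearMap.opNorm_le_bound _ ?_ fun b => ?_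
    · have : 0 ≤ N x := by positivity
      have : 0 ≤ N x₀ + 1 := this.trans h1
      positivity
    · rw [add_apply, hfinal]
      set h := x - x₀
      set e := E x b
      have hc1 : ‖c x h‖ ≤ ‖c x‖ * ‖h‖ := (c x).le_opNorm h
      have hC1 : ‖C' x h‖ ≤ ‖C' x‖ * ‖h‖ := (C' x).le_opNorm h
      have hC2 : ‖C x h‖ ≤ ‖C x‖ * ‖h‖ := (C x).le_opNorm h
      have he1 : ‖S.eval e‖ ≤ ‖S.eval‖ * ‖e‖ := S.eval.le_opNorm e
      have he2 : ‖S.eval (c x h)‖ ≤ ‖S.eval‖ * (‖c x‖ * ‖h‖) :=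
        (S.eval.le_opNorm _).trans (by gcongr)
      have t1 : ‖c x h * e‖ ≤ ‖c x‖ * ‖h‖ * ‖e‖ := (norm_mul_le _ _).trans (by gcongr)
      have t2 : ‖e * C' x h‖ ≤ ‖e‖ * (‖C' x‖ * ‖h‖) := (norm_mul_le _ _).trans (by gcongr)
      have t3 : ‖S.eval (c x h) * S.eval e + S.eval e * C x h‖ ≤
          ‖S.eval‖ * (‖c x‖ * ‖h‖) * (‖S.eval‖ * ‖e‖) + ‖S.eval‖ * ‖e‖ * (‖C x‖ * ‖h‖) :=
        (norm_add_le _ _).trans (add_le_add ((norm_mul_le _ _).trans (by gcongr))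
          ((norm_mul_le _ _).trans (by gcongr)))
      have t4 : ‖g x * S.const (inv (g x) * (S.eval (c x h) * S.eval e + S.eval e * C x h))‖ ≤ ‖g x‖ * (‖S.const‖ *
          (‖inv (g x)‖ * (‖S.eval‖ * (‖c x‖ * ‖h‖) * (‖S.eval‖ * ‖e‖) + ‖S.eval‖ * ‖e‖ * (‖C x‖ * ‖h‖)))) := by
        refine (norm_mul_le _ _).trans ?_
        gcongr
        refine (S.const.le_opNorm _).trans ?_
        gcongr
        exact (norm_mul_le _ _).trans (by gcongr)
      have t5 : ‖-(c x h * e) - e * C' x h +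
          g x * S.const (inv (g x) * (S.eval (c x h) * S.eval e + S.eval e * C x h))‖ ≤
          ‖c x‖ * ‖h‖ * ‖e‖ + ‖e‖ * (‖C' x‖ * ‖h‖) + ‖g x‖ * (‖S.const‖ *
          (‖inv (g x)‖ * (‖S.eval‖ * (‖c x‖ * ‖h‖) * (‖S.eval‖ * ‖e‖) + ‖S.eval‖ * ‖e‖ * (‖C x‖ * ‖h‖)))) := by
        refine (norm_add_le _ _).trans (add_le_add ((norm_sub_le _ _).trans ?_) t4)
        rw [norm_neg]
        exact add_le_add t1 t2
      calc _ ≤ ‖S.shift‖ * _ := (S.shift).le_opNorm _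
        _ ≤ ‖S.shift‖ * _ := mul_le_mul_of_nonneg_left t5 (norm_nonneg _)
        _ = N x * (‖h‖ * ‖e‖) := by simp only [N]; ring
        _ ≤ (N x₀ + 1) * (‖h‖ * (‖E x‖ * ‖b‖)) := by
          have : 0 ≤ N x := by positivity
          have h0 : 0 ≤ N x₀ + 1 := this.trans h1
          gcongr
          exact (E x).le_opNorm b
        _ = _ := by ring
  refine ⟨g, C, hg, hCa, hg0, ?_⟩
  filter_upwards [hEzero, hdef] with x h1 h2 a
  have h3 := h2 a
  rw [h1, zero_apply, mul_zero] at h3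
  exact h3.symm

end Transport

open scoped Matrix.Norms.L2Operator

/-! ### Neighbourhoods of infinity in the coordinate w = 1/z. -/

section NearInfinity

variable {V : Type*} [NormedAddCommGroup V]

theorem eventually_cobounded_iff {P : ℂ → Prop} :
    (∀ᶠ z in Bornology.cobounded ℂ, P z) ↔ ∃ r : ℝ, 0 < r ∧ ∀ w : ℂ, w ≠ 0 → ‖w‖ < r → P w⁻¹ := by
  rw [← Filter.inv_nhdsNE_zero, Filter.eventually_inv]
  rw [eventually_nhdsWithin_iff, Metric.eventually_nhds_iff]
  refine ⟨fun ⟨r, hr, h⟩ => ⟨r, hr, fun w hw hwr => h (by simpa using hwr) hw⟩,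
    fun ⟨r, hr, h⟩ => ⟨r, hr, fun w hwr hw => h w hw (by simpa using hwr)⟩⟩

theorem eventually_nearInfinity_iff {x₀ : V} {P : ℂ × V → Prop} :
    (∀ᶠ p in nearInfinity x₀, P p) ↔ ∃ r : ℝ, 0 < r ∧
      ∀ (w : ℂ) (x : V), w ≠ 0 → ‖w‖ < r → x ∈ Metric.ball x₀ r → P (w⁻¹, x) := by
  rw [nearInfinity, eventually_prod_iff]
  constructor
  · rintro ⟨pa, ha, pb, hb, h⟩
    obtain ⟨r, hr, hr'⟩ := eventually_cobounded_iff.1 ha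
    obtain ⟨s, hs, hs'⟩ := Metric.eventually_nhds_iff_ball.1 hb
    exact ⟨min r s, lt_min hr hs, fun w x hw hwr hx => h (hr' w hw (hwr.trans_le (min_le_left _ _)))
      (hs' x (Metric.ball_subset_ball (min_le_right _ _) hx))⟩
  · rintro ⟨r, hr, h⟩
    refine ⟨fun z => ∀ x ∈ Metric.ball x₀ r, P (z, x),
      eventually_cobounded_iff.2 ⟨r, hr, fun w hw hwr x hx => h w x hw hwr hx⟩,
      fun x => x ∈ Metric.ball x₀ r, Metric.ball_mem_nhds _ hr, fun ha _ hb => ha _ hb⟩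

/-- The sets {|z| > 1/r} × ball are open, so relations that hold near infinity may be differentiated
there. -/
theorem eventually_nearInfinity_nhds {x₀ : V} {P : ℂ × V → Prop}
    (h : ∀ᶠ p in nearInfinity x₀, P p) : ∀ᶠ p in nearInfinity x₀, ∀ᶠ q in 𝓝 p, P q := by
  obtain ⟨r, hr, h⟩ := eventually_nearInfinity_iff.1 h
  refine eventually_nearInfinity_iff.2 ⟨r, hr, fun w x hw hwr hx => ?_⟩
  have hc : ContinuousAt (fun q : ℂ × V => q.1⁻¹) (w⁻¹, x) :=
    continuousAt_fst.inv₀ (inv_ne_zero hw)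
  have h1 : ∀ᶠ q : ℂ × V in 𝓝 (w⁻¹, x), q.1⁻¹ ∈ Metric.ball (0 : ℂ) r :=
    hc.eventually_mem (by simpa using Metric.isOpen_ball.mem_nhds (by simpa using hwr))
  have h2 : ∀ᶠ q : ℂ × V in 𝓝 (w⁻¹, x), q.1 ≠ 0 :=
    continuousAt_fst.eventually_ne (inv_ne_zero hw)
  have h3 : ∀ᶠ q : ℂ × V in 𝓝 (w⁻¹, x), q.2 ∈ Metric.ball x₀ r :=
    continuousAt_snd.eventually_mem (Metric.isOpen_ball.mem_nhds hx)
  filter_upwards [h1, h2, h3] with q hq1 hq2 hq3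
  have := h q.1⁻¹ q.2 (inv_ne_zero hq2) (by simpa using hq1) hq3
  simpa using this

theorem eventually_nearInfinity_of_nhds {x₀ : V} {P : ℂ × V → Prop}
    (h : ∀ᶠ q in 𝓝 ((0 : ℂ), x₀), P q) : ∀ᶠ p in nearInfinity x₀, P (p.1⁻¹, p.2) := by
  obtain ⟨r, hr, h⟩ := Metric.eventually_nhds_iff_ball.1 h
  refine eventually_nearInfinity_iff.2 ⟨r, hr, fun w x _ hwr hx => ?_⟩
  rw [inv_inv]
  refine h _ ?_
  rw [← ball_prod_same]
  exact ⟨by simpa using hwr, hx⟩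

theorem eventually_nearInfinity_of_nhds_snd {x₀ : V} {P : V → Prop}
    (h : ∀ᶠ x in 𝓝 x₀, P x) : ∀ᶠ p in nearInfinity x₀, P p.2 :=
  tendsto_snd.eventually h

theorem eventually_nearInfinity_ne_zero (x₀ : V) : ∀ᶠ p in nearInfinity x₀, p.1 ≠ 0 :=
  eventually_nearInfinity_iff.2 ⟨1, one_pos, fun _ _ hw _ _ => inv_ne_zero hw⟩

end NearInfinity

/-! ### Change of frame and flatness. -/

section Gauge

variable {n : ℕ} {V : Type*} [NormedAddCommGroup V] [NormedSpace ℂ V]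

theorem analyticAt_matrix_inv {E : Type*} [NormedAddCommGroup E] [NormedSpace ℂ E] {F : E → Mat n}
    {e : E} (hF : AnalyticAt ℂ F e) (hu : IsUnit (F e)) : AnalyticAt ℂ (fun x => (F x)⁻¹) e := by
  simp only [Matrix.nonsing_inv_eq_ringInverse]
  exact analyticAt_ringInverse hF hu

theorem mat_mul_inv {M : Mat n} (h : IsUnit M) : M * M⁻¹ = 1 :=
  Matrix.mul_nonsing_inv _ ((Matrix.isUnit_iff_isUnit_det _).1 h)

theorem mat_inv_mul {M : Mat n} (h : IsUnit M) : M⁻¹ * M = 1 :=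
  Matrix.nonsing_inv_mul _ ((Matrix.isUnit_iff_isUnit_det _).1 h)

theorem mul_gauge {G : ℂ × V → Mat n} {p : ℂ × V} (hu : IsUnit (G p)) (Ω : ConnForm n V)
    (v : ℂ × V) : G p * gauge G Ω p v = Ω p v * G p + fderiv ℂ G p v := by
  rw [gauge, mul_add, ← mul_assoc, ← mul_assoc, ← mul_assoc, mat_mul_inv hu, one_mul, one_mul]

/-- `gauge G Ω p v = M` in denominator-free form. -/
theorem gauge_eq_iff {G : ℂ × V → Mat n} {p : ℂ × V} (hu : IsUnit (G p)) {Ω : ConnForm n V}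
    {v : ℂ × V} {M : Mat n} :
    gauge G Ω p v = M ↔ Ω p v * G p + fderiv ℂ G p v = G p * M := by
  rw [← mul_gauge hu]
  exact ⟨fun h => by rw [h], fun h => hu.mul_left_cancel h⟩

/-- Flatness does not depend on the frame. -/
theorem flat_gauge {Ω Ω' : ConnForm n V} {G : ℂ × V → Mat n} {p : ℂ × V}
    (hG : AnalyticAt ℂ G p) (hu : IsUnit (G p)) (hΩ : ∀ v, DifferentiableAt ℂ (fun q => Ω q v) p)
    (hΩ' : ∀ᶠ q in 𝓝 p, ∀ v, gauge G Ω q v = Ω' q v)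
    (hflat : ∀ u v, fderiv ℂ (fun q => Ω q v) p u - fderiv ℂ (fun q => Ω q u) p v +
      (Ω p u * Ω p v - Ω p v * Ω p u) = 0) (u v : ℂ × V) :
    fderiv ℂ (fun q => Ω' q v) p u - fderiv ℂ (fun q => Ω' q u) p v +
      (Ω' p u * Ω' p v - Ω' p v * Ω' p u) = 0 := by
  have hd : ∀ v, DifferentiableAt ℂ (fun q => Ω' q v) p := fun v => by
    have h1 : DifferentiableAt ℂ (fun q => gauge G Ω q v) p := by
      have h2 : DifferentiableAt ℂ (fun q => fderiv ℂ G q v) p :=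
        hG.fderiv.differentiableAt.clm_apply (differentiableAt_const v)
      have h3 := (analyticAt_matrix_inv hG hu).differentiableAt
      exact ((h3.mul (hΩ v)).mul hG.differentiableAt).add (h3.mul h2)
    exact h1.congr_of_eventuallyEq (hΩ'.mono fun q h => (h v).symm)
  have hunit := eventually_isUnit hG.continuousAt hu
  have hmul : ∀ᶠ q in 𝓝 p, ∀ v, G q * Ω' q v = Ω q v * G q + fderiv ℂ G q v := by
    filter_upwards [hΩ', hunit] with q h1 h2 v
    rw [← h1, mul_gauge h2]
  -- The relation GΩ' = ΩG + dG is differentiated, rather than the formula with G⁻¹; the second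
  -- derivative of `G` is symmetric and cancels in the curvature.
  have hder : ∀ u v, fderiv ℂ G p u * Ω' p v + G p * fderiv ℂ (fun q => Ω' q v) p u =
      fderiv ℂ (fun q => Ω q v) p u * G p + Ω p v * fderiv ℂ G p u +
        fderiv ℂ (fderiv ℂ G) p u v := fun u v => by
    have ht : Tendsto (fun t : ℂ => p + t • u) (𝓝 0) (𝓝 p) := by
      have : Continuous fun t : ℂ => p + t • u := by fun_prop
      simpa using this.tendsto 0
    have h1 := (hasDerivAt_line hG.differentiableAt u).mul (hasDerivAt_line (hd v) u)
    have h2 := ((hasDerivAt_line (hΩ v) u).mul (hasDerivAt_line hG.differentiableAt u)).add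
      (hasDerivAt_line_clm hG.fderiv.differentiableAt u v)
    have h3 := h1.unique (h2.congr_of_eventuallyEq ((ht.eventually hmul).mono fun t h => h v))
    simpa using h3
  have hp := hmul.self_of_nhds
  have huv := hder u v
  have hvu := hder v u
  rw [fderiv_fderiv_comm hG v u] at hvu
  refine hu.mul_left_cancel ?_
  rw [mul_zero]
  generalize fderiv ℂ (fun q => Ω' q v) p u = X at *
  generalize fderiv ℂ (fun q => Ω' q u) p v = Y at *
  have e1 : G p * X = fderiv ℂ (fun q => Ω q v) p u * G p + Ω p v * fderiv ℂ G p u +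
        fderiv ℂ (fderiv ℂ G) p u v - fderiv ℂ G p u * Ω' p v := by rw [← huv]; abel
  have e2 : G p * Y = fderiv ℂ (fun q => Ω q u) p v * G p + Ω p u * fderiv ℂ G p v +
        fderiv ℂ (fderiv ℂ G) p u v - fderiv ℂ G p v * Ω' p u := by rw [← hvu]; abel
  have e3 : ∀ a b, G p * (Ω' p a * Ω' p b) =
      Ω p a * (Ω p b * G p + fderiv ℂ G p b) + fderiv ℂ G p a * Ω' p b := fun a b => by
    rw [← mul_assoc, hp, add_mul, mul_assoc, hp]
  have e4 := congrArg (fun m => m * G p) (hflat u v)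
  simp only [zero_mul] at e4
  rw [mul_add, mul_sub, mul_sub, e1, e2, e3, e3, ← e4]
  noncomm_ring

end Gauge

/-! ### Connections with a pole of order two. -/

section Pole

variable {n : ℕ} {V : Type*} [NormedAddCommGroup V] [NormedSpace ℂ V] [FiniteDimensional ℂ V]

theorem HasPoleOrderTwo.exists_clm {x₀ : V} {Ω : ConnForm n V} (h : HasPoleOrderTwo x₀ Ω) :
    ∃ (a : ℂ × V → Mat n) (c : ℂ × V → V →L[ℂ] Mat n), AnalyticAt ℂ a (0, x₀) ∧
      AnalyticAt ℂ c (0, x₀) ∧ ∀ᶠ p in nearInfinity x₀, ∀ v,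
        Ω p v = v.1 • a (p.1⁻¹, p.2) + p.1 • c (p.1⁻¹, p.2) v.2 := by
  obtain ⟨a, c, ha, hc, h⟩ := h
  obtain ⟨T, hT, hTc⟩ := exists_analyticAt_clm_linearMap hc
  refine ⟨a, T, ha, hT, h.mono fun p hp v => ?_⟩
  rw [hp, hTc]
  rfl

theorem analyticAt_inv_fst_snd {p : ℂ × V} (hp : p.1 ≠ 0) :
    AnalyticAt ℂ (fun q : ℂ × V => (q.1⁻¹, q.2)) p :=
  (analyticAt_fst.inv hp).prod analyticAt_snd

theorem HasPoleOrderTwo.analyticAt {x₀ : V} {Ω : ConnForm n V} (h : HasPoleOrderTwo x₀ Ω) :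
    ∀ᶠ p in nearInfinity x₀, ∀ v, AnalyticAt ℂ (fun q => Ω q v) p := by
  obtain ⟨a, c, ha, hc, h⟩ := h.exists_clm
  filter_upwards [eventually_nearInfinity_nhds h, eventually_nearInfinity_ne_zero x₀,
    eventually_nearInfinity_of_nhds ha.eventually_analyticAt,
    eventually_nearInfinity_of_nhds hc.eventually_analyticAt] with p h1 h2 h3 h4 v
  have h5 : AnalyticAt ℂ (fun q : ℂ × V => v.1 • a (q.1⁻¹, q.2) + q.1 • c (q.1⁻¹, q.2) v.2) p := by
    have hi := analyticAt_inv_fst_snd h2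
    exact ((analyticAt_const (v := v.1)).smul (AnalyticAt.comp (g := a) (f := fun q : ℂ × V => (q.1⁻¹, q.2)) h3 hi)).add (analyticAt_fst.smul
      ((AnalyticAt.comp (g := c) (f := fun q : ℂ × V => (q.1⁻¹, q.2)) h4 hi).clm_apply_analyticAt analyticAt_const))
  exact h5.congr (h1.mono fun q h => (h v).symm)

theorem IsFrameAtInfinity.eventually {x₀ : V} {G : ℂ × V → Mat n} (h : IsFrameAtInfinity x₀ G) :
    ∀ᶠ p in nearInfinity x₀, AnalyticAt ℂ G p ∧ IsUnit (G p) := by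
  obtain ⟨g, hg, hu, h⟩ := h
  filter_upwards [eventually_nearInfinity_nhds h, eventually_nearInfinity_ne_zero x₀,
    eventually_nearInfinity_of_nhds hg.eventually_analyticAt,
    eventually_nearInfinity_of_nhds (eventually_isUnit hg.continuousAt hu)] with p h1 h2 h3 h4
  refine ⟨AnalyticAt.congr (AnalyticAt.comp (g := g) (f := fun q : ℂ × V => (q.1⁻¹, q.2)) h3
    (analyticAt_inv_fst_snd h2)) (h1.mono fun q h => h.symm), ?_⟩
  rw [h1.self_of_nhds]
  exact h4

end Pole

/-! ### Rigidity of the part of positive degree in w. -/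

section Tail

variable {R D : Type*} [NormedRing R] [NormedAlgebra ℂ R] [CompleteSpace R]
  [NormedRing D] [NormedAlgebra ℂ D] [CompleteSpace D]
  {V : Type*} [NormedAddCommGroup V] [NormedSpace ℂ V]

theorem ShiftAlgebra.shift_const (S : ShiftAlgebra R D) (m : R) : S.shift (S.const m) = 0 := by
  refine S.cancel ?_
  rw [S.coord_mul_shift, S.eval_const, sub_self, mul_zero]

/-- After multiplication by the coordinate the shift becomes a subtraction, which is compatible with
constant factors. The next lemma is the version for left factors. -/
theorem ShiftAlgebra.shift_mul_const (S : ShiftAlgebra R D) (a : D) (m : R) :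
    S.shift (a * S.const m) = S.shift a * S.const m := by
  refine S.cancel ?_
  rw [S.coord_mul_shift, ← mul_assoc, S.coord_mul_shift, S.eval_mul, S.eval_const, S.const_mul,
    sub_mul]

theorem ShiftAlgebra.shift_const_mul (S : ShiftAlgebra R D) (a : D) (m : R) :
    S.shift (S.const m * a) = S.const m * S.shift a := by
  refine S.cancel ?_
  rw [S.coord_mul_shift, ← mul_assoc, ← S.mul_coord, mul_assoc, S.coord_mul_shift, S.eval_mul,
    S.eval_const, S.const_mul, mul_sub]

/-- A function of `w` whose part of degree at least one is constant at `x₀` keeps this part along the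
flow of `w (dα + m) + [α, C] = 0`. -/
theorem tail_eq_of_flow (S : ShiftAlgebra R D) {α : V → D} {C m : V → V →L[ℂ] R} {x₀ : V} {p q : R}
    (hα : AnalyticAt ℂ α x₀) (hC : AnalyticAt ℂ C x₀)
    (hflow : ∀ᶠ x in 𝓝 x₀, ∀ b, S.coord * (fderiv ℂ α x b + S.const (m x b)) +
      (α x * S.const (C x b) - S.const (C x b) * α x) = 0)
    (h0 : α x₀ = S.const p + S.coord * S.const q) :
    ∀ᶠ x in 𝓝 x₀, α x = S.const (S.eval (α x)) + S.coord * S.const q := by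
  -- The part of positive degree divided by w, minus its value at x₀. It vanishes at x₀ and will
  -- satisfy the homogeneous equation dβ = [C, shift β].
  let β : V → D := fun x => S.shift (α x) - S.const q
  have hβa : AnalyticAt ℂ β x₀ := ((S.shift.analyticAt _).comp hα).sub analyticAt_const
  have hshift0 : S.shift (α x₀) = S.const q := by
    rw [h0, map_add, S.shift_const, zero_add]
    exact S.shift_coord_mul rfl
  have hβ : ∀ᶠ x in 𝓝 x₀, β x = 0 := by
    let N : V → ℝ := fun x => 2 * (‖S.shift‖ * ‖S.const‖ * ‖C x‖)
    have hN : ContinuousAt N x₀ := by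
      have := hC.continuousAt
      fun_prop
    have hNM : ∀ᶠ x in 𝓝 x₀, N x ≤ N x₀ + 1 :=
      (hN.eventually_lt continuousAt_const (lt_add_one _)).mono fun _ h => h.le
    refine eventually_eq_zero_of_fderiv_le (M := N x₀ + 1)
      (hβa.eventually_analyticAt.mono fun _ h => h.differentiableAt) (by simp [β, hshift0]) ?_
    filter_upwards [hNM, hflow, hα.eventually_analyticAt] with x h1 h2 h3 b
    -- At w = 0 the flow equation says that α(0) commutes with C. The bracket in it is therefore
    -- divisible by w, and the whole equation can be divided by w.
    have hcomm : S.eval (α x) * C x b = C x b * S.eval (α x) := by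
      have := congrArg S.eval (h2 b)
      rw [map_add, S.eval_coord_mul, zero_add, map_sub, S.eval_mul, S.eval_mul, S.eval_const,
        map_zero, sub_eq_zero] at this
      exact this
    have hα' : α x = S.const (S.eval (α x)) + S.coord * S.shift (α x) := by
      rw [S.coord_mul_shift]; abel
    have hbr : α x * S.const (C x b) - S.const (C x b) * α x = S.coord *
        (S.shift (α x) * S.const (C x b) - S.const (C x b) * S.shift (α x)) := by
      conv_lhs => rw [hα']
      rw [add_mul, mul_add, ← S.const_mul, ← S.const_mul, hcomm, ← mul_assoc (S.const (C x b)),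
        S.mul_coord]
      noncomm_ring
    have h4 := h2 b
    rw [hbr, ← mul_add] at h4
    have h5 : fderiv ℂ α x b + S.const (m x b) +
        (S.shift (α x) * S.const (C x b) - S.const (C x b) * S.shift (α x)) = 0 :=
      S.cancel (h4.trans (mul_zero _).symm)
    have h6 : fderiv ℂ β x b = S.shift (fderiv ℂ α x b) := by
      have : HasFDerivAt β (S.shift.comp (fderiv ℂ α x)) x :=
        (S.shift.hasFDerivAt.comp x h3.differentiableAt.hasFDerivAt).sub_const _
      rw [this.fderiv]; rfl
    have hSβ : S.shift (β x) = S.shift (S.shift (α x)) := by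
      simp only [β, map_sub, S.shift_const, sub_zero]
    have h7 : fderiv ℂ β x b =
        S.const (C x b) * S.shift (β x) - S.shift (β x) * S.const (C x b) := by
      -- A second shift kills the constant term `m`.
      have h8 := congrArg S.shift h5
      rw [map_add, map_add, S.shift_const, add_zero, map_sub, S.shift_mul_const, S.shift_const_mul,
        map_zero, ← h6, ← hSβ] at h8
      rw [eq_neg_of_add_eq_zero_left h8, neg_sub]
    rw [h7]
    have hc1 : ‖S.const (C x b)‖ ≤ ‖S.const‖ * (‖C x‖ * ‖b‖) :=
      (S.const.le_opNorm _).trans (by gcongr; exact (C x).le_opNorm b)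
    have hb1 : ‖S.shift (β x)‖ ≤ ‖S.shift‖ * ‖β x‖ := S.shift.le_opNorm _
    calc _ ≤ ‖S.const (C x b) * S.shift (β x)‖ + ‖S.shift (β x) * S.const (C x b)‖ :=
          norm_sub_le _ _
      _ ≤ ‖S.const‖ * (‖C x‖ * ‖b‖) * (‖S.shift‖ * ‖β x‖) +
          ‖S.shift‖ * ‖β x‖ * (‖S.const‖ * (‖C x‖ * ‖b‖)) :=
        add_le_add ((norm_mul_le _ _).trans (by gcongr)) ((norm_mul_le _ _).trans (by gcongr))
      _ = N x * (‖b‖ * ‖β x‖) := by simp only [N]; ring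
      _ ≤ _ := by gcongr
  filter_upwards [hβ] with x hx
  have : S.shift (α x) = S.const q := sub_eq_zero.1 hx
  rw [← this, S.coord_mul_shift]
  abel

end Tail

/-! ### From maps into a function algebra back to functions of (w, x). -/

section Evaluation

variable {R D : Type*} [NormedRing R] [NormedAlgebra ℂ R] [CompleteSpace R]
  [NormedRing D] [NormedAlgebra ℂ D] [CompleteSpace D]
  {V : Type*} [NormedAddCommGroup V] [NormedSpace ℂ V]

/-- If g = b - w·shift(b), evaluating at the point w turns w·shift(b) into b(w) - b(0), so g(w) =
b(0). Evaluation at w is thus evaluation at 0 after the resolvent of the shift, and the resolvent is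
analytic in w near 0; this yields joint analyticity in (w, x). -/
theorem ShiftAlgebra.exists_analyticAt_resolvent (S : ShiftAlgebra R D) {g : V → D} {x₀ : V}
    (hg : AnalyticAt ℂ g x₀) : ∃ γ : ℂ × V → R, AnalyticAt ℂ γ (0, x₀) ∧ ∃ r : ℝ, 0 < r ∧
      ∀ (w : ℂ) (x : V), ‖w‖ < r → ∃ b, g x = b - w • S.shift b ∧ γ (w, x) = S.eval b := by
  let T : ℂ → (D →L[ℂ] D) := fun w => 1 - w • S.shift
  have hT : AnalyticAt ℂ T 0 := analyticAt_const.sub (analyticAt_id.smul analyticAt_const)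
  have hT0 : IsUnit (T 0) := by
    change IsUnit (1 - (0 : ℂ) • S.shift)
    have h0 : (0 : ℂ) • S.shift = 0 := ContinuousLinearMap.ext fun a => zero_smul ℂ (S.shift a)
    rw [h0, sub_zero]
    exact isUnit_one
  have hinv : AnalyticAt ℂ (fun w => Ring.inverse (T w)) 0 := analyticAt_ringInverse hT hT0
  refine ⟨fun q => S.eval (Ring.inverse (T q.1) (g q.2)), ?_, ?_⟩
  · refine (S.eval.analyticAt _).comp (AnalyticAt.clm_apply_analyticAt ?_ ?_)
    · exact AnalyticAt.comp (g := fun w => Ring.inverse (T w)) (x := ((0 : ℂ), x₀)) hinv analyticAt_fst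
    · exact AnalyticAt.comp (g := g) (x := ((0 : ℂ), x₀)) hg analyticAt_snd
  · obtain ⟨r, hr, h⟩ := Metric.eventually_nhds_iff_ball.1 (eventually_isUnit hT.continuousAt hT0)
    refine ⟨r, hr, fun w x hw => ⟨Ring.inverse (T w) (g x), ?_, rfl⟩⟩
    have h1 := congrArg (fun L : D →L[ℂ] D => L (g x))
      (Ring.mul_inverse_cancel _ (h w (by simpa using hw)))
    exact h1.symm

/-- A Banach algebra of functions on the closed unit disc, to which analytic functions of `(w, x)`
lift after rescaling of `w`. -/
structure DiscModel (R D V : Type*) [NormedRing R] [NormedAlgebra ℂ R]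
    [NormedRing D] [NormedAlgebra ℂ D] [NormedAddCommGroup V] [NormedSpace ℂ V] extends
    ShiftAlgebra R D where
  evalAt : Disc → D →L[ℂ] R
  evalAt_zero : ∀ a, evalAt 0 a = eval a
  evalAt_mul : ∀ w a b, evalAt w (a * b) = evalAt w a * evalAt w b
  evalAt_const : ∀ w m, evalAt w (const m) = m
  evalAt_one : ∀ w, evalAt w 1 = 1
  evalAt_coord_mul : ∀ w a, evalAt w (coord * a) = (w : ℂ) • evalAt w a
  ext_of_ne_zero : ∀ {a b}, (∀ w, w ≠ 0 → evalAt w a = evalAt w b) → a = b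
  exists_lift : ∀ {f : ℂ × V → R} {x₀ : V}, AnalyticAt ℂ f (0, x₀) →
    ∃ r : ℝ, 0 < r ∧ ∀ ρ : ℝ, 0 < ρ → ρ < r → ∃ F : V → D, AnalyticAt ℂ F x₀ ∧
      ∀ᶠ x in 𝓝 x₀, ∀ w : Disc, evalAt w (F x) = f ((ρ : ℂ) * w, x)

/-- The disc algebra as a model. -/
def discModel (R V : Type*) [NormedRing R] [NormedAlgebra ℂ R] [CompleteSpace R]
    [NormedAddCommGroup V] [NormedSpace ℂ V] : DiscModel R (DiscAlgebra R) V where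
  toShiftAlgebra := discShiftAlgebra R
  evalAt := discEval R
  evalAt_zero _ := rfl
  evalAt_mul := discEval_mul
  evalAt_const := discEval_const
  evalAt_one := discEval_one
  evalAt_coord_mul := discEval_coord_mul
  ext_of_ne_zero := disc_ext_of_ne_zero
  exists_lift := exists_analyticAt_discAlgebra

/-- An analytic map to a model is an analytic function of `(w, x)`. -/
theorem DiscModel.exists_analyticAt_evalAt (M : DiscModel R D V) {g : V → D} {x₀ : V}
    (hg : AnalyticAt ℂ g x₀) {ρ : ℝ}
    (hρ : 0 < ρ) : ∃ γ : ℂ × V → R, AnalyticAt ℂ γ (0, x₀) ∧ ∃ r : ℝ, 0 < r ∧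
      ∀ (ω : Disc) (x : V), ‖(ρ : ℂ) * ω‖ < r → γ ((ρ : ℂ) * ω, x) = M.evalAt ω (g x) := by
  have hρ0 : (ρ : ℂ) ≠ 0 := by exact_mod_cast hρ.ne'
  have hρn : ‖(ρ : ℂ)‖ = ρ := by rw [Complex.norm_real, Real.norm_of_nonneg hρ.le]
  obtain ⟨γ, hγ, r, hr, h⟩ := M.exists_analyticAt_resolvent hg
  refine ⟨fun q => γ ((ρ : ℂ)⁻¹ * q.1, q.2), ?_, ρ * r, by positivity, fun ω x hω => ?_⟩
  · refine AnalyticAt.comp (g := γ) (f := fun q : ℂ × V => ((ρ : ℂ)⁻¹ * q.1, q.2)) ?_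
      ((analyticAt_const.mul analyticAt_fst).prod analyticAt_snd)
    simpa using hγ
  · rw [norm_mul, hρn] at hω
    obtain ⟨b, hb, hγb⟩ := h ω x (lt_of_mul_lt_mul_left hω hρ.le)
    change γ ((ρ : ℂ)⁻¹ * ((ρ : ℂ) * ω), x) = _
    rw [inv_mul_cancel_left₀ hρ0, hγb, hb]
    have h3 := congrArg (M.evalAt ω) (M.coord_mul_shift b)
    rw [M.evalAt_coord_mul, map_sub, M.evalAt_const] at h3
    rw [map_sub, map_smul, h3]
    abel

end Evaluation

/-! ### Restriction to slices and lifts of families of linear maps. -/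

section Slices

variable {V W : Type*} [NormedAddCommGroup V] [NormedSpace ℂ V]
  [NormedAddCommGroup W] [NormedSpace ℂ W]

theorem tendsto_line (x b : V) : Tendsto (fun t : ℂ => x + t • b) (𝓝 0) (𝓝 x) := by
  have : Continuous fun t : ℂ => x + t • b := by fun_prop
  simpa using this.tendsto 0

theorem hasDerivAt_line_snd {F : ℂ × V → W} {w : ℂ} {x : V} (hF : DifferentiableAt ℂ F (w, x))
    (b : V) : HasDerivAt (fun t : ℂ => F (w, x + t • b)) (fderiv ℂ F (w, x) (0, b)) 0 := by
  simpa using hasDerivAt_line hF (0, b)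

theorem hasDerivAt_line_fst {F : ℂ × V → W} {w : ℂ} {x : V} (hF : DifferentiableAt ℂ F (w, x)) :
    HasDerivAt (fun t : ℂ => F (w + t, x)) (fderiv ℂ F (w, x) (1, 0)) 0 := by
  simpa using hasDerivAt_line hF (1, 0)

theorem fderiv_clm_apply_const {U : Type*} [NormedAddCommGroup U] [NormedSpace ℂ U]
    {T : V → U →L[ℂ] W} {x : V} (hT : DifferentiableAt ℂ T x) (t : U) (s : V) :
    fderiv ℂ (fun y => T y t) x s = fderiv ℂ T x s t :=
  (hasDerivAt_line (hT.clm_apply (differentiableAt_const t)) s).unique (hasDerivAt_line_clm hT s t)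

variable {R D : Type*} [NormedRing R] [NormedAlgebra ℂ R] [CompleteSpace R]
  [NormedRing D] [NormedAlgebra ℂ D]

theorem DiscModel.evalAt_fderiv (M : DiscModel R D V) {F : V → D} {f : ℂ × V → R} {w : ℂ} {x : V} {ω : Disc}
    (hF : DifferentiableAt ℂ F x) (hf : DifferentiableAt ℂ f (w, x))
    (h : ∀ᶠ y in 𝓝 x, M.evalAt ω (F y) = f (w, y)) (b : V) :
    M.evalAt ω (fderiv ℂ F x b) = fderiv ℂ f (w, x) (0, b) := by
  have h1 := (M.evalAt ω).hasFDerivAt.comp_hasDerivAt (0 : ℂ) (hasDerivAt_line hF b)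
  exact h1.unique ((hasDerivAt_line_snd hf b).congr_of_eventuallyEq
    ((tendsto_line x b).eventually h))

/-- An analytic family of linear maps lifts to linear maps into a model. -/
theorem DiscModel.exists_lift_clm (M : DiscModel R D V) {U : Type*} [NormedAddCommGroup U] [NormedSpace ℂ U]
    [FiniteDimensional ℂ U] {c : ℂ × V → U →L[ℂ] R} {x₀ : V}
    (hc : AnalyticAt ℂ c (0, x₀)) :
    ∃ r : ℝ, 0 < r ∧ ∀ ρ : ℝ, 0 < ρ → ρ < r → ∃ F : V → U →L[ℂ] D,
      AnalyticAt ℂ F x₀ ∧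
      ∀ᶠ x in 𝓝 x₀, ∀ (w : Disc) (u : U), M.evalAt w (F x u) = c ((ρ : ℂ) * w, x) u := by
  let b := Module.finBasis ℂ U
  let φ : Fin (Module.finrank ℂ U) → U →L[ℂ] ℂ := fun i => (b.coord i).toContinuousLinearMap
  have h1 : ∀ i, AnalyticAt ℂ (fun q => c q (b i)) (0, x₀) := fun i =>
    hc.clm_apply_analyticAt analyticAt_const
  choose r hr hF using fun i => M.exists_lift (h1 i)
  -- A common radius for the finitely many basis vectors; the value 1 serves the zero-dimensional
  -- space.
  obtain ⟨r₀, hr₀, hr₀'⟩ : ∃ r₀ : ℝ, 0 < r₀ ∧ ∀ i, r₀ ≤ r i := by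
    rcases isEmpty_or_nonempty (Fin (Module.finrank ℂ U)) with h | h
    · exact ⟨1, one_pos, fun i => (h.false i).elim⟩
    · exact ⟨Finset.univ.inf' Finset.univ_nonempty r,
        (Finset.lt_inf'_iff _).2 fun i _ => hr i, fun i => Finset.inf'_le _ (Finset.mem_univ i)⟩
  refine ⟨r₀, hr₀, fun ρ hρ hρr => ?_⟩
  choose F hFa hFe using fun i => hF i ρ hρ (hρr.trans_le (hr₀' i))
  refine ⟨fun x => ∑ i, (φ i).smulRight (F i x), ?_, ?_⟩
  · refine Finset.analyticAt_fun_sum _ fun i _ => ?_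
    exact ((ContinuousLinearMap.smulRightL ℂ U (D) (φ i)).analyticAt _).comp (hFa i)
  · filter_upwards [eventually_all.2 hFe] with x hx w u
    simp only [sum_apply, ContinuousLinearMap.smulRight_apply, map_sum, map_smul, hx]
    conv_rhs => rw [← b.sum_repr u, map_sum]
    simp only [map_smul]
    rfl

end Slices

/-! ### Frames that straighten the parameter part. -/

section Birkhoff

variable {n : ℕ} {V : Type*} [NormedAddCommGroup V] [NormedSpace ℂ V]

theorem dzdx_apply (M : Mat n) (N : V →ₗ[ℂ] Mat n) (v : ℂ × V) :
    dzdx M N v = v.1 • M + N v.2 := rfl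

theorem birkhoffForm_apply (A : V → Mat n) (B : Mat n) (C : V → (V →ₗ[ℂ] Mat n)) (p v : ℂ × V) :
    birkhoffForm A B C p v = v.1 • -(A p.2 + p.1⁻¹ • B) + -(p.1 • C p.2 v.2) := rfl

/-- Flatness in the directions of `V` of a connection with a pole of order two. -/
theorem flat_deformation_part {Ω : ConnForm n V} {c : ℂ × V → V →L[ℂ] Mat n} {w : ℂ} {x : V}
    (hw : w ≠ 0) (hc : DifferentiableAt ℂ c (w, x))
    (hΩ : ∀ v, DifferentiableAt ℂ (fun q => Ω q v) (w⁻¹, x))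
    (hform : ∀ᶠ q in 𝓝 ((w⁻¹, x) : ℂ × V), ∀ t : V, Ω q (0, t) = q.1 • c (q.1⁻¹, q.2) t)
    (hflat : ∀ u v, fderiv ℂ (fun q => Ω q v) (w⁻¹, x) u - fderiv ℂ (fun q => Ω q u) (w⁻¹, x) v +
      (Ω (w⁻¹, x) u * Ω (w⁻¹, x) v - Ω (w⁻¹, x) v * Ω (w⁻¹, x) u) = 0) (s t : V) :
    w • (fderiv ℂ c (w, x) (0, s) t - fderiv ℂ c (w, x) (0, t) s) +
      (c (w, x) s * c (w, x) t - c (w, x) t * c (w, x) s) = 0 := by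
  have hd : ∀ s t, fderiv ℂ (fun q => Ω q (0, t)) (w⁻¹, x) (0, s) =
      w⁻¹ • fderiv ℂ c (w, x) (0, s) t := fun s t => by
    refine (hasDerivAt_line_snd (hΩ _) s).unique ?_
    have h1 : HasDerivAt (fun τ : ℂ => w⁻¹ • c (w, x + τ • s) t)
        (w⁻¹ • fderiv ℂ c (w, x) (0, s) t) 0 := by
      have := (ContinuousLinearMap.apply ℂ (Mat n) t).hasFDerivAt.comp_hasDerivAt (0 : ℂ)
        (hasDerivAt_line_snd hc s)
      exact this.const_smul w⁻¹
    refine h1.congr_of_eventuallyEq ?_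
    have ht : Tendsto (fun τ : ℂ => ((w⁻¹, x + τ • s) : ℂ × V)) (𝓝 0) (𝓝 (w⁻¹, x)) :=
      tendsto_const_nhds.prodMk_nhds (tendsto_line x s)
    filter_upwards [ht.eventually hform] with τ hτ
    rw [hτ, inv_inv]
  have h := hflat (0, s) (0, t)
  rw [hd, hd, hform.self_of_nhds, hform.self_of_nhds, inv_inv] at h
  -- In the directions of `V` the form is w⁻¹c: the differential carries w⁻¹ and the bracket w⁻², so
  -- w² clears both.
  have h2 := congrArg (fun m => (w * w) • m) h
  simp only [smul_add, smul_sub, smul_mul_smul_comm, smul_smul, smul_zero] at h2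
  have e1 : w * w * w⁻¹ = w := by field_simp
  have e2 : w * w * (w⁻¹ * w⁻¹) = 1 := by field_simp
  rw [e1, e2, one_smul, one_smul] at h2
  rw [smul_sub]
  exact h2

/-- Solution of the `x`-part: a frame near infinity in which the `x`-part of the connection is
`-z C(x)`. -/
theorem exists_deformation_frame [FiniteDimensional ℂ V] {D : Type*} [NormedRing D]
    [NormedAlgebra ℂ D] [CompleteSpace D] (M : DiscModel (Mat n) D V)
    {c : ℂ × V → V →L[ℂ] Mat n} {x₀ : V}
    (hc : AnalyticAt ℂ c (0, x₀)) {r : ℝ} (hr : 0 < r)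
    (hflat : ∀ (w : ℂ) (x : V), w ≠ 0 → ‖w‖ < r → x ∈ Metric.ball x₀ r → ∀ s t,
      DifferentiableAt ℂ c (w, x) ∧
      w • (fderiv ℂ c (w, x) (0, s) t - fderiv ℂ c (w, x) (0, t) s) +
      (c (w, x) s * c (w, x) t - c (w, x) t * c (w, x) s) = 0) :
    ∃ (γ : ℂ × V → Mat n) (C : V → V →L[ℂ] Mat n), AnalyticAt ℂ γ (0, x₀) ∧ AnalyticAt ℂ C x₀ ∧
      ∃ r' : ℝ, 0 < r' ∧ (∀ w : ℂ, ‖w‖ < r' → γ (w, x₀) = 1) ∧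
        ∀ (w : ℂ) (x : V), ‖w‖ < r' → x ∈ Metric.ball x₀ r' → ∀ b,
          w • fderiv ℂ γ (w, x) (0, b) + c (w, x) b * γ (w, x) + γ (w, x) * C x b = 0 := by
  have : CompleteSpace V := FiniteDimensional.complete ℂ V
  obtain ⟨r₁, hr₁, hlift⟩ := M.exists_lift_clm hc
  obtain ⟨ρ, hρ, hρ'⟩ := exists_between (lt_min hr hr₁)
  obtain ⟨F, hF, hFe⟩ := hlift ρ hρ (hρ'.trans_le (min_le_right _ _))
  have hρ0 : (ρ : ℂ) ≠ 0 := by exact_mod_cast hρ.ne'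
  have hρn : ‖(ρ : ℂ)‖ = ρ := by rw [Complex.norm_real, Real.norm_of_nonneg hρ.le]
  have hωn : ∀ ω : Disc, ‖(ρ : ℂ) * ω‖ < r := fun ω => by
    rw [norm_mul, hρn]
    exact (mul_le_of_le_one_right hρ.le (mem_closedBall_zero_iff.1 ω.2)).trans_lt
      (hρ'.trans_le (min_le_left _ _))
  have hball : ∀ᶠ x in 𝓝 x₀, x ∈ Metric.ball x₀ r := Metric.ball_mem_nhds _ hr
  -- With w = ρω, dividing c by ρ turns w dc + [c, c] = 0 into the same equation in ω. The factor ρ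
  -- is restored in the final deformation part.
  let c' : V → V →L[ℂ] D := fun x => (ρ : ℂ)⁻¹ • F x
  have hc' : AnalyticAt ℂ c' x₀ := (analyticAt_const (v := (ρ : ℂ)⁻¹)).smul hF
  have hflat' : ∀ᶠ x in 𝓝 x₀, ∀ a b, M.coord * (fderiv ℂ c' x a b - fderiv ℂ c' x b a) +
      (c' x a * c' x b - c' x b * c' x a) = 0 := by
    filter_upwards [hFe.eventually_nhds, hball, hF.eventually_analyticAt] with x h1 h2 h3 a b
    have hdc' : ∀ a, fderiv ℂ c' x a = (ρ : ℂ)⁻¹ • fderiv ℂ F x a := fun a => by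
      rw [show c' = (ρ : ℂ)⁻¹ • F from rfl, fderiv_const_smul h3.differentiableAt]; rfl
    refine M.ext_of_ne_zero fun ω hω => ?_
    have hw : (ρ : ℂ) * ω ≠ 0 := mul_ne_zero hρ0 fun h => hω (Subtype.ext h)
    have hfl := hflat _ x hw (hωn ω) h2
    have hdF : ∀ a b, M.evalAt ω (fderiv ℂ F x a b) =
        fderiv ℂ c ((ρ : ℂ) * ω, x) (0, a) b := fun a b => by
      rw [← fderiv_clm_apply_const h3.differentiableAt,
        ← fderiv_clm_apply_const (hfl a b).1]
      exact M.evalAt_fderiv (h3.differentiableAt.clm_apply (differentiableAt_const b))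
        ((hfl a b).1.clm_apply (differentiableAt_const b)) (h1.mono fun y hy => hy ω b) a
    have h4 := (hfl a b).2
    have hev := h1.self_of_nhds ω
    change M.evalAt ω (M.coord * (fderiv ℂ c' x a b - fderiv ℂ c' x b a) +
      ((ρ : ℂ)⁻¹ • F x a * (ρ : ℂ)⁻¹ • F x b - (ρ : ℂ)⁻¹ • F x b * (ρ : ℂ)⁻¹ • F x a)) = _
    rw [map_add, M.evalAt_coord_mul, map_sub, map_sub, M.evalAt_mul, M.evalAt_mul, hdc', hdc',
      smul_apply, smul_apply, map_smul, map_smul, map_smul, map_smul, hdF, hdF, hev, hev, map_zero]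
    have h5 := congrArg (fun m => ((ρ : ℂ)⁻¹ * (ρ : ℂ)⁻¹) • m) h4
    simp only [smul_add, smul_sub, smul_smul, smul_zero] at h5
    rw [smul_mul_smul_comm, smul_mul_smul_comm, smul_sub, smul_smul, smul_smul]
    have e : (ρ : ℂ)⁻¹ * (ρ : ℂ)⁻¹ * ((ρ : ℂ) * ω) = ω * (ρ : ℂ)⁻¹ := by field_simp
    rw [e] at h5
    exact h5
  obtain ⟨g, C, hg, hC, hg0, heq⟩ := exists_transport M.toShiftAlgebra hc' hflat'
  obtain ⟨γ, hγ, r₂, hr₂, hγe⟩ := M.exists_analyticAt_evalAt hg hρ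
  obtain ⟨r₃, hr₃, hall⟩ := Metric.eventually_nhds_iff_ball.1
    (heq.and (hFe.and hg.eventually_analyticAt))
  obtain ⟨r₄, hr₄, hγd⟩ := Metric.eventually_nhds_iff_ball.1 hγ.eventually_analyticAt
  have hdisc : ∀ w : ℂ, ‖w‖ < min r₂ ρ → ∃ ω : Disc, (ρ : ℂ) * ω = w := fun w hw => by
    refine ⟨⟨(ρ : ℂ)⁻¹ * w, ?_⟩, mul_inv_cancel_left₀ hρ0 w⟩
    rw [mem_closedBall_zero_iff, norm_mul, norm_inv, hρn, inv_mul_le_iff₀ hρ, mul_one]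
    exact (hw.trans_le (min_le_right _ _)).le
  refine ⟨γ, fun x => (ρ : ℂ) • C x, hγ, (analyticAt_const (v := (ρ : ℂ))).smul hC,
    min (min r₂ ρ) (min r₃ r₄), by positivity, fun w hw => ?_, fun w x hw hx b => ?_⟩
  · replace hw := hw.trans_le (min_le_left _ _)
    obtain ⟨ω, rfl⟩ := hdisc w hw
    rw [hγe ω x₀ (hw.trans_le (min_le_left _ _)), hg0, M.evalAt_one]
  · have hw4 : ‖w‖ < r₄ := hw.trans_le ((min_le_right _ _).trans (min_le_right _ _))
    replace hw := hw.trans_le (min_le_left _ _)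
    obtain ⟨ω, rfl⟩ := hdisc w hw
    replace hw := hw.trans_le (min_le_left _ _)
    have hx3 := Metric.ball_subset_ball ((min_le_right _ _).trans (min_le_left _ _)) hx
    have hx4 := Metric.ball_subset_ball ((min_le_right _ _).trans (min_le_right _ _)) hx
    obtain ⟨h1, h2, h3⟩ := hall x hx3
    have h4 : AnalyticAt ℂ γ ((ρ : ℂ) * ω, x) := hγd _ (by
      rw [← ball_prod_same]; exact ⟨by simpa using hw4, hx4⟩)
    have h5 : M.evalAt ω (fderiv ℂ g x b) = fderiv ℂ γ ((ρ : ℂ) * ω, x) (0, b) :=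
      M.evalAt_fderiv h3.differentiableAt h4.differentiableAt
        (Eventually.of_forall fun y => (hγe ω y hw).symm) b
    have h6 : M.evalAt ω (M.coord * fderiv ℂ g x b + (ρ : ℂ)⁻¹ • F x b * g x +
      g x * M.const (C x b)) = 0 := (congrArg (M.evalAt ω) (h1 b)).trans (map_zero _)
    rw [map_add, map_add, M.evalAt_coord_mul, M.evalAt_mul, M.evalAt_mul, M.evalAt_const, map_smul,
      h5, h2, ← hγe ω x hw] at h6
    have h7 := congrArg (fun m => (ρ : ℂ) • m) h6
    simp only [smul_add, smul_zero, smul_smul, smul_mul_assoc, mul_inv_cancel₀ hρ0, one_smul] at h7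
    rw [smul_apply, mul_smul_comm]
    exact h7

end Birkhoff

/-! ### Existence of the pole part and the deformation part. -/

section PolePart

variable {n : ℕ} {V : Type*} [NormedAddCommGroup V] [NormedSpace ℂ V]

/-- Flatness in a mixed direction of a connection whose deformation part is `-z C(x)`. -/
theorem flat_pole_part [FiniteDimensional ℂ V] {Ω : ConnForm n V} {α : ℂ × V → Mat n}
    {C : V → V →L[ℂ] Mat n} {w : ℂ} {x : V}
    (hw : w ≠ 0) (hα : DifferentiableAt ℂ α (w, x)) (hC : DifferentiableAt ℂ C x)
    (hform : ∀ᶠ q in 𝓝 ((w⁻¹, x) : ℂ × V), ∀ v : ℂ × V,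
      Ω q v = v.1 • α (q.1⁻¹, q.2) - q.1 • C q.2 v.2)
    (hflat : ∀ u v, fderiv ℂ (fun q => Ω q v) (w⁻¹, x) u - fderiv ℂ (fun q => Ω q u) (w⁻¹, x) v +
      (Ω (w⁻¹, x) u * Ω (w⁻¹, x) v - Ω (w⁻¹, x) v * Ω (w⁻¹, x) u) = 0) (b : V) :
    w • (fderiv ℂ α (w, x) (0, b) + C x b) + (α (w, x) * C x b - C x b * α (w, x)) = 0 := by
  have hd : ∀ v, DifferentiableAt ℂ (fun q => Ω q v) (w⁻¹, x) := fun v => by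
    have h1 : DifferentiableAt ℂ (fun q : ℂ × V => (q.1⁻¹, q.2)) (w⁻¹, x) :=
      (analyticAt_inv_fst_snd (p := (w⁻¹, x)) (inv_ne_zero hw)).differentiableAt
    have h2 : DifferentiableAt ℂ (fun q : ℂ × V => α (q.1⁻¹, q.2)) (w⁻¹, x) :=
      DifferentiableAt.comp (g := α) (f := fun q : ℂ × V => (q.1⁻¹, q.2)) _
        (by simpa using hα) h1
    have h3 : DifferentiableAt ℂ (fun q : ℂ × V => C q.2 v.2) (w⁻¹, x) :=
      (DifferentiableAt.comp (g := C) (f := fun q : ℂ × V => q.2) _ hC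
        differentiableAt_snd).clm_apply (differentiableAt_const _)
    exact ((h2.const_smul v.1).sub (differentiableAt_fst.smul h3)).congr_of_eventuallyEq
      (hform.mono fun q hq => hq v)
  have h1 : fderiv ℂ (fun q => Ω q (0, b)) (w⁻¹, x) (1, 0) = -C x b := by
    refine (hasDerivAt_line_fst (hd _)).unique ?_
    have ht : Tendsto (fun τ : ℂ => ((w⁻¹ + τ, x) : ℂ × V)) (𝓝 0) (𝓝 (w⁻¹, x)) := by
      have : Continuous fun τ : ℂ => ((w⁻¹ + τ, x) : ℂ × V) := by fun_prop
      simpa using this.tendsto 0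
    have h2 : HasDerivAt (fun τ : ℂ => -((w⁻¹ + τ) • C x b)) (-C x b) 0 := by
      have := (((hasDerivAt_id (0 : ℂ)).const_add w⁻¹).smul_const (C x b)).fun_neg
      simpa using this
    refine h2.congr_of_eventuallyEq ?_
    filter_upwards [ht.eventually hform] with τ hτ
    rw [hτ]
    simp
  have h2 : fderiv ℂ (fun q => Ω q (1, 0)) (w⁻¹, x) (0, b) = fderiv ℂ α (w, x) (0, b) := by
    refine (hasDerivAt_line_snd (hd _) b).unique ?_
    refine (hasDerivAt_line_snd hα b).congr_of_eventuallyEq ?_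
    have ht : Tendsto (fun τ : ℂ => ((w⁻¹, x + τ • b) : ℂ × V)) (𝓝 0) (𝓝 (w⁻¹, x)) :=
      tendsto_const_nhds.prodMk_nhds (tendsto_line x b)
    filter_upwards [ht.eventually hform] with τ hτ
    rw [hτ]
    simp
  have h := hflat (1, 0) (0, b)
  rw [h1, h2, hform.self_of_nhds, hform.self_of_nhds] at h
  simp only [one_smul, map_zero, smul_zero, sub_zero, zero_smul, zero_sub, inv_inv, mul_neg, neg_mul,
    mul_smul_comm, smul_mul_assoc] at h
  have h3 := congrArg (fun m => (-w) • m) h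
  simp only [smul_add, smul_sub, smul_neg, smul_smul, neg_mul, mul_inv_cancel₀ hw, smul_zero,
    neg_smul, one_smul, neg_neg] at h3
  rw [← h3]
  simp only [smul_add]
  abel

/-- The matrix of a connection with a pole of order two in a frame that straightens the `x`-part. -/
theorem gauge_deformation_frame {Ω : ConnForm n V} {a γ α : ℂ × V → Mat n}
    {c : ℂ × V → V →L[ℂ] Mat n} {C : V → V →L[ℂ] Mat n} {w : ℂ} {x : V} (hw : w ≠ 0)
    (hγ : DifferentiableAt ℂ γ (w, x)) (hu : IsUnit (γ (w, x)))
    (hα : γ (w, x) * α (w, x) = a (w, x) * γ (w, x) - (w * w) • fderiv ℂ γ (w, x) (1, 0))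
    (hC : ∀ b, w • fderiv ℂ γ (w, x) (0, b) + c (w, x) b * γ (w, x) + γ (w, x) * C x b = 0)
    (hΩ : ∀ v, Ω (w⁻¹, x) v = v.1 • a (w, x) + w⁻¹ • c (w, x) v.2) (v : ℂ × V) :
    gauge (fun q => γ (q.1⁻¹, q.2)) Ω (w⁻¹, x) v = v.1 • α (w, x) - w⁻¹ • C x v.2 := by
  -- Chain rule for w = 1/z, where dw = -w² dz.
  have hd : fderiv ℂ (fun q : ℂ × V => γ (q.1⁻¹, q.2)) (w⁻¹, x) v =
      -(v.1 * (w * w)) • fderiv ℂ γ (w, x) (1, 0) + fderiv ℂ γ (w, x) (0, v.2) := by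
    have h1 : HasFDerivAt (fun q : ℂ × V => (q.1⁻¹, q.2)) _ (w⁻¹, x) :=
      ((hasDerivAt_inv (inv_ne_zero hw)).comp_hasFDerivAt (w⁻¹, x)
        (hasFDerivAt_fst (𝕜 := ℂ) (E := ℂ) (F := V))).prodMk hasFDerivAt_snd
    have h2 : HasFDerivAt γ (fderiv ℂ γ (w, x)) ((fun q : ℂ × V => (q.1⁻¹, q.2)) (w⁻¹, x)) := by
      simpa using hγ.hasFDerivAt
    have h3 := h2.comp (w⁻¹, x) h1
    have h4 : fderiv ℂ (fun q : ℂ × V => γ (q.1⁻¹, q.2)) (w⁻¹, x) = _ := h3.fderiv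
    rw [h4]
    have h5 : ((-(v.1 * (w * w)), v.2) : ℂ × V) = (-(v.1 * (w * w))) • (1, 0) + (0, v.2) := by
      simp
    rw [← map_smul, ← map_add, ← h5]
    simp [pow_two, mul_comm]
  rw [gauge_eq_iff (by simpa using hu), hΩ, hd]
  simp only [inv_inv]
  have h1 := congrArg (fun m => w⁻¹ • m) (hC v.2)
  simp only [smul_add, smul_smul, inv_mul_cancel₀ hw, one_smul, smul_zero] at h1
  rw [mul_sub, mul_smul_comm, mul_smul_comm, hα, add_mul, smul_mul_assoc, smul_mul_assoc, smul_sub,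
    smul_smul, neg_smul, ← sub_eq_zero, ← h1]
  abel

/-- Along the flow of a flat connection with `x`-part `-z C(x)`, the `dz`-part of degree `≥ 1` in
`1/z` is constant. -/
theorem pole_part_of_flow {D : Type*} [NormedRing D]
    [NormedAlgebra ℂ D] [CompleteSpace D] (M : DiscModel (Mat n) D V) {α : ℂ × V → Mat n}
    {C : V → V →L[ℂ] Mat n} {x₀ : V} {A₀ B₀ : Mat n} (hα : AnalyticAt ℂ α (0, x₀))
    (hC : AnalyticAt ℂ C x₀) {r : ℝ} (hr : 0 < r)
    (hflow : ∀ (w : ℂ) (x : V), w ≠ 0 → ‖w‖ < r → x ∈ Metric.ball x₀ r → ∀ b,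
      w • (fderiv ℂ α (w, x) (0, b) + C x b) + (α (w, x) * C x b - C x b * α (w, x)) = 0)
    (h0 : ∀ w : ℂ, w ≠ 0 → ‖w‖ < r → α (w, x₀) = -(A₀ + w • B₀)) :
    α (0, x₀) = -A₀ ∧ ∃ r' : ℝ, 0 < r' ∧ ∀ (w : ℂ) (x : V), ‖w‖ < r' → x ∈ Metric.ball x₀ r' →
      α (w, x) = α (0, x) - w • B₀ := by
  obtain ⟨r₁, hr₁, hlift⟩ := M.exists_lift hα
  obtain ⟨r₂, hr₂, hαd⟩ := Metric.eventually_nhds_iff_ball.1 hα.eventually_analyticAt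
  obtain ⟨ρ, hρ, hρ'⟩ := exists_between (lt_min (lt_min hr hr₂) hr₁)
  obtain ⟨F, hF, hFe⟩ := hlift ρ hρ (hρ'.trans_le (min_le_right _ _))
  have hρ0 : (ρ : ℂ) ≠ 0 := by exact_mod_cast hρ.ne'
  have hρn : ‖(ρ : ℂ)‖ = ρ := by rw [Complex.norm_real, Real.norm_of_nonneg hρ.le]
  have hωn : ∀ ω : Disc, ‖(ρ : ℂ) * ω‖ < min r r₂ := fun ω => by
    rw [norm_mul, hρn]
    exact (mul_le_of_le_one_right hρ.le (mem_closedBall_zero_iff.1 ω.2)).trans_lt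
      (hρ'.trans_le (min_le_left _ _))
  have hball : ∀ᶠ x in 𝓝 x₀, x ∈ Metric.ball x₀ (min r r₂) :=
    Metric.ball_mem_nhds _ (lt_min hr hr₂)
  let C' : V → V →L[ℂ] Mat n := fun x => (ρ : ℂ)⁻¹ • C x
  have hC' : AnalyticAt ℂ C' x₀ := (analyticAt_const (v := (ρ : ℂ)⁻¹)).smul hC
  have hflow' : ∀ᶠ x in 𝓝 x₀, ∀ b, M.coord * (fderiv ℂ F x b + M.const (C x b)) +
      (F x * M.const (C' x b) - M.const (C' x b) * F x) = 0 := by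
    filter_upwards [hFe.eventually_nhds, hball, hF.eventually_analyticAt] with x h1 h2 h3 b
    refine M.ext_of_ne_zero fun ω hω => ?_
    have hw : (ρ : ℂ) * ω ≠ 0 := mul_ne_zero hρ0 fun h => hω (Subtype.ext h)
    have hwr := hωn ω
    have h4 := hflow _ x hw (hwr.trans_le (min_le_left _ _))
      (Metric.ball_subset_ball (min_le_left _ _) h2) b
    have h5 : AnalyticAt ℂ α ((ρ : ℂ) * ω, x) := hαd _ (by
      rw [← ball_prod_same]
      exact ⟨by simpa using hwr.trans_le (min_le_right _ _),
        Metric.ball_subset_ball (min_le_right _ _) h2⟩)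
    have h6 : M.evalAt ω (fderiv ℂ F x b) = fderiv ℂ α ((ρ : ℂ) * ω, x) (0, b) :=
      M.evalAt_fderiv h3.differentiableAt h5.differentiableAt (h1.mono fun y hy => hy ω) b
    have hC'x : C' x b = (ρ : ℂ)⁻¹ • C x b := rfl
    rw [map_add, M.evalAt_coord_mul, map_sub, map_add, M.evalAt_mul, M.evalAt_mul, M.evalAt_const,
      M.evalAt_const, h6, h1.self_of_nhds ω, map_zero, hC'x]
    have h7 := congrArg (fun m => (ρ : ℂ)⁻¹ • m) h4
    simp only [smul_add (ρ : ℂ)⁻¹, smul_smul, smul_zero, smul_sub (ρ : ℂ)⁻¹, inv_mul_cancel_left₀ hρ0] at h7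
    rw [mul_smul_comm, smul_mul_assoc]
    exact h7
  have h0' : F x₀ = M.const (-A₀) + M.coord * M.const (-((ρ : ℂ) • B₀)) := by
    refine M.ext_of_ne_zero fun ω hω => ?_
    have hw : (ρ : ℂ) * ω ≠ 0 := mul_ne_zero hρ0 fun h => hω (Subtype.ext h)
    rw [hFe.self_of_nhds ω, h0 _ hw ((hωn ω).trans_le (min_le_left _ _)), map_add,
      M.evalAt_coord_mul, M.evalAt_const, M.evalAt_const, neg_add, smul_neg, smul_smul,
      mul_comm (ω : ℂ)]
  have htail := tail_eq_of_flow M.toShiftAlgebra hF hC' hflow' h0'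
  have hev : ∀ᶠ x in 𝓝 x₀, M.eval (F x) = α (0, x) := hFe.mono fun x hx => by
    have := hx 0
    rw [M.evalAt_zero] at this
    rw [this]
    simp
  refine ⟨?_, ?_⟩
  · rw [← hev.self_of_nhds, h0', map_add, M.eval_const, M.eval_coord_mul, add_zero]
  · obtain ⟨r₃, hr₃, hall⟩ := Metric.eventually_nhds_iff_ball.1 (htail.and (hFe.and hev))
    refine ⟨min ρ r₃, lt_min hρ hr₃, fun w x hw hx => ?_⟩
    obtain ⟨h1, h2, h3⟩ := hall x (Metric.ball_subset_ball (min_le_right _ _) hx)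
    let ω : Disc := ⟨(ρ : ℂ)⁻¹ * w, by
      rw [mem_closedBall_zero_iff, norm_mul, norm_inv, hρn, inv_mul_le_iff₀ hρ, mul_one]
      exact (hw.trans_le (min_le_left _ _)).le⟩
    have hω : (ρ : ℂ) * ω = w := mul_inv_cancel_left₀ hρ0 w
    have h4 := congrArg (M.evalAt ω) h1
    rw [map_add, M.evalAt_coord_mul, M.evalAt_const, M.evalAt_const, h2, h3, hω, smul_neg, smul_smul,
      mul_comm (ω : ℂ), hω, ← sub_eq_add_neg] at h4
    exact h4

/-- Every germ of integrable deformation has a pole part and a deformation part. -/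
theorem exists_isPoleAndDeformationPart [FiniteDimensional ℂ V] {A₀ B₀ : Mat n} {x₀ : V}
    {Ω : ConnForm n V} (hΩ : Ω ∈ classI A₀ B₀ x₀) :
    ∃ A C, IsPoleAndDeformationPart A₀ B₀ x₀ Ω A C := by
  obtain ⟨hpole, hflat, hbase⟩ := hΩ
  obtain ⟨a, c, ha, hc, hform⟩ := hpole.exists_clm
  obtain ⟨r₁, hr₁, hev⟩ := eventually_nearInfinity_iff.1
    ((eventually_nearInfinity_nhds hform).and (hflat.and (hpole.analyticAt.and
      (eventually_nearInfinity_of_nhds hc.eventually_analyticAt))))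
  simp only [inv_inv] at hev
  obtain ⟨γ, C, hγ, hC, r₂, hr₂, hγ1, hγC⟩ := exists_deformation_frame (discModel (Mat n) V) hc hr₁
    fun w x hw hwr hx s t => by
      obtain ⟨h1, h2, h3, h4⟩ := hev w x hw hwr hx
      exact ⟨h4.differentiableAt, flat_deformation_part hw h4.differentiableAt
        (fun v => (h3 v).differentiableAt) (h1.mono fun q hq t => by simp [hq]) h2 s t⟩
  have hu : IsUnit (γ (0, x₀)) := by
    rw [hγ1 0 (by simpa using hr₂)]
    exact isUnit_one
  -- The dz-coefficient in the frame `γ`: as d/dz = -w² d/dw, it is holomorphic up to w = 0.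
  let α : ℂ × V → Mat n := fun q =>
    (γ q)⁻¹ * (a q * γ q - (q.1 * q.1) • fderiv ℂ γ q (1, 0))
  have hα : AnalyticAt ℂ α (0, x₀) :=
    (analyticAt_matrix_inv hγ hu).mul ((ha.mul hγ).sub ((analyticAt_fst.mul analyticAt_fst).smul
      (hγ.fderiv.clm_apply_analyticAt analyticAt_const)))
  obtain ⟨r₃, hr₃, hev'⟩ := Metric.eventually_nhds_iff_ball.1
    (hα.eventually_analyticAt.and (hγ.eventually_analyticAt.and
      (eventually_isUnit hγ.continuousAt hu)))
  obtain ⟨r₄, hr₄, hC'⟩ := Metric.eventually_nhds_iff_ball.1 hC.eventually_analyticAt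
  let G : ℂ × V → Mat n := fun q => γ (q.1⁻¹, q.2)
  have hG : IsFrameAtInfinity x₀ G := ⟨γ, hγ, hu, Eventually.of_forall fun _ => rfl⟩
  let Ω' : ConnForm n V := fun q => dzdx (α (q.1⁻¹, q.2)) (-(q.1 • (C q.2).toLinearMap))
  have hΩ'a : ∀ q v, Ω' q v = v.1 • α (q.1⁻¹, q.2) - q.1 • C q.2 v.2 := fun q v => by
    rw [sub_eq_add_neg]; rfl
  let r := min (min r₁ r₂) (min r₃ r₄)
  have hr : 0 < r := by positivity
  have hgauge : ∀ (w : ℂ) (x : V), w ≠ 0 → ‖w‖ < r → x ∈ Metric.ball x₀ r → ∀ v,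
      gauge G Ω (w⁻¹, x) v = Ω' (w⁻¹, x) v := fun w x hw hwr hx v => by
    have hwr1 := hwr.trans_le ((min_le_left _ _).trans (min_le_left _ _))
    have hwr2 := hwr.trans_le ((min_le_left _ _).trans (min_le_right _ _))
    have hwr3 := hwr.trans_le ((min_le_right _ _).trans (min_le_left _ _))
    have hx1 := Metric.ball_subset_ball ((min_le_left _ _).trans (min_le_left _ _)) hx
    have hx2 := Metric.ball_subset_ball ((min_le_left _ _).trans (min_le_right _ _)) hx
    have hx3 := Metric.ball_subset_ball ((min_le_right _ _).trans (min_le_left _ _)) hx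
    obtain ⟨h1, -, -, -⟩ := hev w x hw hwr1 hx1
    obtain ⟨-, h5, h6⟩ := hev' (w, x) (by
      rw [← ball_prod_same]; exact ⟨by simpa using hwr3, hx3⟩)
    rw [hΩ'a]
    simp only [inv_inv]
    exact gauge_deformation_frame hw h5.differentiableAt h6
      (by simp only [α]; rw [← mul_assoc, mat_mul_inv h6, one_mul]) (hγC w x hwr2 hx2)
      (fun v => by simpa using h1.self_of_nhds v) v
  have hgauge' : ∀ᶠ p in nearInfinity x₀, ∀ v, gauge G Ω p v = Ω' p v :=
    eventually_nearInfinity_iff.2 ⟨r, hr, hgauge⟩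
  obtain ⟨r₅, hr₅, hflat'⟩ := eventually_nearInfinity_iff.1
    ((eventually_nearInfinity_nhds hgauge').and (hflat.and (hpole.analyticAt.and hG.eventually)))
  obtain ⟨s, hs, hbase'⟩ := eventually_cobounded_iff.1 hbase
  -- Flatness holds in the new frame as well, and its mixed component is the flow equation for `α`.
  have hflow : ∀ (w : ℂ) (x : V), w ≠ 0 → ‖w‖ < min (min r r₅) s →
      x ∈ Metric.ball x₀ (min (min r r₅) s) → ∀ b,
      w • (fderiv ℂ α (w, x) (0, b) + C x b) + (α (w, x) * C x b - C x b * α (w, x)) = 0 :=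
    fun w x hw hwr hx => by
      replace hwr := hwr.trans_le (min_le_left _ _)
      replace hx := Metric.ball_subset_ball (min_le_left _ _) hx
      have hwr3 := (hwr.trans_le (min_le_left _ _)).trans_le ((min_le_right _ _).trans (min_le_left _ _))
      have hxr := Metric.ball_subset_ball (min_le_left _ _) hx
      have hx3 := Metric.ball_subset_ball ((min_le_right _ _).trans (min_le_left _ _)) hxr
      have hx4 := Metric.ball_subset_ball ((min_le_right _ _).trans (min_le_right _ _)) hxr
      obtain ⟨h1, h2, h3, h4⟩ := hflat' w x hw (hwr.trans_le (min_le_right _ _))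
        (Metric.ball_subset_ball (min_le_right _ _) hx)
      have h5 := (hev' (w, x) (by rw [← ball_prod_same]; exact ⟨by simpa using hwr3, hx3⟩)).1
      exact flat_pole_part (Ω := Ω') hw h5.differentiableAt (hC' x hx4).differentiableAt
        (Eventually.of_forall hΩ'a)
        (flat_gauge h4.1 h4.2 (fun v => (h3 v).differentiableAt) h1 h2)
  have h0 : ∀ w : ℂ, w ≠ 0 → ‖w‖ < min (min r r₅) s → α (w, x₀) = -(A₀ + w • B₀) :=
    fun w hw hwr => by
      have hwrr := hwr.trans_le ((min_le_left _ _).trans (min_le_left _ _))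
      have hwr1 := hwrr.trans_le ((min_le_left _ _).trans (min_le_left _ _))
      have hwr2 := hwrr.trans_le ((min_le_left _ _).trans (min_le_right _ _))
      have hwr3 := hwrr.trans_le ((min_le_right _ _).trans (min_le_left _ _))
      obtain ⟨h1, -, -, -⟩ := hev w x₀ hw hwr1 (Metric.mem_ball_self hr₁)
      have h2 := hbase' w hw (hwr.trans_le (min_le_right _ _)) 1
      rw [h1.self_of_nhds] at h2
      simp only [inv_inv, map_zero, smul_zero, add_zero, one_smul] at h2
      obtain ⟨-, h5, -⟩ := hev' (w, x₀) (by
        rw [← ball_prod_same]; exact ⟨by simpa using hwr3, Metric.mem_ball_self hr₃⟩)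
      -- Over x₀ the frame is 1 for every small w, so its w-derivative vanishes and the base
      -- connection keeps its matrix.
      have h6 : fderiv ℂ γ (w, x₀) (1, 0) = 0 := by
        refine (hasDerivAt_line_fst h5.differentiableAt).unique ?_
        refine (hasDerivAt_const (0 : ℂ) (1 : Mat n)).congr_of_eventuallyEq ?_
        have hcont : Continuous fun t : ℂ => ‖w + t‖ := by fun_prop
        filter_upwards [(hcont.tendsto 0).eventually_lt_const (u := r₂) (by simpa using hwr2)] with t ht
        exact hγ1 _ ht
      simp only [α]
      rw [h6, hγ1 w hwr2, h2]
      simp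
  -- The part of positive degree in w stays equal to its value -wB₀ at x₀; only the value at w = 0,
  -- which is minus the pole part, depends on x.
  obtain ⟨hA0, r₆, hr₆, htail⟩ := pole_part_of_flow (discModel (Mat n) V) hα hC
    (r := min (min r r₅) s) (by positivity) hflow h0
  refine ⟨fun x => -α (0, x), fun x => (C x).toLinearMap, ⟨?_, fun v => ?_, ?_, G, hG, ?_, ?_⟩⟩
  · exact (AnalyticAt.comp (g := α) (f := fun x => ((0 : ℂ), x)) hα
      (analyticAt_const.prod analyticAt_id)).neg
  · exact hC.clm_apply_analyticAt analyticAt_const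
  · simp [hA0]
  · exact eventually_cobounded_iff.2 ⟨r₂, hr₂, fun w hw hwr => hγ1 _ (by simpa using hwr)⟩
  · have h1 : ∀ᶠ p in nearInfinity x₀, α (p.1⁻¹, p.2) = α (0, p.2) - p.1⁻¹ • B₀ :=
      eventually_nearInfinity_iff.2 ⟨r₆, hr₆, fun w x hw hwr hx => by
        simpa using htail w x hwr hx⟩
    filter_upwards [hgauge', h1] with p hp hp1 v
    rw [hp, hΩ'a, hp1, birkhoffForm_apply, sub_eq_add_neg, neg_add, neg_neg, ← sub_eq_add_neg]
    rfl

end PolePart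

/-! ### Matrix entries and diagonal matrices. -/

section Entries

variable {n : ℕ} {V : Type*} [NormedAddCommGroup V] [NormedSpace ℂ V]

def entryCLM (i j : Fin n) : Mat n →L[ℂ] ℂ := (Matrix.entryLinearMap ℂ ℂ i j).toContinuousLinearMap

theorem analyticAt_entry {F : V → Mat n} {x : V} (hF : AnalyticAt ℂ F x) (i j : Fin n) :
    AnalyticAt ℂ (fun y => F y i j) x :=
  ((entryCLM i j).analyticAt _).comp hF

theorem fderiv_entry {F : V → Mat n} {x : V} (hF : DifferentiableAt ℂ F x) (i j : Fin n) (v : V) :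
    fderiv ℂ (fun y => F y i j) x v = fderiv ℂ F x v i j := by
  have h := ((entryCLM i j).hasFDerivAt.comp x hF.hasFDerivAt).fderiv
  exact congrArg (fun T => T v) h

theorem analyticAt_of_entries {F : V → Mat n} {x : V}
    (hF : ∀ i j, AnalyticAt ℂ (fun y => F y i j) x) : AnalyticAt ℂ F x := by
  have h : F = fun y => ∑ i, ∑ j,
      (Matrix.singleLinearMap ℂ i j : ℂ →ₗ[ℂ] Mat n).toContinuousLinearMap (F y i j) := by
    funext y
    exact Matrix.matrix_eq_sum_single (F y)
  rw [h]
  exact Finset.analyticAt_fun_sum _ fun i _ => Finset.analyticAt_fun_sum _ fun j _ =>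
    (ContinuousLinearMap.analyticAt _ _).comp (hF i j)

theorem offDiag_apply (M : Mat n) (i j : Fin n) : offDiag M i j = if i = j then 0 else M i j := by
  rw [offDiag, Matrix.sub_apply, Matrix.diagonal_apply]
  split_ifs with h
  · subst h; simp
  · simp

/-- The diagonal part, as a linear map. -/
def diagPartCLM (n : ℕ) : Mat n →L[ℂ] Mat n :=
  ((Matrix.diagonalLinearMap (Fin n) ℂ ℂ).comp (Matrix.diagLinearMap (Fin n) ℂ ℂ)).toContinuousLinearMap

theorem analyticAt_offDiag {F : V → Mat n} {x : V} (hF : AnalyticAt ℂ F x) :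
    AnalyticAt ℂ (fun y => offDiag (F y)) x :=
  ((ContinuousLinearMap.id ℂ _ - diagPartCLM n).analyticAt _).comp hF

theorem diag_offDiag (M : Mat n) : (offDiag M).diag = 0 := by
  funext i
  simp [offDiag_apply]

theorem isDiag_fderiv {Δ : V → Mat n} {x : V} (hΔ : DifferentiableAt ℂ Δ x)
    (h : ∀ᶠ y in 𝓝 x, (Δ y).IsDiag) (v : V) : (fderiv ℂ Δ x v).IsDiag := fun i j hij => by
  change fderiv ℂ Δ x v i j = 0
  rw [← fderiv_entry hΔ]
  have : (fun y => Δ y i j) =ᶠ[𝓝 x] fun _ => (0 : ℂ) := h.mono fun y hy => hy hij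
  rw [this.fderiv_eq]
  simp

theorem IsDiag.comm_apply {Δ : Mat n} (h : Δ.IsDiag) (M : Mat n) (i j : Fin n) :
    (Δ * M - M * Δ) i j = (Δ i i - Δ j j) * M i j := by
  rw [← h.diagonal_diag, Matrix.sub_apply, Matrix.diagonal_mul, Matrix.mul_diagonal]
  simp only [Matrix.diagonal_apply_eq, Matrix.diag_apply]
  ring

theorem IsDiag.commute {Δ Δ' : Mat n} (h : Δ.IsDiag) (h' : Δ'.IsDiag) : Δ * Δ' = Δ' * Δ := by
  rw [← h.diagonal_diag, ← h'.diagonal_diag, Matrix.diagonal_mul_diagonal,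
    Matrix.diagonal_mul_diagonal]
  simp [mul_comm]

end Entries

/-! ### Primitives of closed one-forms. -/

section Primitive

variable {V : Type*} [NormedAddCommGroup V] [NormedSpace ℂ V] [CompleteSpace V]

/-- A closed holomorphic one-form has a holomorphic primitive near a point. -/
theorem exists_analyticAt_primitive {θ : V → V →L[ℂ] ℂ} {x₀ : V} (hθ : AnalyticAt ℂ θ x₀)
    (hclosed : ∀ᶠ x in 𝓝 x₀, ∀ a b, fderiv ℂ θ x a b = fderiv ℂ θ x b a) :
    ∃ h : V → ℂ, AnalyticAt ℂ h x₀ ∧ ∀ᶠ x in 𝓝 x₀, fderiv ℂ h x = θ x := by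
  obtain ⟨h, hh, -, hrad⟩ := exists_radial_solution (𝒜 := ℂ) (x₀ := x₀) (y₀ := 0)
    (f := fun p : V × V × ℂ => θ p.1 p.2.1)
    ((AnalyticAt.comp (g := θ) (f := fun p : V × V × ℂ => p.1) hθ analyticAt_fst).clm_apply_analyticAt
      (analyticAt_fst.comp analyticAt_snd)) (fun s x u y => map_smul _ _ _)
  refine ⟨h, hh, ?_⟩
  -- Closedness of θ makes the differential of `E` symmetric. Differentiating E(x)(x - x₀) = 0 then
  -- gives the Euler equation dE(x - x₀) + E = 0, with bound 0.
  let E : V → V →L[ℂ] ℂ := fun x => fderiv ℂ h x - θ x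
  have hE : AnalyticAt ℂ E x₀ := hh.fderiv.sub hθ
  have hEz : ∀ᶠ x in 𝓝 x₀, E x = 0 := by
    refine eventually_eq_zero_of_euler (M := 0)
      (hE.eventually_analyticAt.mono fun x h => h.differentiableAt) ?_
    filter_upwards [hrad.eventually_nhds, hclosed, hh.eventually_analyticAt,
      hθ.eventually_analyticAt, hE.eventually_analyticAt] with x h1 h2 h3 h4 h5
    have hdE : ∀ a b, fderiv ℂ E x a b = fderiv ℂ E x b a := fun a b => by
      have h6 : fderiv ℂ E x = fderiv ℂ (fderiv ℂ h) x - fderiv ℂ θ x :=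
        fderiv_sub h3.fderiv.differentiableAt h4.differentiableAt
      rw [h6]
      simp only [sub_apply]
      rw [fderiv_fderiv_comm h3, h2]
    have h7 : fderiv ℂ E x (x - x₀) + E x = 0 := by
      ext b
      have h8 : HasDerivAt (fun t : ℂ => E (x + t • b) (x + t • b - x₀))
          (fderiv ℂ E x b (x - x₀) + E x b) 0 := by
        have hsub : DifferentiableAt ℂ (fun y => y - x₀) x := differentiableAt_fun_id.sub_const x₀
        have h9 := hasDerivAt_line (F := fun y => E y (y - x₀)) (x := x)
          (h5.differentiableAt.clm_apply hsub) b
        rw [fderiv_clm_apply h5.differentiableAt hsub] at h9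
        have h10 : fderiv ℂ (fun y => y - x₀) x = ContinuousLinearMap.id ℂ V := by
          rw [fderiv_sub_const]; exact fderiv_id
        rw [h10] at h9
        simpa [add_comm] using h9
      have h11 : (fun t : ℂ => E (x + t • b) (x + t • b - x₀)) =ᶠ[𝓝 0] fun _ => 0 :=
        ((tendsto_line x b).eventually h1).mono fun t ht => by
          simp only [E, sub_apply, sub_eq_zero]
          exact ht
      have h12 := h8.unique ((hasDerivAt_const (0 : ℂ) (0 : ℂ)).congr_of_eventuallyEq h11)
      rw [add_apply, hdE]
      exact h12
    rw [h7]
    simp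
  exact hEz.mono fun x hx => sub_eq_zero.1 hx

end Primitive

/-! ### Holomorphic diagonalization at a simple spectrum. -/

section Diagonalization

variable {n : ℕ} {V : Type*} [NormedAddCommGroup V] [NormedSpace ℂ V] [CompleteSpace V]

/-- Holomorphic diagonalization near a matrix with simple spectrum. -/
theorem exists_analyticAt_diagonalization {A : V → Mat n} {x₀ : V} (hA : AnalyticAt ℂ A x₀) {Q : Mat n}
    (hQ : IsUnit Q) {d : Fin n → ℂ} (hd : Function.Injective d)
    (h : Q⁻¹ * A x₀ * Q = Matrix.diagonal d) :
    ∃ P Δ : V → Mat n, AnalyticAt ℂ P x₀ ∧ IsUnit (P x₀) ∧ AnalyticAt ℂ Δ x₀ ∧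
      Δ x₀ = Matrix.diagonal d ∧ ∀ᶠ x in 𝓝 x₀, (Δ x).IsDiag ∧ A x * P x = P x * Δ x := by
  let D : Mat n := Matrix.diagonal d
  let o : Mat n →L[ℂ] Mat n := ContinuousLinearMap.id ℂ _ - diagPartCLM n
  let M : V → Mat n := fun x => Q⁻¹ * A x * Q
  have hM : AnalyticAt ℂ M x₀ := (analyticAt_const.mul hA).mul analyticAt_const
  -- One unknown matrix ξ encodes everything: its off-diagonal part ξ'' perturbs the eigenvectors
  -- and its diagonal part ξ' the eigenvalues, so that the system is square. The derivative in ξ at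
  -- the base point is [D, ξ''] - ξ', injective because the entries of `d` are distinct.
  let F : V × Mat n → Mat n := fun p =>
    M p.1 * (1 + o p.2) - (1 + o p.2) * (D + diagPartCLM n p.2)
  have hF : AnalyticAt ℂ F (x₀, 0) := by
    have h1 : AnalyticAt ℂ (fun p : V × Mat n => M p.1) (x₀, 0) :=
      AnalyticAt.comp (g := M) (f := fun p : V × Mat n => p.1) hM analyticAt_fst
    have h2 : AnalyticAt ℂ (fun p : V × Mat n => 1 + o p.2) (x₀, 0) :=
      analyticAt_const.add ((o.analyticAt _).comp analyticAt_snd)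
    have h3 : AnalyticAt ℂ (fun p : V × Mat n => D + diagPartCLM n p.2) (x₀, 0) :=
      analyticAt_const.add (((diagPartCLM n).analyticAt _).comp analyticAt_snd)
    exact (h1.mul h2).sub (h2.mul h3)
  have hF0 : F (x₀, 0) = 0 := by simp [F, M, h, D]
  have hder : ∀ ξ, fderiv ℂ F (x₀, 0) (0, ξ) = D * o ξ - o ξ * D - diagPartCLM n ξ := fun ξ => by
    refine (hasDerivAt_line hF.differentiableAt (0, ξ)).unique ?_
    have h1 : HasDerivAt (fun t : ℂ => t • (D * o ξ - o ξ * D - diagPartCLM n ξ) -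
        (t * t) • (o ξ * diagPartCLM n ξ)) (D * o ξ - o ξ * D - diagPartCLM n ξ) 0 := by
      have := ((hasDerivAt_id (0 : ℂ)).smul_const (D * o ξ - o ξ * D - diagPartCLM n ξ)).fun_sub
        (((hasDerivAt_id (0 : ℂ)).mul (hasDerivAt_id (0 : ℂ))).smul_const (o ξ * diagPartCLM n ξ))
      simpa using this
    refine h1.congr_of_eventuallyEq (Eventually.of_forall fun t => ?_)
    simp only [F, M, Prod.mk_add_mk, Prod.smul_mk, smul_zero, add_zero, zero_add, h, map_smul]
    change D * _ - _ = _
    simp only [mul_add, add_mul, mul_one, one_mul, smul_sub, smul_add, mul_smul_comm,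
      smul_mul_assoc, mul_smul]
    abel
  let T : Mat n →L[ℂ] Mat n := fderiv ℂ F (x₀, 0) ∘L .inr ℂ V (Mat n)
  have hTi : Function.Injective T := by
    refine (injective_iff_map_eq_zero T).2 fun ξ hξ => ?_
    have h1 : D * offDiag ξ - offDiag ξ * D - Matrix.diagonal ξ.diag = 0 := (hder ξ).symm.trans hξ
    ext i j
    have h2 := congrFun (congrFun h1 i) j
    rw [Matrix.sub_apply, IsDiag.comm_apply (Matrix.isDiag_diagonal d), offDiag_apply] at h2
    by_cases hij : i = j
    · subst hij
      simpa using h2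
    · rw [if_neg hij, Matrix.diagonal_apply_ne _ hij] at h2
      simpa [sub_eq_zero, hd.ne hij] using h2
  have hinv : (fderiv ℂ F (x₀, 0) ∘L .inr ℂ V (Mat n)).IsInvertible :=
    ⟨(LinearEquiv.ofInjectiveEndo T.toLinearMap hTi).toContinuousLinearEquiv, by ext ξ; rfl⟩
  have hcd : ContDiffAt ℂ ⊤ F (x₀, 0) := hF.contDiffAt
  have hne : (⊤ : WithTop ℕ∞) ≠ 0 := by simp
  set ψ := hcd.implicitFunction hne hinv with hψ
  have hψ0 : ψ x₀ = 0 := hcd.implicitFunction_apply_self hne hinv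
  have hψa : AnalyticAt ℂ ψ x₀ := (hcd.contDiffAt_implicitFunction hne hinv).analyticAt
  have hsol := hcd.eventually_apply_implicitFunction hne hinv
  rw [← hψ, hF0] at hsol
  refine ⟨fun x => Q * (1 + o (ψ x)), fun x => D + diagPartCLM n (ψ x), ?_, ?_, ?_, ?_, ?_⟩
  · exact analyticAt_const.mul (analyticAt_const.add ((o.analyticAt _).comp hψa))
  · simpa [hψ0] using hQ
  · exact analyticAt_const.add (((diagPartCLM n).analyticAt _).comp hψa)
  · simp [hψ0, D]
  · filter_upwards [hsol] with x hx
    refine ⟨(Matrix.isDiag_diagonal d).add (Matrix.isDiag_diagonal _), ?_⟩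
    have h1 : Q * F (x, ψ x) = 0 := by rw [hx, mul_zero]
    simp only [F, M, mul_sub] at h1
    rw [sub_eq_zero] at h1
    simp only [← mul_assoc] at h1
    rw [mat_mul_inv hQ, one_mul] at h1
    simp only [mul_assoc] at h1 ⊢
    exact h1

/-- A regular diagonalizable matrix has a simple spectrum. -/
theorem exists_injective_diagonal {A : Mat n} (hreg : A ∈ Mreg n) (hdiag : A ∈ Mdiag n) :
    ∃ (Q : Mat n) (d : Fin n → ℂ), IsUnit Q ∧ Function.Injective d ∧ Q⁻¹ * A * Q = Matrix.diagonal d := by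
  obtain ⟨Q, hQ, hD⟩ := hdiag
  refine ⟨Q, (Q⁻¹ * A * Q).diag, hQ, ?_, hD.diagonal_diag.symm⟩
  set D := Q⁻¹ * A * Q with hDdef
  have hA : A = Q * D * Q⁻¹ := by
    rw [hDdef, ← mul_assoc, ← mul_assoc, mat_mul_inv hQ, one_mul, mul_assoc, mat_mul_inv hQ, mul_one]
  let S : Finset ℂ := Finset.univ.image D.diag
  -- This product over the distinct eigenvalues annihilates `A`. As the minimal polynomial has
  -- degree n, there must be n of them.
  let p : Polynomial ℂ := ∏ a ∈ S, (Polynomial.X - Polynomial.C a)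
  have hpow : ∀ q : Polynomial ℂ, Polynomial.aeval A q = Q * Polynomial.aeval D q * Q⁻¹ := fun q => by
    induction q using Polynomial.induction_on' with
    | add q r hq hr => rw [map_add, map_add, hq, hr, mul_add, add_mul]
    | monomial k a =>
      rw [Polynomial.aeval_monomial, Polynomial.aeval_monomial]
      have h1 : A ^ k = Q * D ^ k * Q⁻¹ := by
        induction k with
        | zero => rw [pow_zero, pow_zero, mul_one, mat_mul_inv hQ]
        | succ k ih =>
          rw [pow_succ, ih, pow_succ]
          nth_rewrite 1 [hA]
          simp only [mul_assoc]
          rw [← mul_assoc Q⁻¹ Q, mat_inv_mul hQ, one_mul]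
      rw [h1, Algebra.algebraMap_eq_smul_one, smul_one_mul, smul_one_mul, mul_smul_comm,
        smul_mul_assoc]
  have hpD : Polynomial.aeval D p = 0 := by
    rw [← hD.diagonal_diag]
    have h1 : Polynomial.aeval (Matrix.diagonal D.diag) p =
        Matrix.diagonal (fun i => p.eval (D.diag i)) := by
      have := Polynomial.aeval_algHom_apply (Matrix.diagonalAlgHom (n := Fin n) (α := ℂ) ℂ) D.diag p
      rw [Matrix.diagonalAlgHom_apply] at this
      rw [this, Matrix.diagonalAlgHom_apply]
      congr 1
      funext i
      rw [← Polynomial.coe_aeval_eq_eval]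
      exact (Polynomial.aeval_algHom_apply (Pi.evalAlgHom ℂ (fun _ => ℂ) i) D.diag p).symm
    rw [h1]
    ext i j
    rw [Matrix.diagonal_apply]
    split_ifs
    · rw [Polynomial.eval_prod]
      exact Finset.prod_eq_zero (Finset.mem_image_of_mem _ (Finset.mem_univ i)) (by simp)
    · rfl
  have hp0 : p ≠ 0 := (Polynomial.monic_prod_of_monic _ _ fun a _ => Polynomial.monic_X_sub_C a).ne_zero
  have hdvd : minpoly ℂ A ∣ p := minpoly.dvd ℂ A (by rw [hpow, hpD, mul_zero, zero_mul])
  have hdeg := Polynomial.natDegree_le_of_dvd hdvd hp0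
  rw [← (show A.charpoly = minpoly ℂ A from hreg), Matrix.charpoly_natDegree_eq_dim,
    Polynomial.natDegree_prod_of_monic _ _ fun a _ => Polynomial.monic_X_sub_C a] at hdeg
  simp only [Polynomial.natDegree_X_sub_C, Finset.sum_const, smul_eq_mul, mul_one] at hdeg
  have hcard : S.card = Finset.univ.card := le_antisymm Finset.card_image_le (by simpa using hdeg)
  simpa using Finset.card_image_iff.1 hcard

end Diagonalization

/-! ### Integrability conditions for the pole and deformation parts. -/

section Integrability

variable {n : ℕ} {V : Type*} [NormedAddCommGroup V] [NormedSpace ℂ V] [FiniteDimensional ℂ V]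

/-- An affine function of w is determined by two values; the points r/2 and r/4 are used. This
separates the powers of z in the flatness equation. -/
theorem eq_zero_of_add_smul {W : Type*} [NormedAddCommGroup W] [NormedSpace ℂ W] {X Y : W} {r : ℝ}
    (hr : 0 < r) (h : ∀ w : ℂ, w ≠ 0 → ‖w‖ < r → X + w • Y = 0) : X = 0 ∧ Y = 0 := by
  have hn : ∀ s : ℝ, 0 < s → s < r → X + (s : ℂ) • Y = 0 := fun s hs hsr =>
    h s (by exact_mod_cast hs.ne') (by rwa [Complex.norm_real, Real.norm_of_nonneg hs.le])
  have h1 := hn (r / 2) (by positivity) (by linarith)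
  have h2 := hn (r / 4) (by positivity) (by linarith)
  have h3 : ((r / 4 : ℝ) : ℂ) • Y = 0 := by
    have := congrArg₂ (· - ·) h1 h2
    simp only [add_sub_add_left_eq_sub, ← sub_smul, sub_zero] at this
    rw [← this]
    congr 1
    push_cast
    ring
  have hY : Y = 0 := (smul_eq_zero.1 h3).resolve_left (by
    have : (r / 4 : ℝ) ≠ 0 := by positivity
    exact_mod_cast this)
  rw [hY, smul_zero, add_zero] at h1
  exact ⟨h1, hY⟩

/-- Flatness in mixed directions, in terms of the pole part and the deformation part. -/
theorem IsPoleAndDeformationPart.integrability {A₀ B₀ : Mat n} {x₀ : V} {Ω : ConnForm n V}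
    {A : V → Mat n} {C : V → (V →ₗ[ℂ] Mat n)} (hΩ : Ω ∈ classI A₀ B₀ x₀)
    (h : IsPoleAndDeformationPart A₀ B₀ x₀ Ω A C) :
    ∀ᶠ x in 𝓝 x₀, ∀ v, A x * C x v = C x v * A x ∧
      fderiv ℂ A x v = C x v + C x v * B₀ - B₀ * C x v := by
  obtain ⟨hpole, hflat, -⟩ := hΩ
  obtain ⟨T, hT, hTC⟩ := exists_analyticAt_clm_linearMap h.analyticAt_def
  obtain ⟨G, hG, -, hgauge⟩ := h.exists_frame
  obtain ⟨r, hr, hev⟩ := eventually_nearInfinity_iff.1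
    ((eventually_nearInfinity_nhds hgauge).and (hflat.and (hpole.analyticAt.and hG.eventually)))
  filter_upwards [Metric.ball_mem_nhds x₀ hr, h.analyticAt_pole.eventually_analyticAt,
    hT.eventually_analyticAt] with x hx hA hTx v
  -- The mixed component of flatness is affine in w, and its two coefficients are the two
  -- conditions.
  have key : ∀ w : ℂ, w ≠ 0 → ‖w‖ < r → (C x v * A x - A x * C x v) +
      w • (-fderiv ℂ A x v + C x v + (C x v * B₀ - B₀ * C x v)) = 0 := fun w hw hwr => by
    obtain ⟨h1, h2, h3, h4⟩ := hev w x hw hwr hx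
    let α : ℂ × V → Mat n := fun q => -(A q.2 + q.1 • B₀)
    have hα : DifferentiableAt ℂ α (w, x) :=
      ((DifferentiableAt.comp (g := A) (f := fun q : ℂ × V => q.2) _ hA.differentiableAt
        differentiableAt_snd).add (differentiableAt_fst.smul_const B₀)).neg
    have hd : fderiv ℂ α (w, x) (0, v) = -fderiv ℂ A x v := by
      refine (hasDerivAt_line_snd hα v).unique ?_
      exact ((hasDerivAt_line hA.differentiableAt v).add_const (w • B₀)).neg
    have h5 := flat_pole_part (Ω := birkhoffForm A B₀ C) (α := α) (C := T) hw hα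
      hTx.differentiableAt (Eventually.of_forall fun q v => by
        rw [birkhoffForm_apply, hTC, ← sub_eq_add_neg])
      (flat_gauge h4.1 h4.2 (fun v => (h3 v).differentiableAt) h1 h2) v
    rw [hd, hTC] at h5
    simp only [α] at h5
    rw [← h5]
    simp only [neg_mul, mul_neg, add_mul, mul_add, smul_add, smul_sub, smul_mul_assoc,
      mul_smul_comm]
    abel
  obtain ⟨k1, k2⟩ := eq_zero_of_add_smul hr key
  refine ⟨(sub_eq_zero.1 k1).symm, ?_⟩
  rw [← sub_eq_zero, ← neg_eq_zero, ← k2]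
  abel

end Integrability

/-! ### The connection in a frame of eigenvectors. -/

section DiagonalFrame

variable {n : ℕ} {V : Type*} [NormedAddCommGroup V] [NormedSpace ℂ V]

theorem fderiv_mul_apply {F G : V → Mat n} {x : V} (hF : DifferentiableAt ℂ F x)
    (hG : DifferentiableAt ℂ G x) (v : V) :
    fderiv ℂ (fun y => F y * G y) x v = F x * fderiv ℂ G x v + fderiv ℂ F x v * G x := by
  rw [fderiv_fun_mul' hF hG]
  simp

/-- In a frame of eigenvectors, the deformation part is the differential of the eigenvalues as soon
as it is diagonal. -/
theorem deformation_part_diagonal_frame {A P Δ : V → Mat n} {B T dA : Mat n} {x v : V}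
    (hA : HasFDerivAt A (fderiv ℂ A x) x) (hdA : fderiv ℂ A x v = dA)
    (hP : DifferentiableAt ℂ P x) (hu : IsUnit (P x)) (hΔ : DifferentiableAt ℂ Δ x)
    (hdiag : ∀ᶠ y in 𝓝 x, (Δ y).IsDiag ∧ A y * P y = P y * Δ y)
    (hT : ((P x)⁻¹ * T * P x).IsDiag) (h : dA = T + T * B - B * T) :
    T * P x = P x * fderiv ℂ Δ x v ∧
      Δ x * ((P x)⁻¹ * fderiv ℂ P x v) - (P x)⁻¹ * fderiv ℂ P x v * Δ x =
        (P x)⁻¹ * B * P x * fderiv ℂ Δ x v - fderiv ℂ Δ x v * ((P x)⁻¹ * B * P x) := by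
  have hΔx := hdiag.self_of_nhds.1
  have hAP := hdiag.self_of_nhds.2
  have hdΔ := isDiag_fderiv hΔ (hdiag.mono fun y hy => hy.1) v
  set p := P x
  set q := (P x)⁻¹
  set dP := fderiv ℂ P x v
  set dΔ := fderiv ℂ Δ x v
  have hpq : p * q = 1 := mat_mul_inv hu
  have hqp : q * p = 1 := mat_inv_mul hu
  have hder : A x * dP + dA * p = p * dΔ + dP * Δ x := by
    have h1 : (fun y => A y * P y) =ᶠ[𝓝 x] fun y => P y * Δ y := hdiag.mono fun y hy => hy.2
    have h2 := congrArg (fun L : V →L[ℂ] Mat n => L v) h1.fderiv_eq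
    rw [fderiv_mul_apply hA.differentiableAt hP, fderiv_mul_apply hP hΔ, hdA] at h2
    exact h2
  set D := q * T * p with hD
  set N := q * B * p with hN
  have hqA : q * A x = Δ x * q := by
    have := congrArg (fun m => q * m * q) hAP
    simp only [mul_assoc, hpq, mul_one] at this
    rwa [← mul_assoc q p, hqp, one_mul] at this
  have hTp : T * p = p * D := by rw [hD, ← mul_assoc, ← mul_assoc, hpq, one_mul]
  have hBp : B * p = p * N := by rw [hN, ← mul_assoc, ← mul_assoc, hpq, one_mul]
  -- The derivative of AP = PΔ, multiplied by P⁻¹ on the left, with dA replaced by its expression in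
  -- T and B.
  have hsum : (Δ x * (q * dP) - q * dP * Δ x) + (D - dΔ) + (D * N - N * D) = 0 := by
    have h1 := congrArg (fun m => q * m) hder
    simp only [mul_add] at h1
    have h2 : q * (dA * p) = D + D * N - N * D := by
      rw [h, sub_mul, add_mul, mul_assoc T B, hBp, ← mul_assoc T p, hTp, mul_assoc B T, hTp,
        ← mul_assoc B p, hBp, mul_sub, mul_add]
      simp only [← mul_assoc, hqp, one_mul]
    rw [h2, ← mul_assoc q (A x), hqA, ← mul_assoc q p, hqp, one_mul, ← sub_eq_zero] at h1
    rw [← h1]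
    simp only [mul_assoc]
    abel
  -- Both brackets in `hsum` involve a diagonal matrix, so their diagonals vanish and D and dΔ have
  -- the same diagonal; off the diagonal both are zero.
  have hDd : D = dΔ := by
    ext i j
    by_cases hij : i = j
    · subst hij
      have h1 := congrFun (congrFun hsum i) i
      simp only [Matrix.add_apply, Matrix.zero_apply] at h1
      rw [IsDiag.comm_apply hΔx, IsDiag.comm_apply hT] at h1
      simpa [sub_eq_zero] using h1
    · rw [hT hij, hdΔ hij]
  rw [hDd, sub_self, add_zero] at hsum
  refine ⟨by rw [hTp, hDd], ?_⟩
  rw [← sub_eq_zero, ← hsum]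
  abel

/-- The logarithmic derivative `P⁻¹ dP`. -/
def matLogDeriv (P : V → Mat n) (x : V) : V →L[ℂ] Mat n :=
  (ContinuousLinearMap.mul ℂ (Mat n) (P x)⁻¹).comp (fderiv ℂ P x)

theorem matLogDeriv_apply (P : V → Mat n) (x v : V) :
    matLogDeriv P x v = (P x)⁻¹ * fderiv ℂ P x v := rfl

theorem analyticAt_matLogDeriv {P : V → Mat n} {x : V} (hP : AnalyticAt ℂ P x) (hu : IsUnit (P x)) :
    AnalyticAt ℂ (matLogDeriv P) x :=
  (((ContinuousLinearMap.mul ℂ (Mat n)).analyticAt _).comp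
    (analyticAt_matrix_inv hP hu)).clm_comp_analyticAt hP.fderiv

/-- The Maurer–Cartan equation for the logarithmic derivative. -/
theorem fderiv_matLogDeriv {P : V → Mat n} {x : V} (hP : AnalyticAt ℂ P x) (hu : IsUnit (P x)) (a b : V) :
    fderiv ℂ (matLogDeriv P) x a b + matLogDeriv P x a * matLogDeriv P x b =
      fderiv ℂ (matLogDeriv P) x b a + matLogDeriv P x b * matLogDeriv P x a := by
  have hl := (analyticAt_matLogDeriv hP hu).differentiableAt
  have key : ∀ a b, P x * (fderiv ℂ (matLogDeriv P) x a b + matLogDeriv P x a * matLogDeriv P x b) =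
      fderiv ℂ (fderiv ℂ P) x a b := fun a b => by
    have h1 : (fun y => P y * matLogDeriv P y b) =ᶠ[𝓝 x] fun y => fderiv ℂ P y b := by
      filter_upwards [eventually_isUnit hP.continuousAt hu] with y hy
      rw [matLogDeriv_apply, ← mul_assoc, mat_mul_inv hy, one_mul]
    have h2 := congrArg (fun L : V →L[ℂ] Mat n => L a) h1.fderiv_eq
    rw [fderiv_mul_apply hP.differentiableAt (hl.clm_apply (differentiableAt_const b)),
      fderiv_clm_apply_const hl, fderiv_clm_apply_const hP.fderiv.differentiableAt] at h2
    rw [← h2, mul_add, matLogDeriv_apply P x a, ← mul_assoc, ← mul_assoc, mat_mul_inv hu, one_mul]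
  exact hu.mul_left_cancel (by rw [key, key, fderiv_fderiv_comm hP])

end DiagonalFrame

/-! ### Normalization of the eigenvectors. -/

section NormalizedFrame

variable {n : ℕ} {V : Type*} [NormedAddCommGroup V] [NormedSpace ℂ V] [FiniteDimensional ℂ V]

/-- Applied with t = Δᵢ - Δⱼ: the (i, j) and (j, i) entries of P⁻¹dP are both multiples of the
covector dt, so their wedge product vanishes. Through the Maurer–Cartan equation this makes the
diagonal of P⁻¹dP closed. -/
theorem closed_of_proportional {t a1 a2 b1 b2 da db N M : ℂ} (ht : t ≠ 0)
    (h1 : t * a1 = -(da * N)) (h2 : t * b1 = -(db * N)) (h3 : t * a2 = -(da * M))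
    (h4 : t * b2 = -(db * M)) : a1 * b2 = b1 * a2 := by
  have e : t * t * (a1 * b2) = t * t * (b1 * a2) := by
    calc t * t * (a1 * b2) = (t * a1) * (t * b2) := by ring
      _ = (t * b1) * (t * a2) := by rw [h1, h2, h3, h4]; ring
      _ = t * t * (b1 * a2) := by ring
  exact mul_left_cancel₀ (mul_ne_zero ht ht) e

/-- Rescaling the eigenvectors so that `P⁻¹ dP` has no diagonal part. -/
theorem exists_rescaling {P : V → Mat n} {x₀ : V} (hP : AnalyticAt ℂ P x₀) (hu : IsUnit (P x₀))
    (hclosed : ∀ᶠ x in 𝓝 x₀, ∀ i a b,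
      (matLogDeriv P x a * matLogDeriv P x b) i i = (matLogDeriv P x b * matLogDeriv P x a) i i) :
    ∃ S : V → Mat n, AnalyticAt ℂ S x₀ ∧ ∀ᶠ x in 𝓝 x₀, (S x).IsDiag ∧ IsUnit (S x) ∧
      ∀ v, ((P x * S x)⁻¹ * fderiv ℂ (fun y => P y * S y) x v).diag = 0 := by
  have : CompleteSpace V := FiniteDimensional.complete ℂ V
  let θ : Fin n → V → V →L[ℂ] ℂ := fun i x => (entryCLM i i).comp (matLogDeriv P x)
  have hla := analyticAt_matLogDeriv hP hu
  have hθ : ∀ i, AnalyticAt ℂ (θ i) x₀ := fun i =>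
    (analyticAt_const (v := entryCLM i i)).clm_comp_analyticAt hla
  have hθd : ∀ i, ∀ᶠ x in 𝓝 x₀, ∀ a b, fderiv ℂ (θ i) x a b = fderiv ℂ (θ i) x b a := fun i => by
    filter_upwards [hclosed, hP.eventually_analyticAt, eventually_isUnit hP.continuousAt hu,
      hla.eventually_analyticAt, (hθ i).eventually_analyticAt] with x h1 h2 h3 h4 h5 a b
    have h6 : ∀ a b, fderiv ℂ (θ i) x a b = fderiv ℂ (matLogDeriv P) x a b i i := fun a b => by
      rw [← fderiv_clm_apply_const h5.differentiableAt,
        ← fderiv_clm_apply_const h4.differentiableAt]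
      exact fderiv_entry (h4.differentiableAt.clm_apply (differentiableAt_const b)) i i a
    have h7 := congrFun (congrFun (fderiv_matLogDeriv h2 h3 a b) i) i
    rw [Matrix.add_apply, Matrix.add_apply, h1 i a b] at h7
    rw [h6, h6]
    exact add_right_cancel h7
  choose h hh hprim using fun i => exists_analyticAt_primitive (hθ i) (hθd i)
  -- Rescaling the i-th eigenvector by exp(-hᵢ) subtracts dhᵢ from the i-th diagonal entry of P⁻¹dP,
  -- which is dhᵢ itself.
  let S : V → Mat n := fun x => Matrix.diagonal fun i => Complex.exp (-h i x)
  let S' : V → Mat n := fun x => Matrix.diagonal fun i => Complex.exp (h i x)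
  have hSS' : ∀ x, S x * S' x = 1 := fun x => by
    simp only [S, S', Matrix.diagonal_mul_diagonal, ← Complex.exp_add, neg_add_cancel,
      Complex.exp_zero]
    exact Matrix.diagonal_one
  have hexp : ∀ i {x}, AnalyticAt ℂ (h i) x → AnalyticAt ℂ (fun y => Complex.exp (-h i y)) x :=
    fun i x hx => (hx.neg).cexp
  have hSa : ∀ {x}, (∀ i, AnalyticAt ℂ (h i) x) → AnalyticAt ℂ S x := fun {x} hx =>
    analyticAt_of_entries fun i j => by
      by_cases hij : i = j
      · subst hij
        simpa [S] using hexp i (hx i)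
      · simpa [S, hij] using analyticAt_const
  refine ⟨S, hSa hh, ?_⟩
  have hha : ∀ᶠ x in 𝓝 x₀, ∀ i, AnalyticAt ℂ (h i) x :=
    eventually_all.2 fun i => (hh i).eventually_analyticAt
  filter_upwards [hha, eventually_all.2 hprim, hP.eventually_analyticAt,
    eventually_isUnit hP.continuousAt hu] with x hx hp hPx hux
  have hSu : IsUnit (S x) := ((Matrix.isUnit_iff_isUnit_det _).2
    (Matrix.isUnit_det_of_right_inverse (hSS' x)))
  refine ⟨Matrix.isDiag_diagonal _, hSu, fun v => ?_⟩
  have hS := (hSa hx).differentiableAt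
  let E : Mat n := Matrix.diagonal fun i => -(fderiv ℂ (h i) x v)
  have hdS : fderiv ℂ S x v = S x * E := by
    ext i j
    rw [← fderiv_entry hS]
    simp only [S, E, Matrix.diagonal_mul_diagonal]
    by_cases hij : i = j
    · subst hij
      simp only [Matrix.diagonal_apply_eq]
      have h1 := (hx i).differentiableAt.hasFDerivAt.neg.cexp
      have h2 : fderiv ℂ (fun y => Complex.exp (-h i y)) x = _ := h1.fderiv
      rw [h2]
      simp
    · simp [hij]
  have hX : (P x * S x)⁻¹ * fderiv ℂ (fun y => P y * S y) x v =
      S' x * matLogDeriv P x v * S x + E := by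
    refine (hux.mul hSu).mul_left_cancel ?_
    rw [← mul_assoc, mat_mul_inv (hux.mul hSu), one_mul, fderiv_mul_apply hPx.differentiableAt hS,
      hdS, mul_add, matLogDeriv_apply]
    have e1 : P x * S x * (S' x * ((P x)⁻¹ * fderiv ℂ P x v) * S x) =
        P x * (S x * S' x) * (P x)⁻¹ * fderiv ℂ P x v * S x := by simp only [mul_assoc]
    rw [e1, hSS', mul_one, mat_mul_inv hux, one_mul, mul_assoc, add_comm]
  rw [hX]
  funext i
  have hpi := congrArg (fun L => L v) (hp i)
  have hpi' : fderiv ℂ (h i) x v = matLogDeriv P x v i i := hpi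
  simp only [S, S', E, Matrix.diag_apply, Matrix.add_apply, Matrix.diagonal_apply_eq,
    Matrix.mul_diagonal, Matrix.diagonal_mul, hpi', Pi.zero_apply]
  rw [mul_comm (Complex.exp _), mul_assoc, ← Complex.exp_add, add_neg_cancel, Complex.exp_zero]
  ring

/-- A frame of eigenvectors near a point with simple spectrum, normalized by
`diag (P⁻¹ dP) = 0`. -/
theorem exists_normalized_frame {A : V → Mat n} {B Q : Mat n} {C : V → (V →ₗ[ℂ] Mat n)} {x₀ : V}
    (hA : AnalyticAt ℂ A x₀)
    (hint : ∀ᶠ x in 𝓝 x₀, ∀ v, A x * C x v = C x v * A x ∧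
      fderiv ℂ A x v = C x v + C x v * B - B * C x v)
    (hQ : IsUnit Q) {d : Fin n → ℂ} (hd : Function.Injective d)
    (h : Q⁻¹ * A x₀ * Q = Matrix.diagonal d) :
    ∃ P Δ : V → Mat n, AnalyticAt ℂ P x₀ ∧ AnalyticAt ℂ Δ x₀ ∧ ∀ᶠ x in 𝓝 x₀,
      IsUnit (P x) ∧ (Δ x).IsDiag ∧ (∀ i j, i ≠ j → Δ x i i ≠ Δ x j j) ∧
      A x * P x = P x * Δ x ∧ ∀ v, C x v * P x = P x * fderiv ℂ Δ x v ∧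
        ((P x)⁻¹ * fderiv ℂ P x v).diag = 0 ∧
        Δ x * ((P x)⁻¹ * fderiv ℂ P x v) - (P x)⁻¹ * fderiv ℂ P x v * Δ x =
        (P x)⁻¹ * B * P x * fderiv ℂ Δ x v - fderiv ℂ Δ x v * ((P x)⁻¹ * B * P x) := by
  have : CompleteSpace V := FiniteDimensional.complete ℂ V
  obtain ⟨P₀, Δ, hP₀, hu₀, hΔ, hΔ₀, hdiag⟩ := exists_analyticAt_diagonalization hA hQ hd h
  have hsimple : ∀ᶠ x in 𝓝 x₀, ∀ i j, i ≠ j → Δ x i i ≠ Δ x j j := by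
    refine eventually_all.2 fun i => eventually_all.2 fun j => ?_
    by_cases hij : i = j
    · exact Eventually.of_forall fun x h => (h hij).elim
    · have hc : ∀ i, ContinuousAt (fun x => Δ x i i) x₀ := fun i => (analyticAt_entry hΔ i i).continuousAt
      have hne : Δ x₀ i i ≠ Δ x₀ j j := by
        rw [hΔ₀, Matrix.diagonal_apply_eq, Matrix.diagonal_apply_eq]
        exact hd.ne hij
      filter_upwards [((hc i).sub (hc j)).eventually_ne (sub_ne_zero.2 hne)] with x hx _
      exact sub_ne_zero.1 hx
  -- Stated for an arbitrary frame of eigenvectors, since it is needed both before and after the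
  -- rescaling.
  have hframe : ∀ {P : V → Mat n}, AnalyticAt ℂ P x₀ → IsUnit (P x₀) →
      (∀ᶠ x in 𝓝 x₀, A x * P x = P x * Δ x) → ∀ᶠ x in 𝓝 x₀, ∀ v,
      C x v * P x = P x * fderiv ℂ Δ x v ∧
      Δ x * ((P x)⁻¹ * fderiv ℂ P x v) - (P x)⁻¹ * fderiv ℂ P x v * Δ x =
        (P x)⁻¹ * B * P x * fderiv ℂ Δ x v - fderiv ℂ Δ x v * ((P x)⁻¹ * B * P x) := by
    intro P hP hu hAP
    filter_upwards [hint, hA.eventually_analyticAt, hP.eventually_analyticAt,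
      eventually_isUnit hP.continuousAt hu, hΔ.eventually_analyticAt, hsimple,
      hdiag.eventually_nhds, hAP.eventually_nhds] with x h1 h2 h3 h4 h5 h6 h7 h8 v
    -- `C` commutes with `A`, hence is diagonal in eigenvectors of distinct eigenvalues.
    have hcomm : Δ x * ((P x)⁻¹ * C x v * P x) - ((P x)⁻¹ * C x v * P x) * Δ x = 0 := by
      have e1 : P x * Δ x = A x * P x := h8.self_of_nhds.symm
      have e2 : Δ x * (P x)⁻¹ = (P x)⁻¹ * A x := by
        refine h4.mul_left_cancel ?_
        rw [← mul_assoc, e1, mul_assoc, mat_mul_inv h4, mul_one, ← mul_assoc, mat_mul_inv h4, one_mul]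
      rw [← mul_assoc, ← mul_assoc, e2, mul_assoc _ (P x), e1, mul_assoc (P x)⁻¹ (A x),
        (h1 v).1]
      simp only [mul_assoc, sub_self]
    refine deformation_part_diagonal_frame h2.differentiableAt.hasFDerivAt rfl h3.differentiableAt h4
      h5.differentiableAt (h7.and h8 |>.mono fun y hy => ⟨hy.1.1, hy.2⟩) (fun i j hij => ?_) (h1 v).2
    have h9 := congrFun (congrFun hcomm i) j
    rw [IsDiag.comm_apply h7.self_of_nhds.1] at h9
    exact (mul_eq_zero.1 h9).resolve_left (sub_ne_zero.2 (h6 i j hij))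
  have hclosed : ∀ᶠ x in 𝓝 x₀, ∀ i a b,
      (matLogDeriv P₀ x a * matLogDeriv P₀ x b) i i = (matLogDeriv P₀ x b * matLogDeriv P₀ x a) i i := by
    filter_upwards [hframe hP₀ hu₀ (hdiag.mono fun x hx => hx.2), hdiag.eventually_nhds, hsimple,
      hΔ.eventually_analyticAt] with x h1 h2 h3 h4 i a b
    have hrel : ∀ i j v, (Δ x i i - Δ x j j) * matLogDeriv P₀ x v i j =
        -((fderiv ℂ Δ x v i i - fderiv ℂ Δ x v j j) * ((P₀ x)⁻¹ * B * P₀ x) i j) := fun i j v => by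
      have h5 := congrFun (congrFun (h1 v).2 i) j
      rw [← neg_sub (fderiv ℂ Δ x v * _), Matrix.neg_apply, IsDiag.comm_apply h2.self_of_nhds.1,
        IsDiag.comm_apply (isDiag_fderiv h4.differentiableAt (h2.mono fun y hy => hy.1) v)] at h5
      exact h5
    rw [Matrix.mul_apply, Matrix.mul_apply]
    refine Finset.sum_congr rfl fun j _ => ?_
    by_cases hij : i = j
    · subst hij
      exact mul_comm _ _
    · refine closed_of_proportional (sub_ne_zero.2 (h3 i j hij)) (hrel i j a) (hrel i j b)
        (M := ((P₀ x)⁻¹ * B * P₀ x) j i) ?_ ?_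
      · linear_combination -hrel j i a
      · linear_combination -hrel j i b
  obtain ⟨S, hS, hSev⟩ := exists_rescaling hP₀ hu₀ hclosed
  have hP : AnalyticAt ℂ (fun x => P₀ x * S x) x₀ := hP₀.mul hS
  have hAP : ∀ᶠ x in 𝓝 x₀, A x * (P₀ x * S x) = P₀ x * S x * Δ x := by
    filter_upwards [hdiag, hSev] with x h1 h2
    rw [← mul_assoc, h1.2, mul_assoc, IsDiag.commute h1.1 h2.1, mul_assoc]
  refine ⟨fun x => P₀ x * S x, Δ, hP, hΔ, ?_⟩
  filter_upwards [hframe hP (hu₀.mul hSev.self_of_nhds.2.1) hAP, hAP, hsimple, hdiag, hSev,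
    eventually_isUnit hP₀.continuousAt hu₀] with x h1 h2 h3 h4 h5 h6
  exact ⟨h6.mul h5.2.1, h4.1, h3, h2, fun v => ⟨(h1 v).1, h5.2.2 v, (h1 v).2⟩⟩

end NormalizedFrame

/-! ### Recursion for the formal gauge. -/

section FormalRecursion

variable {n : ℕ}

theorem IsDiag.mul_apply_right {D : Mat n} (h : D.IsDiag) (M : Mat n) (i j : Fin n) :
    (M * D) i j = M i j * D j j := by
  nth_rewrite 1 [← h.diagonal_diag]
  rw [Matrix.mul_diagonal, Matrix.diag_apply]

/-- The right-hand side of the recursion for the formal gauge. -/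
def formalRhs (N B' : Mat n) (k : ℕ) (ψ : Mat n) : Mat n := ψ * B' - N * ψ - (k : ℂ) • ψ

/-- Off the diagonal, the equation for the bracket of Δ with the next coefficient is solved by
dividing by the eigenvalue differences. -/
def formalOff (Δ N B' : Mat n) (k : ℕ) (ψ : Mat n) : Mat n :=
  Matrix.of fun i j => if i = j then 0 else formalRhs N B' k ψ i j / (Δ i i - Δ j j)

/-- The equation at level k does not involve the diagonal of the next coefficient. That diagonal is
fixed by the solvability of level k + 1, where the terms with the diagonals of N and B' cancel and
the factor k + 1 remains to divide by. -/
def formalStep (Δ N B' : Mat n) (k : ℕ) (ψ : Mat n) : Mat n :=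
  formalOff Δ N B' k ψ +
    Matrix.diagonal fun i => -((N * formalOff Δ N B' k ψ) i i / ((k : ℂ) + 1))

/-- The formal gauge in a normalized frame of eigenvectors. -/
def formalSol (Δ N B' : Mat n) : ℕ → Mat n
  | 0 => 1
  | k + 1 => formalStep Δ N B' k (formalSol Δ N B' k)

theorem formalStep_apply_ne (Δ N B' ψ : Mat n) (k : ℕ) {i j : Fin n} (hij : i ≠ j) :
    formalStep Δ N B' k ψ i j = formalRhs N B' k ψ i j / (Δ i i - Δ j j) := by
  simp [formalStep, formalOff, hij]

theorem diag_formalRhs_formalStep {Δ N B' : Mat n} (hB' : B'.IsDiag) (hN : ∀ i, B' i i = N i i)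
    (k : ℕ) (ψ : Mat n) (i : Fin n) : formalRhs N B' (k + 1) (formalStep Δ N B' k ψ) i i = 0 := by
  have hk : (k : ℂ) + 1 ≠ 0 := by exact_mod_cast k.succ_ne_zero
  have h1 : formalStep Δ N B' k ψ i i = -((N * formalOff Δ N B' k ψ) i i / ((k : ℂ) + 1)) := by
    simp [formalStep, formalOff]
  have h2 : (formalStep Δ N B' k ψ * B') i i = formalStep Δ N B' k ψ i i * N i i := by
    rw [← hN, IsDiag.mul_apply_right hB']
  have h3 : (N * formalStep Δ N B' k ψ) i i =
      (N * formalOff Δ N B' k ψ) i i + N i i * formalStep Δ N B' k ψ i i := by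
    rw [h1]
    nth_rewrite 1 [formalStep]
    rw [mul_add, Matrix.add_apply, Matrix.mul_diagonal]
  rw [formalRhs, Matrix.sub_apply, Matrix.sub_apply, Matrix.smul_apply, h2, h3, h1]
  push_cast
  rw [smul_eq_mul]
  field_simp
  ring

/-- Solvability at every level. At level 0 it is the agreement of the diagonals of `B'` and `N`;
later it is the choice made in `formalStep`. -/
theorem diag_formalRhs_formalSol {Δ N B' : Mat n} (hB' : B'.IsDiag) (hN : ∀ i, B' i i = N i i)
    (k : ℕ) (i : Fin n) : formalRhs N B' k (formalSol Δ N B' k) i i = 0 := by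
  cases k with
  | zero => simp [formalRhs, formalSol, hN]
  | succ k => exact diag_formalRhs_formalStep hB' hN k _ i

theorem formalSol_succ {Δ N B' : Mat n} (hΔ : Δ.IsDiag) (hs : ∀ i j, i ≠ j → Δ i i ≠ Δ j j)
    (hB' : B'.IsDiag) (hN : ∀ i, B' i i = N i i) (k : ℕ) :
    Δ * formalSol Δ N B' (k + 1) - formalSol Δ N B' (k + 1) * Δ =
      formalRhs N B' k (formalSol Δ N B' k) := by
  ext i j
  rw [IsDiag.comm_apply hΔ]
  by_cases hij : i = j
  · subst hij
    rw [sub_self, zero_mul, diag_formalRhs_formalSol hB' hN]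
  · rw [formalSol, formalStep_apply_ne _ _ _ _ _ hij, mul_div_cancel₀ _ (sub_ne_zero.2 (hs i j hij))]

variable {V : Type*} [NormedAddCommGroup V] [NormedSpace ℂ V]

theorem analyticAt_formalSol {Δ N : V → Mat n} {x : V} (B' : Mat n) (hΔ : AnalyticAt ℂ Δ x)
    (hN : AnalyticAt ℂ N x) (hs : ∀ i j, i ≠ j → Δ x i i ≠ Δ x j j) (k : ℕ) :
    AnalyticAt ℂ (fun y => formalSol (Δ y) (N y) B' k) x := by
  induction k with
  | zero => exact analyticAt_const
  | succ k ih =>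
    have h1 : AnalyticAt ℂ (fun y => formalRhs (N y) B' k (formalSol (Δ y) (N y) B' k)) x :=
      ((ih.mul analyticAt_const).sub (hN.mul ih)).sub ((analyticAt_const (v := (k : ℂ))).smul ih)
    have h2 : AnalyticAt ℂ (fun y => formalOff (Δ y) (N y) B' k (formalSol (Δ y) (N y) B' k)) x :=
      analyticAt_of_entries fun i j => by
        by_cases hij : i = j
        · simpa [formalOff, hij] using analyticAt_const
        · simp only [formalOff, Matrix.of_apply, if_neg hij]
          exact (analyticAt_entry h1 i j).div ((analyticAt_entry hΔ i i).sub (analyticAt_entry hΔ j j))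
            (sub_ne_zero.2 (hs i j hij))
    refine h2.add (analyticAt_of_entries fun i j => ?_)
    by_cases hij : i = j
    · subst hij
      simp only [Matrix.diagonal_apply_eq]
      exact (((analyticAt_entry (hN.mul h2) i i)).div analyticAt_const
        (by exact_mod_cast k.succ_ne_zero)).neg
    · simpa [hij] using analyticAt_const

end FormalRecursion

/-! ### The defect of the parameter equation. -/

section Defect

variable {n : ℕ}

/-- The defect of the `x`-part of the formal gauge equation satisfies the homogeneous recursion. -/
theorem defect_recursion {A B B' T Δ dA dΔ Φ₁ Φ₂ dΦ₀ dΦ₁ : Mat n} {k : ℂ}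
    (h2 : A * Φ₂ + B * Φ₁ + (k + 1) • Φ₁ = Φ₂ * Δ + Φ₁ * B')
    (hd : (A * dΦ₁ + dA * Φ₁) + B * dΦ₀ + k • dΦ₀ = (Φ₁ * dΔ + dΦ₁ * Δ) + dΦ₀ * B')
    (hA : dA = T + T * B - B * T) (hAT : A * T = T * A) (hΔ : Δ * dΔ = dΔ * Δ)
    (hB' : B' * dΔ = dΔ * B') :
    A * (dΦ₁ - T * Φ₂ + Φ₂ * dΔ) - (dΦ₁ - T * Φ₂ + Φ₂ * dΔ) * Δ =
      (dΦ₀ - T * Φ₁ + Φ₁ * dΔ) * B' - B * (dΦ₀ - T * Φ₁ + Φ₁ * dΔ) -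
        k • (dΦ₀ - T * Φ₁ + Φ₁ * dΔ) := by
  have h2T : T * (A * Φ₂) = T * (Φ₂ * Δ + Φ₁ * B' - B * Φ₁ - (k + 1) • Φ₁) := by
    rw [← h2]; congr 1; abel
  have h2Δ : A * Φ₂ * dΔ = (Φ₂ * Δ + Φ₁ * B' - B * Φ₁ - (k + 1) • Φ₁) * dΔ := by
    rw [← h2]; congr 1; abel
  have hd' : A * dΦ₁ = (Φ₁ * dΔ + dΦ₁ * Δ) + dΦ₀ * B' - B * dΦ₀ - k • dΦ₀ - dA * Φ₁ := by
    rw [← hd]; abel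
  have hAT' : A * (T * Φ₂) = T * (A * Φ₂) := by rw [← mul_assoc, hAT, mul_assoc]
  have hΔ' : Φ₂ * Δ * dΔ = Φ₂ * dΔ * Δ := by rw [mul_assoc, hΔ, mul_assoc]
  have hB'' : Φ₁ * B' * dΔ = Φ₁ * dΔ * B' := by rw [mul_assoc, hB', mul_assoc]
  rw [mul_add, mul_sub, hAT', h2T, ← mul_assoc A Φ₂, h2Δ, hd', hA]
  simp only [mul_add, mul_sub, add_mul, sub_mul, hΔ', hB'', add_smul, smul_add, smul_sub, one_smul,
    mul_smul_comm, smul_mul_assoc, mul_assoc]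
  abel

/-- The general recursion at k = -1, with zero as the coefficient of degree -1. The defect on its
right side is then Φ₀ dΔ - TΦ₀, which vanishes by `hT`. -/
theorem defect_recursion_zero {A B B' T Δ dA dΔ Φ₀ Φ₁ dΦ₀ : Mat n}
    (h2 : A * Φ₁ + B * Φ₀ = Φ₁ * Δ + Φ₀ * B')
    (hd : A * dΦ₀ + dA * Φ₀ = Φ₀ * dΔ + dΦ₀ * Δ) (hT : T * Φ₀ = Φ₀ * dΔ)
    (hA : dA = T + T * B - B * T) (hAT : A * T = T * A) (hΔ : Δ * dΔ = dΔ * Δ)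
    (hB' : B' * dΔ = dΔ * B') :
    A * (dΦ₀ - T * Φ₁ + Φ₁ * dΔ) - (dΦ₀ - T * Φ₁ + Φ₁ * dΔ) * Δ = 0 := by
  have h := defect_recursion (A := A) (B := B) (B' := B') (T := T) (Δ := Δ) (dA := dA) (dΔ := dΔ)
    (Φ₁ := Φ₀) (Φ₂ := Φ₁) (dΦ₀ := 0) (dΦ₁ := dΦ₀) (k := -1) (by simp [h2])
    (by simp [hd]) hA hAT hΔ hB'
  rw [h]
  simp [hT]

/-- Multiplied by P⁻¹, the first equation says that P⁻¹E commutes with Δ, hence is diagonal. On the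
diagonal of the second equation B' cancels against P⁻¹BP and only the term with k survives. It gives
nothing at k = 0, where the normalization of P must take over. -/
theorem eq_zero_of_homogeneous {A B B' P Δ E E' : Mat n} {k : ℕ} (hu : IsUnit P) (hΔ : Δ.IsDiag)
    (hs : ∀ i j, i ≠ j → Δ i i ≠ Δ j j) (hAP : A * P = P * Δ) (hB' : B'.IsDiag)
    (hN : ∀ i, B' i i = (P⁻¹ * B * P) i i) (hE : A * E - E * Δ = 0)
    (hE' : A * E' - E' * Δ = E * B' - B * E - (k : ℂ) • E) :
    (P⁻¹ * E).IsDiag ∧ ∀ i, (k : ℂ) * (P⁻¹ * E) i i = 0 := by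
  have e2 : P⁻¹ * A = Δ * P⁻¹ := by
    refine hu.mul_left_cancel ?_
    rw [← mul_assoc, ← mul_assoc, mat_mul_inv hu, one_mul, ← hAP, mul_assoc, mat_mul_inv hu, mul_one]
  have hdiag : (P⁻¹ * E).IsDiag := fun i j hij => by
    have h1 := congrArg (fun m => P⁻¹ * m) hE
    simp only [mul_sub, mul_zero] at h1
    rw [← mul_assoc, e2, mul_assoc, ← mul_assoc P⁻¹] at h1
    have h2 := congrFun (congrFun h1 i) j
    rw [IsDiag.comm_apply hΔ] at h2
    exact (mul_eq_zero.1 h2).resolve_left (sub_ne_zero.2 (hs i j hij))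
  refine ⟨hdiag, fun i => ?_⟩
  have h1 := congrArg (fun m => P⁻¹ * m) hE'
  simp only [mul_sub, mul_smul_comm] at h1
  have e3 : P⁻¹ * (B * E) = P⁻¹ * B * P * (P⁻¹ * E) := by
    rw [mul_assoc (P⁻¹ * B), ← mul_assoc P, mat_mul_inv hu, one_mul, mul_assoc]
  rw [← mul_assoc, e2, mul_assoc, ← mul_assoc P⁻¹ E', e3, ← mul_assoc P⁻¹ E B'] at h1
  have h2 := congrFun (congrFun h1 i) i
  rw [IsDiag.comm_apply hΔ, sub_self, zero_mul, Matrix.sub_apply, Matrix.sub_apply,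
    Matrix.smul_apply] at h2
  have e4 : (P⁻¹ * E * B') i i = (P⁻¹ * E) i i * (P⁻¹ * B * P) i i := by
    rw [← hN, IsDiag.mul_apply_right hB']
  have e5 : (P⁻¹ * B * P * (P⁻¹ * E)) i i = (P⁻¹ * B * P) i i * (P⁻¹ * E) i i := by
    rw [IsDiag.mul_apply_right hdiag]
  rw [e4, e5, smul_eq_mul] at h2
  linear_combination h2

end Defect

/-! ### Formal simplification at a simple spectrum. -/

section FormalGauge

variable {n : ℕ} {V : Type*} [NormedAddCommGroup V] [NormedSpace ℂ V]

/-- The recursion is the z-part of the gauge equation. Differentiating it shows that the defects of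
the parameter part satisfy the homogeneous recursion, and they vanish by induction: the previous
level makes P⁻¹Eₖ diagonal and the next one kills its diagonal. For k = 0 the diagonal is killed by
`hnorm` instead. -/
theorem isFormalGauge_formalSol {U : Set V} (hU : IsOpen U) {A P Δ : V → Mat n} {B B' : Mat n}
    {C : V → (V →ₗ[ℂ] Mat n)} (hA : AnalyticOnNhd ℂ A U) (hP : AnalyticOnNhd ℂ P U)
    (hΔ : AnalyticOnNhd ℂ Δ U)
    (hint : ∀ x ∈ U, ∀ v, A x * C x v = C x v * A x ∧
      fderiv ℂ A x v = C x v + C x v * B - B * C x v)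
    (hu : ∀ x ∈ U, IsUnit (P x)) (hdiag : ∀ x ∈ U, (Δ x).IsDiag)
    (hs : ∀ x ∈ U, ∀ i j, i ≠ j → Δ x i i ≠ Δ x j j) (hAP : ∀ x ∈ U, A x * P x = P x * Δ x)
    (hCP : ∀ x ∈ U, ∀ v, C x v * P x = P x * fderiv ℂ Δ x v)
    (hnorm : ∀ x ∈ U, ∀ v, ((P x)⁻¹ * fderiv ℂ P x v).diag = 0)
    (hB' : B'.IsDiag) (hN : ∀ x ∈ U, ∀ i, B' i i = ((P x)⁻¹ * B * P x) i i) :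
    (∀ k, AnalyticOnNhd ℂ (fun x => P x * formalSol (Δ x) ((P x)⁻¹ * B * P x) B' k) U) ∧
    IsFormalGauge U A B C (fun k x => P x * formalSol (Δ x) ((P x)⁻¹ * B * P x) B' k) Δ B' := by
  set Φ : ℕ → V → Mat n := fun k x => P x * formalSol (Δ x) ((P x)⁻¹ * B * P x) B' k with hΦ
  have hΦa : ∀ k, AnalyticOnNhd ℂ (Φ k) U := fun k x hx =>
    (hP x hx).mul (analyticAt_formalSol B' (hΔ x hx)
      (((analyticAt_matrix_inv (hP x hx) (hu x hx)).mul analyticAt_const).mul (hP x hx)) (hs x hx) k)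
  have hΦ0 : ∀ x, Φ 0 x = P x := fun x => mul_one _
  have hrec : ∀ x ∈ U, ∀ k : ℕ, A x * Φ (k + 1) x + B * Φ k x + (k : ℂ) • Φ k x =
      Φ (k + 1) x * Δ x + Φ k x * B' := fun x hx k => by
    have h1 := congrArg (fun m => P x * m)
      (formalSol_succ (hdiag x hx) (hs x hx) hB' (hN x hx) k)
    simp only [formalRhs, mul_sub, mul_smul_comm] at h1
    have h2 : B * P x = P x * ((P x)⁻¹ * B * P x) := by
      rw [← mul_assoc, ← mul_assoc, mat_mul_inv (hu x hx), one_mul]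
    simp only [hΦ]
    rw [← mul_assoc, ← mul_assoc, hAP x hx, h2]
    rw [← sub_eq_zero] at h1 ⊢
    rw [← h1]
    simp only [mul_assoc]
    abel
  have hzero : ∀ x ∈ U, ∀ v, ∀ k : ℕ,
      fderiv ℂ (Φ k) x v - C x v * Φ (k + 1) x + Φ (k + 1) x * fderiv ℂ Δ x v = 0 := by
    intro x hx v
    have hxU := hU.mem_nhds hx
    have hdΔ : (fderiv ℂ Δ x v).IsDiag :=
      isDiag_fderiv (hΔ x hx).differentiableAt (Filter.mem_of_superset hxU hdiag) v
    have hΔc := IsDiag.commute (hdiag x hx) hdΔ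
    have hB'c := IsDiag.commute hB' hdΔ
    have hd : ∀ k, DifferentiableAt ℂ (Φ k) x := fun k => (hΦa k x hx).differentiableAt
    have hdA := (hA x hx).differentiableAt
    have hdΔ' := (hΔ x hx).differentiableAt
    have hrec' : ∀ k : ℕ, (A x * fderiv ℂ (Φ (k + 1)) x v + fderiv ℂ A x v * Φ (k + 1) x) +
        B * fderiv ℂ (Φ k) x v + (k : ℂ) • fderiv ℂ (Φ k) x v =
        (Φ (k + 1) x * fderiv ℂ Δ x v + fderiv ℂ (Φ (k + 1)) x v * Δ x) +
          fderiv ℂ (Φ k) x v * B' := fun k => by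
      have h1 : (fun y => A y * Φ (k + 1) y + B * Φ k y + (k : ℂ) • Φ k y) =ᶠ[𝓝 x]
          fun y => Φ (k + 1) y * Δ y + Φ k y * B' :=
        Filter.mem_of_superset hxU fun y hy => hrec y hy k
      have h2 := congrArg (fun L : V →L[ℂ] Mat n => L v) h1.fderiv_eq
      have h3 := hdA.fun_mul (hd (k + 1))
      have h4 := (differentiableAt_const (x := x) (𝕜 := ℂ) B).fun_mul (hd k)
      rw [fderiv_fun_add (h3.fun_add h4) ((hd k).fun_const_smul _), fderiv_fun_add h3 h4,
        fderiv_fun_const_smul (hd k), fderiv_fun_add ((hd (k + 1)).fun_mul hdΔ')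
          ((hd k).fun_mul (differentiableAt_const _))] at h2
      simp only [add_apply, smul_apply] at h2
      rw [fderiv_mul_apply hdA (hd (k + 1)), fderiv_mul_apply (differentiableAt_const _) (hd k),
        fderiv_mul_apply (hd (k + 1)) hdΔ', fderiv_mul_apply (hd k) (differentiableAt_const _)] at h2
      simpa using h2
    have hbase : A x * fderiv ℂ (Φ 0) x v + fderiv ℂ A x v * Φ 0 x =
        Φ 0 x * fderiv ℂ Δ x v + fderiv ℂ (Φ 0) x v * Δ x := by
      have h1 : (fun y => A y * Φ 0 y) =ᶠ[𝓝 x] fun y => Φ 0 y * Δ y :=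
        Filter.mem_of_superset hxU fun y hy => by
          change A y * Φ 0 y = Φ 0 y * Δ y
          rw [hΦ0]; exact hAP y hy
      have h2 := congrArg (fun L : V →L[ℂ] Mat n => L v) h1.fderiv_eq
      rwa [fderiv_mul_apply hdA (hd 0), fderiv_mul_apply (hd 0) hdΔ'] at h2
    let E : ℕ → Mat n := fun k =>
      fderiv ℂ (Φ k) x v - C x v * Φ (k + 1) x + Φ (k + 1) x * fderiv ℂ Δ x v
    have hE0 : A x * E 0 - E 0 * Δ x = 0 :=
      defect_recursion_zero (by simpa using hrec x hx 0) hbase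
        (by rw [hΦ0]; exact hCP x hx v) (hint x hx v).2 (hint x hx v).1 hΔc hB'c
    have hEs : ∀ k : ℕ, A x * E (k + 1) - E (k + 1) * Δ x =
        E k * B' - B * E k - (k : ℂ) • E k := fun k =>
      defect_recursion (by simpa using hrec x hx (k + 1)) (hrec' k)
        (hint x hx v).2 (hint x hx v).1 hΔc hB'c
    have hfin : ∀ k, (∀ i, ((P x)⁻¹ * E k) i i = 0) → ((P x)⁻¹ * E k).IsDiag → E k = 0 :=
      fun k h1 h2 => by
        have h3 : (P x)⁻¹ * E k = 0 := by
          ext i j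
          by_cases hij : i = j
          · subst hij; exact h1 i
          · exact h2 hij
        have h4 := congrArg (fun m => P x * m) h3
        simpa [← mul_assoc, mat_mul_inv (hu x hx)] using h4
    have hall : ∀ k, E k = 0 := fun k => by
      induction k with
      | zero =>
        refine hfin 0 (fun i => ?_) (eq_zero_of_homogeneous (hu x hx) (hdiag x hx) (hs x hx)
          (hAP x hx) hB' (hN x hx) hE0 (hEs 0)).1
        have h1 : (P x)⁻¹ * C x v = fderiv ℂ Δ x v * (P x)⁻¹ := by
          refine (hu x hx).mul_left_cancel ?_
          rw [← mul_assoc, ← mul_assoc, mat_mul_inv (hu x hx), one_mul, ← hCP x hx, mul_assoc,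
            mat_mul_inv (hu x hx), mul_one]
        -- Apart from P⁻¹dP, the defect of level 0 is a bracket with dΔ and has zero diagonal.
        have h2 : (P x)⁻¹ * E 0 = (P x)⁻¹ * fderiv ℂ P x v -
            (fderiv ℂ Δ x v * ((P x)⁻¹ * Φ 1 x) - (P x)⁻¹ * Φ 1 x * fderiv ℂ Δ x v) := by
          simp only [E, show Φ 0 = P from funext hΦ0]
          rw [mul_add, mul_sub, ← mul_assoc _ (C x v), h1]
          simp only [mul_assoc]
          abel
        rw [h2, Matrix.sub_apply, IsDiag.comm_apply hdΔ, sub_self, zero_mul, sub_zero]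
        exact congrFun (hnorm x hx v) i
      | succ k ih =>
        have h1 : A x * E (k + 1) - E (k + 1) * Δ x = 0 := by rw [hEs, ih]; simp
        obtain ⟨h2, h3⟩ := eq_zero_of_homogeneous (hu x hx) (hdiag x hx) (hs x hx)
          (hAP x hx) hB' (hN x hx) h1 (hEs (k + 1))
        exact hfin _ (fun i => (mul_eq_zero.1 (h3 i)).resolve_left
          (by exact_mod_cast k.succ_ne_zero)) h2
    exact hall
  refine ⟨hΦa, fun x hx => ⟨?_, fun k => ?_, fun v => ?_, fun k v => ?_⟩⟩
  · rw [hΦ0, hAP x hx]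
  · have h1 := hrec x hx k
    rw [← sub_eq_zero] at h1 ⊢
    rw [← neg_eq_zero, ← h1]
    abel
  · rw [hΦ0, hCP x hx]
  · rw [← sub_eq_zero, ← hzero x hx v k]
    abel

/-- With simple spectrum, every integrable deformation is formally simplifiable. -/
theorem classI_subset_classFs [FiniteDimensional ℂ V] {A₀ B₀ : Mat n} (hA₀ : A₀ ∈ Mreg n ∩ Mdiag n)
    (x₀ : V) : classI A₀ B₀ x₀ ⊆ classFs A₀ B₀ x₀ := by
  intro Ω hΩ
  obtain ⟨A, C, h⟩ := exists_isPoleAndDeformationPart hΩ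
  obtain ⟨Q, d, hQ, hd, hQA⟩ := exists_injective_diagonal hA₀.1 hA₀.2
  have hint := h.integrability hΩ
  obtain ⟨P, Δ, hP, hΔ, hframe⟩ := exists_normalized_frame h.analyticAt_pole hint hQ hd
    (by rw [h.pole_base]; exact hQA)
  obtain ⟨r, hr, hball⟩ := Metric.eventually_nhds_iff_ball.1
    (hint.and (hframe.and (h.analyticAt_pole.eventually_analyticAt.and
      (hP.eventually_analyticAt.and hΔ.eventually_analyticAt))))
  let U := Metric.ball x₀ r
  have hU : IsOpen U := Metric.isOpen_ball
  have hx₀ : x₀ ∈ U := Metric.mem_ball_self hr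
  let N : V → Mat n := fun x => (P x)⁻¹ * B₀ * P x
  have hNa : ∀ x ∈ U, AnalyticAt ℂ N x := fun x hx =>
    ((analyticAt_matrix_inv (hball x hx).2.2.2.1 (hball x hx).2.1.1).mul analyticAt_const).mul
      (hball x hx).2.2.2.1
  -- The derivative of N = P⁻¹B₀P is [N, P⁻¹dP]. Its i-th diagonal entry is a sum over j of Nᵢⱼωⱼᵢ -
  -- ωᵢⱼNⱼᵢ with ω = P⁻¹dP. Each term vanishes because (Δᵢ - Δⱼ)ωᵢⱼ = -d(Δᵢ - Δⱼ)Nᵢⱼ. So the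
  -- diagonal of N is constant, and its value at x₀ serves as B'.
  have hconst : ∀ x ∈ U, ∀ i, N x₀ i i = N x i i := fun x hx i => by
    refine hU.is_const_of_fderiv_eq_zero (𝕜 := ℂ) (f := fun y => N y i i)
      (convex_ball x₀ r).isPreconnected
      (fun y hy => (analyticAt_entry (hNa y hy) i i).differentiableAt.differentiableWithinAt)
      (fun y hy => ?_) hx₀ hx
    obtain ⟨-, ⟨hu, hdiag, hs, -, hfr⟩, -, hPy, hΔy⟩ := hball y hy
    ext v
    rw [fderiv_entry (hNa y hy).differentiableAt]
    obtain ⟨-, -, hrel⟩ := hfr v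
    have hPN : (fun z => P z * N z) =ᶠ[𝓝 y] fun z => B₀ * P z := by
      filter_upwards [eventually_isUnit hPy.continuousAt hu] with z hz
      simp only [N]
      rw [← mul_assoc, ← mul_assoc, mat_mul_inv hz, one_mul]
    have h2 := congrArg (fun L : V →L[ℂ] Mat n => L v) hPN.fderiv_eq
    rw [fderiv_mul_apply hPy.differentiableAt (hNa y hy).differentiableAt,
      fderiv_mul_apply (differentiableAt_const _) hPy.differentiableAt] at h2
    have hdN : fderiv ℂ N y v = N y * ((P y)⁻¹ * fderiv ℂ P y v) - (P y)⁻¹ * fderiv ℂ P y v * N y := by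
      refine hu.mul_left_cancel ?_
      have hPN' := hPN.self_of_nhds
      simp only [] at hPN'
      rw [mul_sub, ← mul_assoc (P y) (N y), hPN', ← mul_assoc (P y) (_ * _), ← mul_assoc (P y),
        mat_mul_inv hu, one_mul, mul_assoc B₀, ← mul_assoc (P y), mat_mul_inv hu, one_mul]
      rw [← sub_eq_zero] at h2 ⊢
      rw [← h2]
      simp
      abel
    rw [hdN, Matrix.sub_apply, Matrix.mul_apply, Matrix.mul_apply]
    have hdΔ : (fderiv ℂ Δ y v).IsDiag := isDiag_fderiv hΔy.differentiableAt
      (Filter.mem_of_superset (hU.mem_nhds hy) fun z hz => (hball z hz).2.1.2.1) v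
    have hrel' : ∀ i j, (Δ y i i - Δ y j j) * ((P y)⁻¹ * fderiv ℂ P y v) i j =
        -((fderiv ℂ Δ y v i i - fderiv ℂ Δ y v j j) * N y i j) := fun i j => by
      have h5 := congrFun (congrFun hrel i) j
      rw [← neg_sub (fderiv ℂ Δ y v * _), Matrix.neg_apply, IsDiag.comm_apply hdiag,
        IsDiag.comm_apply hdΔ] at h5
      exact h5
    refine sub_eq_zero.2 (Finset.sum_congr rfl fun j _ => ?_)
    by_cases hij : i = j
    · subst hij
      exact mul_comm _ _
    · refine mul_left_cancel₀ (sub_ne_zero.2 (hs i j hij)) ?_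
      linear_combination -(N y i j) * hrel' j i - N y j i * hrel' i j
  obtain ⟨hΦa, hΦ⟩ := isFormalGauge_formalSol hU (fun x hx => (hball x hx).2.2.1)
    (fun x hx => (hball x hx).2.2.2.1)
    (fun x hx => (hball x hx).2.2.2.2) (fun x hx => (hball x hx).1) (fun x hx => (hball x hx).2.1.1)
    (fun x hx => (hball x hx).2.1.2.1) (fun x hx => (hball x hx).2.1.2.2.1)
    (fun x hx => (hball x hx).2.1.2.2.2.1) (fun x hx v => ((hball x hx).2.1.2.2.2.2 v).1)
    (fun x hx v => ((hball x hx).2.1.2.2.2.2 v).2.1) (Matrix.isDiag_diagonal (N x₀).diag)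
    (fun x hx i => by rw [Matrix.diagonal_apply_eq]; exact hconst x hx i)
  exact ⟨hΩ, A, C, h, U, hU, hx₀, _, Δ, _, hΦa, fun x hx => by simpa [formalSol] using (hball x hx).2.1.1,
    fun x hx => (hball x hx).2.2.2.2, fun x hx => (hball x hx).2.1.2.1, Matrix.isDiag_diagonal _, hΦ⟩

end FormalGauge

/-! ### Gauge by a frame independent of z, and division by a submersion. -/

section Vanishing

variable {n : ℕ} {V : Type*} [NormedAddCommGroup V] [NormedSpace ℂ V]

theorem inv_mul_comm_of_conj {A P D : Mat n} (hu : IsUnit P) (h : A * P = P * D) : P⁻¹ * A = D * P⁻¹ := by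
  refine hu.mul_left_cancel ?_
  rw [← mul_assoc, ← mul_assoc, mat_mul_inv hu, one_mul, ← h, mul_assoc, mat_mul_inv hu, mul_one]

theorem conj_eq {A P D : Mat n} (hu : IsUnit P) (h : A * P = P * D) : P⁻¹ * A * P = D := by
  rw [mul_assoc, h, ← mul_assoc, mat_inv_mul hu, one_mul]

theorem conj_eq_iff {A P D : Mat n} (hu : IsUnit P) : P⁻¹ * A * P = D ↔ A * P = P * D :=
  ⟨fun h => by rw [← h, ← mul_assoc, ← mul_assoc, mat_mul_inv hu, one_mul], conj_eq hu⟩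

theorem isProjectiveFrame_snd {U : Set V} {P : V → Mat n} (hP : AnalyticOnNhd ℂ P U)
    (hu : ∀ x ∈ U, IsUnit (P x)) : IsProjectiveFrame U fun p : ℂ × V => P p.2 := by
  have h : AnalyticOnNhd ℂ (fun p : ℂ × V => P p.2) (Set.univ ×ˢ U) := fun p hp =>
    AnalyticAt.comp (g := P) (f := fun p : ℂ × V => p.2) (hP p.2 hp.2) analyticAt_snd
  exact ⟨⟨h, fun p hp => hu _ hp⟩, fun p => P p.2, ⟨h, fun p hp => hu _ hp⟩, fun p _ _ => rfl⟩

/-- The matrix of a connection in Birkhoff normal form in a frame of eigenvectors that does not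
depend on `z`. -/
theorem gauge_birkhoffForm_snd {A P Δ : V → Mat n} {B : Mat n} {C : V → (V →ₗ[ℂ] Mat n)} {p : ℂ × V}
    (hP : DifferentiableAt ℂ P p.2) (hu : IsUnit (P p.2)) (hAP : A p.2 * P p.2 = P p.2 * Δ p.2)
    (hCP : ∀ v, C p.2 v * P p.2 = P p.2 * fderiv ℂ Δ p.2 v) (v : ℂ × V) :
    gauge (fun p => P p.2) (birkhoffForm A B C) p v =
      dzdx (-(Δ p.2 + p.1⁻¹ • ((P p.2)⁻¹ * B * P p.2)))
        (-(p.1 • (fderiv ℂ Δ p.2).toLinearMap) + (matLogDeriv P p.2).toLinearMap) v := by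
  have hd : fderiv ℂ (fun q : ℂ × V => P q.2) p v = fderiv ℂ P p.2 v.2 := by
    have h1 : HasFDerivAt (fun q : ℂ × V => P q.2) _ p :=
      hP.hasFDerivAt.comp p (hasFDerivAt_snd (𝕜 := ℂ) (E := ℂ) (F := V))
    rw [h1.fderiv]
    rfl
  rw [gauge_eq_iff hu, hd, birkhoffForm_apply, dzdx_apply]
  have e1 : P p.2 * ((P p.2)⁻¹ * B * P p.2) = B * P p.2 := by
    rw [← mul_assoc, ← mul_assoc, mat_mul_inv hu, one_mul]
  have e2 : (-(p.1 • (fderiv ℂ Δ p.2).toLinearMap) + (matLogDeriv P p.2).toLinearMap) v.2 =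
      -(p.1 • fderiv ℂ Δ p.2 v.2) + (P p.2)⁻¹ * fderiv ℂ P p.2 v.2 := rfl
  rw [e2]
  simp only [add_mul, mul_add, neg_mul, mul_neg, smul_mul_assoc, mul_smul_comm, hAP, hCP, e1, smul_neg,
    smul_add]
  rw [← mul_assoc (P p.2) (P p.2)⁻¹, mat_mul_inv hu, one_mul]
  abel

theorem offDiag_eq_comm {M L D : Mat n} (hD : D.IsDiag)
    (h : ∀ i j, i ≠ j → M i j = (D i i - D j j) * L i j) : offDiag M = D * L - L * D := by
  ext i j
  rw [offDiag_apply, IsDiag.comm_apply hD]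
  split_ifs with hij
  · subst hij; simp
  · exact h i j hij

/-- A continuous function that vanishes off the zeros of a submersion vanishes. -/
theorem eq_zero_of_mul_eq_zero {t g : V → ℂ} {x v : V} (ht : fderiv ℂ t x v ≠ 0)
    (hg : ContinuousAt g x) (h : ∀ᶠ y in 𝓝 x, t y * g y = 0) : g x = 0 := by
  -- If g(x) were nonzero, t would vanish identically near x and its differential with it.
  by_contra hne
  have h1 : t =ᶠ[𝓝 x] fun _ => 0 := by
    filter_upwards [h, hg.eventually_ne hne] with y h1 h2
    exact (mul_eq_zero.1 h1).resolve_right h2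
  rw [h1.fderiv_eq] at ht
  simp at ht

end Vanishing

/-! ### Inclusions between the classes. -/

section Inclusions

variable {n : ℕ} {V : Type*} [NormedAddCommGroup V] [NormedSpace ℂ V]

/-- The leading coefficient Φ₀ is independent of z, hence a frame over all of ℙ¹. The gauge
equations one order lower express the matrices 𝓑 and ϖ of that frame by brackets with Φ₀⁻¹Φ₁, whose
off-diagonal part is taken as L. -/
theorem classFs_subset_classDv (A₀ B₀ : Mat n) (x₀ : V) :
    classFs A₀ B₀ x₀ ⊆ classDv A₀ B₀ x₀ := by
  rintro Ω ⟨hΩ, A, C, h, U, hU, hx₀, Φ, Δ, B', hΦ, hu, hΔ, hdiag, hB', hform⟩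
  have hUx := hU.mem_nhds hx₀
  have hAP : ∀ x ∈ U, A x * Φ 0 x = Φ 0 x * Δ x := fun x hx => neg_injective (hform x hx).1
  have hCP : ∀ x ∈ U, ∀ v, C x v * Φ 0 x = Φ 0 x * fderiv ℂ Δ x v := fun x hx v =>
    neg_injective ((hform x hx).2.2.1 v)
  have hdΔ : ∀ x ∈ U, ∀ v, (fderiv ℂ Δ x v).IsDiag := fun x hx v =>
    isDiag_fderiv (hΔ x hx).differentiableAt (Filter.mem_of_superset (hU.mem_nhds hx) hdiag) v
  have hinv : AnalyticOnNhd ℂ (fun x => (Φ 0 x)⁻¹) U := fun x hx =>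
    analyticAt_matrix_inv (hΦ 0 x hx) (hu x hx)
  refine ⟨hΩ, A, C, h, ⟨Δ, Φ 0, hΦ 0 _ hx₀, hu _ hx₀, hΔ _ hx₀, ?_⟩,
    ⟨Φ 0, hΦ 0 _ hx₀, hu _ hx₀, ?_⟩, U, hU, hx₀, fun p => Φ 0 p.2,
    isProjectiveFrame_snd (hΦ 0) hu, Δ, fun x => (Φ 0 x)⁻¹ * B₀ * Φ 0 x,
    fun x => offDiag ((Φ 0 x)⁻¹ * Φ 1 x), fun x => (matLogDeriv (Φ 0) x).toLinearMap, hΔ, ?_, ?_, ?_,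
    ?_, fun x hx => ⟨hdiag x hx, diag_offDiag _, ?_, fun v => ?_⟩⟩
  · filter_upwards [hUx] with x hx
    exact ⟨hdiag x hx, conj_eq (hu x hx) (hAP x hx)⟩
  · filter_upwards [hUx] with x hx v
    rw [conj_eq (hu x hx) (hCP x hx v)]
    exact hdΔ x hx v
  · exact fun x hx => ((hinv x hx).mul analyticAt_const).mul (hΦ 0 x hx)
  · exact fun x hx => analyticAt_offDiag ((hinv x hx).mul (hΦ 1 x hx))
  · exact fun v x hx => (analyticAt_matLogDeriv (hΦ 0 x hx) (hu x hx)).clm_apply_analyticAt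
      analyticAt_const
  · exact fun p hp _ v => gauge_birkhoffForm_snd (hΦ 0 _ hp).differentiableAt (hu _ hp) (hAP _ hp)
      (hCP _ hp) v
  -- The coefficient of dz/z, multiplied by Φ₀⁻¹; the diagonal matrix B' does not contribute off the
  -- diagonal. The sign of 𝓑 is reversed because `offDiag_eq_comm` produces [Δ, L] while [L, Δ] is
  -- wanted.
  · have h1 := congrArg (fun m => (Φ 0 x)⁻¹ * m) ((hform x hx).2.1 0)
    simp only [Nat.cast_zero, zero_smul, sub_zero, mul_sub, mul_neg, zero_add, ← mul_assoc] at h1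
    rw [inv_mul_comm_of_conj (hu x hx) (hAP x hx), mat_inv_mul (hu x hx), one_mul, mul_assoc (Δ x)] at h1
    rw [← neg_sub, ← offDiag_eq_comm (M := -((Φ 0 x)⁻¹ * B₀ * Φ 0 x)) (hdiag x hx) fun i j hij => ?_]
    · ext i j
      simp only [offDiag_apply, Matrix.neg_apply]
      split_ifs <;> simp
    · change _ = _ * offDiag ((Φ 0 x)⁻¹ * Φ 1 x) i j
      rw [offDiag_apply, if_neg hij, ← IsDiag.comm_apply (hdiag x hx)]
      have h2 : -((Φ 0 x)⁻¹ * B₀ * Φ 0 x) = Δ x * ((Φ 0 x)⁻¹ * Φ 1 x) - (Φ 0 x)⁻¹ * Φ 1 x * Δ x - B' := by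
        rw [← sub_eq_zero] at h1 ⊢
        rw [← h1]
        abel
      rw [h2, Matrix.sub_apply _ B', hB' hij, sub_zero]
  · refine offDiag_eq_comm (hdΔ x hx v) fun i j hij => ?_
    have h1 := congrArg (fun m => (Φ 0 x)⁻¹ * m) ((hform x hx).2.2.2 0 v)
    simp only [mul_add, mul_neg, zero_add, ← mul_assoc] at h1
    rw [inv_mul_comm_of_conj (hu x hx) (hCP x hx v), mul_assoc (fderiv ℂ Δ x v)] at h1
    have h2 : (matLogDeriv (Φ 0) x).toLinearMap v = fderiv ℂ Δ x v * ((Φ 0 x)⁻¹ * Φ 1 x) -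
        (Φ 0 x)⁻¹ * Φ 1 x * fderiv ℂ Δ x v := by
      change (Φ 0 x)⁻¹ * fderiv ℂ (Φ 0) x v = _
      rw [← sub_eq_zero] at h1 ⊢
      rw [← h1]
      abel
    change _ = _ * offDiag ((Φ 0 x)⁻¹ * Φ 1 x) i j
    rw [h2, offDiag_apply, if_neg hij, IsDiag.comm_apply (hdΔ x hx v)]

/-- Eigenvalues may coincide at x₀, so dividing by Δᵢ - Δⱼ is not allowed. But the differential of
this difference is nonzero near x₀, so a relation multiplied by it can still be cancelled by
continuity. This replaces the simple spectrum in showing that C is diagonal in the frame of A and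
that the entries of P⁻¹dP are multiples of d(Δᵢ - Δⱼ). -/
theorem classDgen_subset_classDv [FiniteDimensional ℂ V] (A₀ B₀ : Mat n) (x₀ : V) :
    classDgen A₀ B₀ x₀ ⊆ classDv A₀ B₀ x₀ := by
  rintro Ω ⟨hΩ, A, C, h, hAd, hCd, Δ, ⟨P, hP, hu₀, hΔ, hform⟩, hgen⟩
  have hv : ∀ i j, ∃ v : V, i ≠ j → fderiv ℂ Δ x₀ v i i - fderiv ℂ Δ x₀ v j j ≠ 0 := fun i j => by
    by_cases hij : i = j
    · exact ⟨0, fun h => (h hij).elim⟩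
    · obtain ⟨v, hv⟩ := DFunLike.ne_iff.1 (hgen i j hij)
      rw [fderiv_entry hΔ.differentiableAt, fderiv_entry hΔ.differentiableAt] at hv
      exact ⟨v, fun _ => sub_ne_zero.2 hv⟩
  choose v hv using hv
  -- The derivative of Δᵢ - Δⱼ in a fixed direction `v i j` that separates the two eigenvalues at
  -- x₀; it remains nonzero nearby and will be the denominator of L.
  let dt : Fin n → Fin n → V → ℂ := fun i j x =>
    fderiv ℂ Δ x (v i j) i i - fderiv ℂ Δ x (v i j) j j
  have hdta : ∀ {x}, AnalyticAt ℂ Δ x → ∀ i j u, AnalyticAt ℂ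
      (fun y => fderiv ℂ Δ y u i i - fderiv ℂ Δ y u j j) x := fun {x} hx i j u =>
    have h1 : AnalyticAt ℂ (fun y => fderiv ℂ Δ y u) x := hx.fderiv.clm_apply_analyticAt analyticAt_const
    (analyticAt_entry h1 i i).sub (analyticAt_entry h1 j j)
  have hdt : ∀ᶠ x in 𝓝 x₀, ∀ i j, i ≠ j → dt i j x ≠ 0 := by
    refine eventually_all.2 fun i => eventually_all.2 fun j => ?_
    by_cases hij : i = j
    · exact Eventually.of_forall fun x h => (h hij).elim
    · exact ((hdta hΔ i j _).continuousAt.eventually_ne (hv i j hij)).mono fun x hx _ => hx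
  obtain ⟨T, hT, hTC⟩ := exists_analyticAt_clm_linearMap h.analyticAt_def
  obtain ⟨r, hr, hball⟩ := Metric.eventually_nhds_iff_ball.1
    ((h.integrability hΩ).and (hform.and (hdt.and (h.analyticAt_pole.eventually_analyticAt.and
      (hP.eventually_analyticAt.and (hΔ.eventually_analyticAt.and (hT.eventually_analyticAt.and
      (eventually_isUnit hP.continuousAt hu₀))))))))
  let U := Metric.ball x₀ r
  have hU : IsOpen U := Metric.isOpen_ball
  have hx₀ : x₀ ∈ U := Metric.mem_ball_self hr
  have hPa : AnalyticOnNhd ℂ P U := fun x hx => (hball x hx).2.2.2.2.1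
  have hΔa : AnalyticOnNhd ℂ Δ U := fun x hx => (hball x hx).2.2.2.2.2.1
  have hu : ∀ x ∈ U, IsUnit (P x) := fun x hx => (hball x hx).2.2.2.2.2.2.2
  have hdiag : ∀ x ∈ U, (Δ x).IsDiag := fun x hx => (hball x hx).2.1.1
  have hdt' : ∀ x ∈ U, ∀ i j, i ≠ j → dt i j x ≠ 0 := fun x hx => (hball x hx).2.2.1
  have hAP : ∀ x ∈ U, A x * P x = P x * Δ x := fun x hx => (conj_eq_iff (hu x hx)).1 (hball x hx).2.1.2
  have hdΔ : ∀ x ∈ U, ∀ v, (fderiv ℂ Δ x v).IsDiag := fun x hx v =>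
    isDiag_fderiv (hΔa x hx).differentiableAt (Filter.mem_of_superset (hU.mem_nhds hx) hdiag) v
  have hvanish : ∀ i j, i ≠ j → ∀ g : V → ℂ, (∀ x ∈ U, ContinuousAt g x) →
      (∀ x ∈ U, (Δ x i i - Δ x j j) * g x = 0) → ∀ x ∈ U, g x = 0 := fun i j hij g hg hz x hx => by
    refine eq_zero_of_mul_eq_zero (t := fun y => Δ y i i - Δ y j j) (v := v i j) ?_ (hg x hx)
      (Filter.mem_of_superset (hU.mem_nhds hx) hz)
    have hd := fun i => (analyticAt_entry (hΔa x hx) i i).differentiableAt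
    rw [fderiv_fun_sub (hd i) (hd j), sub_apply, fderiv_entry (hΔa x hx).differentiableAt,
      fderiv_entry (hΔa x hx).differentiableAt]
    exact hdt' x hx i j hij
  have hinv : AnalyticOnNhd ℂ (fun x => (P x)⁻¹) U := fun x hx =>
    analyticAt_matrix_inv (hPa x hx) (hu x hx)
  -- As C commutes with A, the (i, j) entry of P⁻¹CP is annihilated by Δᵢ - Δⱼ, hence zero: the
  -- frame that diagonalizes A also diagonalizes C.
  have hCdiag : ∀ x ∈ U, ∀ u, ((P x)⁻¹ * C x u * P x).IsDiag := fun x hx u i j hij => by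
    have hCa : ∀ y ∈ U, AnalyticAt ℂ (fun y => (P y)⁻¹ * C y u * P y) y := fun y hy => by
      simp only [← hTC]
      exact ((hinv y hy).mul ((hball y hy).2.2.2.2.2.2.1.clm_apply_analyticAt analyticAt_const)).mul
        (hPa y hy)
    refine hvanish i j hij (fun y => ((P y)⁻¹ * C y u * P y) i j)
      (fun y hy => (analyticAt_entry (hCa y hy) i j).continuousAt) (fun y hy => ?_) x hx
    rw [← IsDiag.comm_apply (hdiag y hy), ← mul_assoc, ← mul_assoc,
      ← inv_mul_comm_of_conj (hu y hy) (hAP y hy), mul_assoc _ (P y), ← hAP y hy,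
      mul_assoc (P y)⁻¹ (A y), ((hball y hy).1 u).1]
    simp [mul_assoc]
  have hframe : ∀ x ∈ U, ∀ u, C x u * P x = P x * fderiv ℂ Δ x u ∧
      Δ x * ((P x)⁻¹ * fderiv ℂ P x u) - (P x)⁻¹ * fderiv ℂ P x u * Δ x =
        (P x)⁻¹ * B₀ * P x * fderiv ℂ Δ x u - fderiv ℂ Δ x u * ((P x)⁻¹ * B₀ * P x) := fun x hx u =>
    deformation_part_diagonal_frame (hball x hx).2.2.2.1.differentiableAt.hasFDerivAt rfl
      (hPa x hx).differentiableAt (hu x hx) (hΔa x hx).differentiableAt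
      (Filter.mem_of_superset (hU.mem_nhds hx) fun y hy => ⟨hdiag y hy, hAP y hy⟩) (hCdiag x hx u)
      ((hball x hx).1 u).2
  have hrel : ∀ x ∈ U, ∀ i j u, (Δ x i i - Δ x j j) * matLogDeriv P x u i j =
      -((fderiv ℂ Δ x u i i - fderiv ℂ Δ x u j j) * ((P x)⁻¹ * B₀ * P x) i j) := fun x hx i j u => by
    have h5 := congrFun (congrFun (hframe x hx u).2 i) j
    rw [← neg_sub (fderiv ℂ Δ x u * _), Matrix.neg_apply, IsDiag.comm_apply (hdiag x hx),
      IsDiag.comm_apply (hdΔ x hx u)] at h5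
    exact h5
  have hla : ∀ x ∈ U, AnalyticAt ℂ (matLogDeriv P) x := fun x hx =>
    analyticAt_matLogDeriv (hPa x hx) (hu x hx)
  have hlae : ∀ x ∈ U, ∀ u i j, AnalyticAt ℂ (fun y => matLogDeriv P y u i j) x := fun x hx u i j =>
    analyticAt_entry (F := fun y => matLogDeriv P y u)
      ((hla x hx).clm_apply_analyticAt analyticAt_const) i j
  -- Eliminating (P⁻¹B₀P)ᵢⱼ between the directions u and `v i j` leaves a multiple of Δᵢ - Δⱼ, and
  -- this factor is cancelled. The (i, j) entry of P⁻¹dP is thus a holomorphic multiple of d(Δᵢ -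
  -- Δⱼ), and the multiple is Lᵢⱼ.
  have hprop : ∀ i j, i ≠ j → ∀ u, ∀ x ∈ U, matLogDeriv P x u i j * dt i j x -
      (fderiv ℂ Δ x u i i - fderiv ℂ Δ x u j j) * matLogDeriv P x (v i j) i j = 0 := fun i j hij u =>
    hvanish i j hij _ (fun x hx => (((hlae x hx u i j).mul (hdta (hΔa x hx) i j _)).sub
      ((hdta (hΔa x hx) i j _).mul (hlae x hx _ i j))).continuousAt) fun x hx => by
        have e1 := hrel x hx i j u
        have e2 := hrel x hx i j (v i j)
        simp only [dt]
        linear_combination (fderiv ℂ Δ x (v i j) i i - fderiv ℂ Δ x (v i j) j j) * e1 -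
          (fderiv ℂ Δ x u i i - fderiv ℂ Δ x u j j) * e2
  let L : V → Mat n := fun x => Matrix.of fun i j =>
    if i = j then 0 else matLogDeriv P x (v i j) i j / dt i j x
  have hL : ∀ x i j, i ≠ j → L x i j = matLogDeriv P x (v i j) i j / dt i j x := fun x i j hij => by
    simp [L, hij]
  refine ⟨hΩ, A, C, h, hAd, hCd, U, hU, hx₀, fun p => P p.2, isProjectiveFrame_snd hPa hu, Δ,
    fun x => (P x)⁻¹ * B₀ * P x, L, fun x => (matLogDeriv P x).toLinearMap, hΔa, ?_, ?_, ?_, ?_,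
    fun x hx => ⟨hdiag x hx, ?_, ?_, fun u => ?_⟩⟩
  · exact fun x hx => ((hinv x hx).mul analyticAt_const).mul (hPa x hx)
  · intro x hx
    refine analyticAt_of_entries fun i j => ?_
    by_cases hij : i = j
    · simpa [L, hij] using analyticAt_const
    · simp only [hL _ _ _ hij]
      exact (hlae x hx _ i j).div (hdta (hΔa x hx) i j _) (hdt' x hx i j hij)
  · exact fun u x hx => (hla x hx).clm_apply_analyticAt analyticAt_const
  · exact fun p hp _ u => gauge_birkhoffForm_snd (hPa _ hp).differentiableAt (hu _ hp) (hAP _ hp)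
      (fun u => (hframe _ hp u).1) u
  · funext i
    simp [L]
  · rw [← neg_sub, ← offDiag_eq_comm (M := -((P x)⁻¹ * B₀ * P x)) (hdiag x hx) fun i j hij => ?_]
    · ext i j
      simp only [offDiag_apply, Matrix.neg_apply]
      split_ifs <;> simp
    · have e2 := hrel x hx i j (v i j)
      rw [hL _ _ _ hij, Matrix.neg_apply, mul_div_assoc', e2, eq_div_iff (hdt' x hx i j hij)]
      simp only [dt]
      ring
  · refine offDiag_eq_comm (hdΔ x hx u) fun i j hij => ?_
    rw [hL _ _ _ hij, mul_div_assoc', eq_div_iff (hdt' x hx i j hij)]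
    exact sub_eq_zero.1 (hprop i j hij u x hx)

theorem classDv_subset_classD (A₀ B₀ : Mat n) (x₀ : V) : classDv A₀ B₀ x₀ ⊆ classD A₀ B₀ x₀ := by
  rintro Ω ⟨hΩ, A, C, h, hA, hC, -⟩
  exact ⟨hΩ, A, C, h, hA, hC⟩

theorem classD_subset_classI (A₀ B₀ : Mat n) (x₀ : V) : classD A₀ B₀ x₀ ⊆ classI A₀ B₀ x₀ :=
  fun _ h => h.1

end Inclusions

/-! ### Base change. -/

section BaseChange

variable {n : ℕ} {V V' : Type*} [NormedAddCommGroup V'] [NormedSpace ℂ V']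
  [NormedAddCommGroup V] [NormedSpace ℂ V]

/-- The map `(z, x) ↦ (z, φ x)`. -/
def prodMapSnd (φ : V → V') (p : ℂ × V) : ℂ × V' := (p.1, φ p.2)

theorem tendsto_prodMapSnd {φ : V → V'} {x₀ : V} (hφ : ContinuousAt φ x₀) :
    Tendsto (prodMapSnd φ) (nearInfinity x₀) (nearInfinity (φ x₀)) :=
  (tendsto_id.prodMap hφ : Tendsto (Prod.map id φ) _ _)

theorem analyticAt_prodMapSnd {φ : V → V'} {p : ℂ × V} (hφ : AnalyticAt ℂ φ p.2) :
    AnalyticAt ℂ (prodMapSnd φ) p :=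
  analyticAt_fst.prod (AnalyticAt.comp (g := φ) (f := fun p : ℂ × V => p.2) hφ analyticAt_snd)

theorem fderiv_prodMapSnd {φ : V → V'} {p : ℂ × V} (hφ : DifferentiableAt ℂ φ p.2) (v : ℂ × V) :
    fderiv ℂ (prodMapSnd φ) p v = (v.1, fderiv ℂ φ p.2 v.2) := by
  have h : HasFDerivAt (prodMapSnd φ) _ p := (hasFDerivAt_fst (𝕜 := ℂ) (E := ℂ) (F := V)).prodMk
    (hφ.hasFDerivAt.comp p (hasFDerivAt_snd (𝕜 := ℂ) (E := ℂ) (F := V)))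
  rw [h.fderiv]
  rfl

theorem baseChange_apply (φ : V → V') (Ω : ConnForm n V') (p v : ℂ × V) :
    baseChange φ Ω p v = Ω (prodMapSnd φ p) (v.1, fderiv ℂ φ p.2 v.2) := rfl

/-- The pull-back of a form `C` on `V'` by `φ`. -/
def pullbackForm (φ : V → V') (C : V' → (V' →ₗ[ℂ] Mat n)) (x : V) : V →ₗ[ℂ] Mat n :=
  C (φ x) ∘ₗ (fderiv ℂ φ x).toLinearMap

theorem pullbackForm_apply (φ : V → V') (C : V' → (V' →ₗ[ℂ] Mat n)) (x v : V) :
    pullbackForm φ C x v = C (φ x) (fderiv ℂ φ x v) := rfl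

theorem analyticAt_pullbackForm [FiniteDimensional ℂ V'] {φ : V → V'} {C : V' → (V' →ₗ[ℂ] Mat n)}
    {x : V} (hφ : AnalyticAt ℂ φ x) (hC : ∀ v, AnalyticAt ℂ (fun y => C y v) (φ x)) (v : V) :
    AnalyticAt ℂ (fun y => pullbackForm φ C y v) x := by
  obtain ⟨T, hT, hTC⟩ := exists_analyticAt_clm_linearMap hC
  simp only [pullbackForm_apply, ← hTC]
  exact (AnalyticAt.comp (g := T) hT hφ).clm_apply_analyticAt
    (hφ.fderiv.clm_apply_analyticAt analyticAt_const)

theorem HasPoleOrderTwo.baseChange [FiniteDimensional ℂ V'] {φ : V → V'} {x₀ : V}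
    {Ω : ConnForm n V'} (hφ : AnalyticAt ℂ φ x₀) (h : HasPoleOrderTwo (φ x₀) Ω) :
    HasPoleOrderTwo x₀ (baseChange φ Ω) := by
  obtain ⟨a, c, ha, hc, hΩ⟩ := h
  have hψ : AnalyticAt ℂ (prodMapSnd φ) (0, x₀) := analyticAt_prodMapSnd hφ
  refine ⟨fun p => a (prodMapSnd φ p),
    fun p => c (prodMapSnd φ p) ∘ₗ (fderiv ℂ φ p.2).toLinearMap,
    AnalyticAt.comp (g := a) ha hψ, fun v => ?_, ?_⟩
  · obtain ⟨T, hT, hTc⟩ := exists_analyticAt_clm_linearMap hc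
    have h1 : (fun p : ℂ × V => (c (prodMapSnd φ p) ∘ₗ (fderiv ℂ φ p.2).toLinearMap) v) =
        fun p => T (prodMapSnd φ p) (fderiv ℂ φ p.2 v) := by
      funext p
      rw [hTc]
      rfl
    rw [h1]
    refine (AnalyticAt.comp (g := T) (f := prodMapSnd φ) (x := (0, x₀)) hT hψ).clm_apply_analyticAt ?_
    exact (AnalyticAt.comp (g := fderiv ℂ φ) (f := fun p : ℂ × V => p.2) hφ.fderiv
      analyticAt_snd).clm_apply_analyticAt analyticAt_const
  · filter_upwards [(tendsto_prodMapSnd hφ.continuousAt).eventually hΩ] with p hp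
    refine LinearMap.ext fun v => ?_
    rw [baseChange_apply, hp]
    rfl

/-- Differentiating the pulled-back form produces the second derivative of the map, which is
symmetric and drops out. What is left is the flatness identity at the image point on the image
vectors. -/
theorem IsFlat.baseChange [FiniteDimensional ℂ V'] {φ : V → V'} {x₀ : V}
    {Ω : ConnForm n V'} (hφ : AnalyticAt ℂ φ x₀) (hpole : HasPoleOrderTwo (φ x₀) Ω)
    (h : IsFlat (φ x₀) Ω) : IsFlat x₀ (baseChange φ Ω) := by
  have ht := tendsto_prodMapSnd hφ.continuousAt
  filter_upwards [ht.eventually h, ht.eventually hpole.analyticAt,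
    eventually_nearInfinity_nhds (eventually_nearInfinity_of_nhds_snd hφ.eventually_analyticAt)]
    with p h1 h2 h3 u v
  obtain ⟨T, hT, hTΩ⟩ := exists_analyticAt_clm_linearMap h2
  have hψ : AnalyticAt ℂ (prodMapSnd φ) p := analyticAt_prodMapSnd h3.self_of_nhds
  have happ : ∀ v, (fun q => RHB.baseChange φ Ω q v) =ᶠ[𝓝 p]
      fun q => T (prodMapSnd φ q) (fderiv ℂ (prodMapSnd φ) q v) := fun v => by
    filter_upwards [h3] with q hq
    rw [baseChange_apply, hTΩ, fderiv_prodMapSnd hq.differentiableAt]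
  have hcomp : DifferentiableAt ℂ (fun q => T (prodMapSnd φ q)) p :=
    (AnalyticAt.comp (g := T) hT hψ).differentiableAt
  have hdcomp : fderiv ℂ (fun q => T (prodMapSnd φ q)) p =
      (fderiv ℂ T (prodMapSnd φ p)).comp (fderiv ℂ (prodMapSnd φ) p) :=
    fderiv_comp (g := T) p hT.differentiableAt hψ.differentiableAt
  have hd : ∀ u v, fderiv ℂ (fun q => RHB.baseChange φ Ω q v) p u =
      fderiv ℂ T (prodMapSnd φ p) (fderiv ℂ (prodMapSnd φ) p u) (fderiv ℂ (prodMapSnd φ) p v) +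
        T (prodMapSnd φ p) (fderiv ℂ (fderiv ℂ (prodMapSnd φ)) p u v) := fun u v => by
    rw [(happ v).fderiv_eq, fderiv_clm_apply hcomp
      (hψ.fderiv.differentiableAt.clm_apply (differentiableAt_const v)), hdcomp, add_apply,
      ContinuousLinearMap.comp_apply, fderiv_clm_apply_const hψ.fderiv.differentiableAt, add_comm]
    rfl
  have hdT : ∀ u v, fderiv ℂ (fun q => Ω q v) (prodMapSnd φ p) u =
      fderiv ℂ T (prodMapSnd φ p) u v := fun u v => by
    simp only [← hTΩ]
    exact fderiv_clm_apply_const hT.differentiableAt v u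
  have h4 := h1 (fderiv ℂ (prodMapSnd φ) p u) (fderiv ℂ (prodMapSnd φ) p v)
  rw [hdT, hdT] at h4
  rw [hd, hd, fderiv_fderiv_comm hψ, add_sub_add_right_eq_sub, baseChange_apply, baseChange_apply,
    ← fderiv_prodMapSnd h3.self_of_nhds.differentiableAt,
    ← fderiv_prodMapSnd h3.self_of_nhds.differentiableAt]
  exact h4

theorem baseChange_mem_classI [FiniteDimensional ℂ V'] {φ : V → V'} {x₀ : V} {A₀ B₀ : Mat n}
    {Ω : ConnForm n V'} (hφ : AnalyticAt ℂ φ x₀) (h : Ω ∈ classI A₀ B₀ (φ x₀)) :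
    baseChange φ Ω ∈ classI A₀ B₀ x₀ := by
  refine ⟨h.1.baseChange hφ, h.2.1.baseChange hφ h.1, h.2.2.mono fun z hz ζ => ?_⟩
  rw [baseChange_apply, map_zero]
  exact hz ζ

theorem gauge_baseChange {φ : V → V'} {p : ℂ × V} {G : ℂ × V' → Mat n} {Ω : ConnForm n V'}
    (hφ : AnalyticAt ℂ φ p.2) (hG : DifferentiableAt ℂ G (prodMapSnd φ p)) (v : ℂ × V) :
    gauge (fun q => G (prodMapSnd φ q)) (baseChange φ Ω) p v =
      gauge G Ω (prodMapSnd φ p) (v.1, fderiv ℂ φ p.2 v.2) := by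
  have h : fderiv ℂ (fun q => G (prodMapSnd φ q)) p = _ :=
    fderiv_comp (g := G) p hG (analyticAt_prodMapSnd hφ).differentiableAt
  rw [gauge, gauge, h, ContinuousLinearMap.comp_apply, fderiv_prodMapSnd hφ.differentiableAt,
    baseChange_apply]

theorem birkhoffForm_baseChange (φ : V → V') (A : V' → Mat n) (B : Mat n)
    (C : V' → (V' →ₗ[ℂ] Mat n)) :
    birkhoffForm (fun x => A (φ x)) B (pullbackForm φ C) = baseChange φ (birkhoffForm A B C) := rfl

theorem IsPoleAndDeformationPart.baseChange [FiniteDimensional ℂ V'] {φ : V → V'} {x₀ : V}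
    {A₀ B₀ : Mat n} {Ω : ConnForm n V'} {A : V' → Mat n} {C : V' → (V' →ₗ[ℂ] Mat n)}
    (hφ : AnalyticAt ℂ φ x₀) (h : IsPoleAndDeformationPart A₀ B₀ (φ x₀) Ω A C) :
    IsPoleAndDeformationPart A₀ B₀ x₀ (baseChange φ Ω) (fun x => A (φ x)) (pullbackForm φ C) := by
  obtain ⟨G, hG, hG1, hgauge⟩ := h.exists_frame
  have ht := tendsto_prodMapSnd hφ.continuousAt
  refine ⟨AnalyticAt.comp (g := A) h.analyticAt_pole hφ, analyticAt_pullbackForm hφ h.analyticAt_def,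
    h.pole_base, fun q => G (prodMapSnd φ q), ?_, hG1, ?_⟩
  · obtain ⟨g, hg, hu, hGg⟩ := hG
    exact ⟨fun q => g (prodMapSnd φ q),
      AnalyticAt.comp (g := g) (x := (0, x₀)) hg (analyticAt_prodMapSnd hφ), hu, ht.eventually hGg⟩
  · filter_upwards [ht.eventually hgauge, ht.eventually hG.eventually,
      eventually_nearInfinity_of_nhds_snd hφ.eventually_analyticAt] with p h1 h2 h3 v
    rw [gauge_baseChange h3 h2.1.differentiableAt, h1]
    rfl

theorem IsLocDiagonalizable.comp {φ : V → V'} {x₀ : V} {A : V' → Mat n} (hφ : AnalyticAt ℂ φ x₀)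
    (h : IsLocDiagonalizable (φ x₀) A) : IsLocDiagonalizable x₀ fun x => A (φ x) := by
  obtain ⟨Δ, P, hP, hu, hΔ, hform⟩ := h
  exact ⟨fun x => Δ (φ x), fun x => P (φ x), AnalyticAt.comp (g := P) hP hφ, hu,
    AnalyticAt.comp (g := Δ) hΔ hφ, hφ.continuousAt.eventually hform⟩

theorem IsLocDiagonalizableForm.pullback {φ : V → V'} {x₀ : V} {C : V' → (V' →ₗ[ℂ] Mat n)}
    (hφ : AnalyticAt ℂ φ x₀) (h : IsLocDiagonalizableForm (φ x₀) C) :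
    IsLocDiagonalizableForm x₀ (pullbackForm φ C) := by
  obtain ⟨P, hP, hu, hform⟩ := h
  exact ⟨fun x => P (φ x), AnalyticAt.comp (g := P) hP hφ, hu,
    (hφ.continuousAt.eventually hform).mono fun x hx v => hx _⟩

theorem exists_open_analyticOnNhd [FiniteDimensional ℂ V'] {φ : V → V'} {x₀ : V}
    (hφ : AnalyticAt ℂ φ x₀) {U : Set V'}
    (hU : IsOpen U) (hx₀ : φ x₀ ∈ U) :
    ∃ U' : Set V, IsOpen U' ∧ x₀ ∈ U' ∧ AnalyticOnNhd ℂ φ U' ∧ ∀ x ∈ U', φ x ∈ U := by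
  have : CompleteSpace V' := FiniteDimensional.complete ℂ V'
  obtain ⟨U', h1, h2, h3⟩ := eventually_nhds_iff.1
    (hφ.eventually_analyticAt.and (hφ.continuousAt.eventually_mem (hU.mem_nhds hx₀)))
  exact ⟨U', h2, h3, fun x hx => (h1 x hx).1, fun x hx => (h1 x hx).2⟩

theorem fderiv_comp_apply_comp {W : Type*} [NormedAddCommGroup W] [NormedSpace ℂ W] {φ : V → V'} {x : V}
    {F : V' → W} (hF : DifferentiableAt ℂ F (φ x)) (hφ : DifferentiableAt ℂ φ x) (v : V) :
    fderiv ℂ (fun y => F (φ y)) x v = fderiv ℂ F (φ x) (fderiv ℂ φ x v) := by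
  have h : fderiv ℂ (fun y => F (φ y)) x = _ := fderiv_comp (g := F) x hF hφ
  rw [h]
  rfl

theorem IsProjectiveFrame.comp {φ : V → V'} {U : Set V'} {U' : Set V} {G : ℂ × V' → Mat n}
    (hφ : AnalyticOnNhd ℂ φ U') (hU' : ∀ x ∈ U', φ x ∈ U) (h : IsProjectiveFrame U G) :
    IsProjectiveFrame U' fun q => G (prodMapSnd φ q) := by
  obtain ⟨⟨hG, hGu⟩, H, ⟨hH, hHu⟩, hGH⟩ := h
  have hcomp : ∀ {F : ℂ × V' → Mat n}, AnalyticOnNhd ℂ F (Set.univ ×ˢ U) →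
      AnalyticOnNhd ℂ (fun q => F (prodMapSnd φ q)) (Set.univ ×ˢ U') := fun {F} hF p hp =>
    AnalyticAt.comp (g := F) (hF _ ⟨trivial, hU' _ hp.2⟩) (analyticAt_prodMapSnd (hφ _ hp.2))
  exact ⟨⟨hcomp hG, fun p hp => hGu _ (hU' _ hp)⟩, fun q => H (prodMapSnd φ q),
    ⟨hcomp hH, fun p hp => hHu _ (hU' _ hp)⟩, fun p hp => hGH (prodMapSnd φ p) (hU' _ hp)⟩

variable [FiniteDimensional ℂ V']

theorem classD_closedUnderBaseChange (A₀ B₀ : Mat n) :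
    ClosedUnderBaseChange (V := V) (V' := V') (fun x => classD A₀ B₀ x) fun x => classD A₀ B₀ x := by
  rintro x₀ _ φ hφ rfl Ω ⟨hΩ, A, C, h, hA, hC⟩
  exact ⟨baseChange_mem_classI hφ hΩ, _, _, h.baseChange hφ, hA.comp hφ, hC.pullback hφ⟩

/-- The differential of Δ ∘ φ is the pull-back of dΔ, so the bracket relations for 𝓑 and ϖ pull back
with the same construction of L, and the frame over ℙ¹ pulls back fibrewise. -/
theorem classDv_closedUnderBaseChange (A₀ B₀ : Mat n) :
    ClosedUnderBaseChange (V := V) (V' := V') (fun x => classDv A₀ B₀ x) fun x => classDv A₀ B₀ x := by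
  rintro x₀ _ φ hφ rfl Ω ⟨hΩ, A, C, h, hA, hC, U, hU, hx₀, G, hG, Δ, N, L, ϖ, hΔ, hN, hL, hϖ, hgauge,
    hform⟩
  obtain ⟨U', hU'o, hx₀', hφ', hU'⟩ := exists_open_analyticOnNhd hφ hU hx₀
  have hcomp : ∀ {F : V' → Mat n}, AnalyticOnNhd ℂ F U → AnalyticOnNhd ℂ (fun x => F (φ x)) U' :=
    fun {F} hF x hx => AnalyticAt.comp (g := F) (hF _ (hU' x hx)) (hφ' x hx)
  have hdΔ : ∀ x ∈ U', ∀ v, fderiv ℂ (fun y => Δ (φ y)) x v = fderiv ℂ Δ (φ x) (fderiv ℂ φ x v) :=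
    fun x hx v => fderiv_comp_apply_comp (hΔ _ (hU' x hx)).differentiableAt (hφ' x hx).differentiableAt v
  refine ⟨baseChange_mem_classI hφ hΩ, _, _, h.baseChange hφ, hA.comp hφ, hC.pullback hφ, U', hU'o, hx₀',
    fun q => G (prodMapSnd φ q), hG.comp hφ' hU', fun x => Δ (φ x), fun x => N (φ x), fun x => L (φ x),
    pullbackForm φ ϖ, hcomp hΔ, hcomp hN, hcomp hL,
    fun v x hx => analyticAt_pullbackForm (hφ' x hx) (fun u => hϖ u _ (hU' x hx)) v, fun p hp hp0 v => ?_,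
    fun x hx => ?_⟩
  · rw [birkhoffForm_baseChange, gauge_baseChange (hφ' _ hp)
      (hG.1.1 _ ⟨trivial, hU' _ hp⟩).differentiableAt, hgauge _ (hU' _ hp) hp0]
    rw [dzdx_apply, dzdx_apply]
    congr 1
    change -(p.1 • fderiv ℂ Δ (φ p.2) (fderiv ℂ φ p.2 v.2)) + ϖ (φ p.2) (fderiv ℂ φ p.2 v.2) =
      -(p.1 • fderiv ℂ (fun y => Δ (φ y)) p.2 v.2) + ϖ (φ p.2) (fderiv ℂ φ p.2 v.2)
    rw [hdΔ _ hp]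
  · obtain ⟨h1, h2, h3, h4⟩ := hform _ (hU' x hx)
    refine ⟨h1, h2, h3, fun v => ?_⟩
    rw [hdΔ x hx, pullbackForm_apply]
    exact h4 _

theorem classFs_closedUnderBaseChange (A₀ B₀ : Mat n) :
    ClosedUnderBaseChange (V := V) (V' := V') (fun x => classFs A₀ B₀ x) fun x => classFs A₀ B₀ x := by
  rintro x₀ _ φ hφ rfl Ω ⟨hΩ, A, C, h, U, hU, hx₀, Φ, Δ, B', hΦ, hu, hΔ, hdiag, hB', hform⟩
  obtain ⟨U', hU'o, hx₀', hφ', hU'⟩ := exists_open_analyticOnNhd hφ hU hx₀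
  have hcomp : ∀ {F : V' → Mat n}, AnalyticOnNhd ℂ F U → AnalyticOnNhd ℂ (fun x => F (φ x)) U' :=
    fun {F} hF x hx => AnalyticAt.comp (g := F) (hF _ (hU' x hx)) (hφ' x hx)
  have hd : ∀ {F : V' → Mat n}, AnalyticOnNhd ℂ F U → ∀ x ∈ U', ∀ v,
      fderiv ℂ (fun y => F (φ y)) x v = fderiv ℂ F (φ x) (fderiv ℂ φ x v) :=
    fun hF x hx v => fderiv_comp_apply_comp (hF _ (hU' x hx)).differentiableAt
      (hφ' x hx).differentiableAt v
  refine ⟨baseChange_mem_classI hφ hΩ, _, _, h.baseChange hφ, U', hU'o, hx₀', fun k x => Φ k (φ x),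
    fun x => Δ (φ x), B', fun k => hcomp (hΦ k), fun x hx => hu _ (hU' x hx), hcomp hΔ,
    fun x hx => hdiag _ (hU' x hx), hB', fun x hx => ?_⟩
  obtain ⟨h1, h2, h3, h4⟩ := hform _ (hU' x hx)
  refine ⟨h1, h2, fun v => ?_, fun k v => ?_⟩
  · rw [hd hΔ x hx]
    exact h3 _
  · rw [hd hΔ x hx, hd (hΦ k) x hx]
    exact h4 k _

end BaseChange

end RHB

end

theorem mainTheorem4 {V V' : Type*}
    [NormedAddCommGroup V] [NormedSpace ℂ V] [FiniteDimensional ℂ V]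
    [NormedAddCommGroup V'] [NormedSpace ℂ V'] [FiniteDimensional ℂ V']
    {n : ℕ} (Aₒ Bₒ : Matrix (Fin n) (Fin n) ℂ) :
    (RHB.ClosedUnderBaseChange (V := V) (V' := V')
        (fun x => RHB.classD Aₒ Bₒ x) (fun x => RHB.classD Aₒ Bₒ x) ∧
      RHB.ClosedUnderBaseChange (V := V) (V' := V')
        (fun x => RHB.classDv Aₒ Bₒ x) (fun x => RHB.classDv Aₒ Bₒ x) ∧
      RHB.ClosedUnderBaseChange (V := V) (V' := V')
        (fun x => RHB.classFs Aₒ Bₒ x) (fun x => RHB.classFs Aₒ Bₒ x)) ∧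
    (∀ xₒ : V,
      RHB.classFs Aₒ Bₒ xₒ ⊆ RHB.classDv Aₒ Bₒ xₒ ∧
      RHB.classDgen Aₒ Bₒ xₒ ⊆ RHB.classDv Aₒ Bₒ xₒ ∧
      RHB.classDv Aₒ Bₒ xₒ ⊆ RHB.classD Aₒ Bₒ xₒ ∧
      RHB.classD Aₒ Bₒ xₒ ⊆ RHB.classI Aₒ Bₒ xₒ) ∧
    (Aₒ ∈ RHB.Mreg n ∩ RHB.Mdiag n → ∀ xₒ : V,
      RHB.classFs Aₒ Bₒ xₒ = RHB.classDv Aₒ Bₒ xₒ ∧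
      RHB.classDv Aₒ Bₒ xₒ = RHB.classD Aₒ Bₒ xₒ ∧
      RHB.classD Aₒ Bₒ xₒ = RHB.classI Aₒ Bₒ xₒ) := by
  refine ⟨⟨RHB.classD_closedUnderBaseChange Aₒ Bₒ, RHB.classDv_closedUnderBaseChange Aₒ Bₒ,
    RHB.classFs_closedUnderBaseChange Aₒ Bₒ⟩, fun xₒ => ⟨RHB.classFs_subset_classDv Aₒ Bₒ xₒ,
    RHB.classDgen_subset_classDv Aₒ Bₒ xₒ, RHB.classDv_subset_classD Aₒ Bₒ xₒ,
    RHB.classD_subset_classI Aₒ Bₒ xₒ⟩, fun hA xₒ => ?_⟩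
  have h1 := RHB.classFs_subset_classDv Aₒ Bₒ xₒ
  have h2 := RHB.classDv_subset_classD Aₒ Bₒ xₒ
  have h3 := RHB.classD_subset_classI Aₒ Bₒ xₒ
  -- This inclusion closes the chain into a cycle, so the four classes coincide.
  have h4 := RHB.classI_subset_classFs (B₀ := Bₒ) hA xₒ
  exact ⟨h1.antisymm (h2.trans (h3.trans h4)), h2.antisymm (h3.trans (h4.trans h1)),
    h3.antisymm (h4.trans (h1.trans h2))⟩
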